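/- Let $\lambda>0$ and $P\in\mathbb R$. A function $\psi\in H^1(\mathbb T)$, $\mathbb T=\mathbb R/2\pi\mathbb Z$ (continuous representative), is called a \emph{solution} with pressure $P$ if $$2(\lambda-1)P=-(2\lambda-1)(\psi')^2+\lambda^2\psi^2-\lambda\,\psi\psi'\,\partial_\theta$$ in the sense of distributions on $\mathbb T$, i.e. $$2(\lambda-1)P\int_{\mathbb T}\varphi\,d\theta=\int_{\mathbb T}\bigl[(-(2\lambda-1)(\psi')^2+\lambda^2\psi^2)\varphi-\lambda\psi\psi'\varphi'\bigr]d\theta\qquad\text{for all }\varphi\in C^\infty(\mathbb T).$$ (This is the equation for the $(\lambda-1)$-homogeneous stationary Euler flow with stream function $\Psi=r^\lambda\psi(\theta)$ and pressure $p=r^{2\lambda-2}P$.) A solution is \emph{hyperbolic} if it vanishes at two or more points of $\mathbb T$ and is not a parallel shear flow, i.e. not, up to rotation, of the form $|\cos\theta|^\lambda(A\,1_{\cos\theta>0}+C\,1_{\cos\theta\le0})$ with $A,C\in\mathbb R$; it is \emph{parabolic} if it vanishes at exactly one point of $\mathbb T$. A \emph{local solution} is a pair $(\psi,(a,b))$ with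 $a<b$ real and $\psi\in H^1(a,b)$ solving the same equation in the sense of distributions on $(a,b)$, with $\psi\neq0$ on $(a,b)$ and $\psi(a)=\psi(b)=0$; its \emph{life-span} is $T=b-a$. Hyperbolic solutions: \begin{itemize} \item If $\frac12<\lambda<1$, then for every $P>0$ there are infinitely many hyperbolic solutions with pressure $P$, no two of which are related by rotation, reflection and multiplication by nonzero constants; for $P<0$ there are none. \item If $0<\lambda\le\frac12$, there are no hyperbolic solutions, for any $P\in\mathbb R$. \item If $\lambda>1$, then for every $P<0$ there are infinitely many hyperbolic solutions with pressure $P$, no two of which are related by these symmetries; for $P>0$ there are none. \end{itemize} Life-spans: every local solution is differentiable on $(a,b)$ and has a Bernoulli constant, i.e. $(2P+\lambda^2\psi^2+(\psi')^2)\,|\psi|^{\frac2\lambda-2}$ equals a constant $B$ on $(a,b)$. \begin{itemize} \item If $\lambda>1$ and $P<0$, then for every $B\in\mathbb R$ local solutions with pressure $P$ and Bernoulli constant $B$ exist and all have the same life-span $T(B)$. The range of $T$ over $B>0$ is exactly $(\frac\pi\lambda,\pi)$, $T(0)=\frac\pi\lambda$, and the range over $B<0$ is exactly $(0,\frac\pi\lambda)$.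 \item If $\frac12<\lambda<1$ and $P>0$, then every local solution has $B>0$; for every $B>0$ local solutions exist and all have the same life-span $T(B)$, and the range of $T$ over $B>0$ is exactly $(0,\pi)$. \item If $\frac12<\lambda<1$, $P<0$ and $B>0$, every local solution has life-span in $(\pi,\frac\pi\lambda)$. \item If $0<\lambda\le\frac12$, there is no local solution with $B>0$, for any $P\in\mathbb R$. \end{itemize} Parabolic solutions: for $\lambda>0$ and $P\in\mathbb R$, $\psi$ is a parabolic solution with pressure $P$ if and only if $\lambda=\frac12$ and, for some $\gamma>0$ and $\theta_0\in\mathbb R$, $P=-\frac\gamma4$ and $\psi(\theta)=\sqrt{\gamma+\gamma\cos(\theta-\theta_0)}$ for all $\theta$ or $\psi(\theta)=-\sqrt{\gamma+\gamma\cos(\theta-\theta_0)}$ for all $\theta$. -/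

import Mathlib

open Real Set MeasureTheory
open scoped ContDiff

namespace HomEuler

/-- `ψ` is (the continuous representative of) an element of `H¹(a,b)` with weak derivative `g`:
`g ∈ L²(a,b)` and `ψ` is a primitive of `g` on `[a,b]`. -/
def IsH1On (ψ g : ℝ → ℝ) (a b : ℝ) : Prop :=
  MemLp g 2 (volume.restrict (Ioo a b)) ∧
    ∀ x ∈ Icc a b, ∀ y ∈ Icc a b, ψ y - ψ x = ∫ t in x..y, g t

/-- The identity `2(λ-1)P = -(2λ-1)(ψ')² + λ²ψ² - λψψ'∂_θ`, with `ψ' = g`, tested against `φ`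
on `(a,b)`. -/
def WeakIdentity (lam P : ℝ) (ψ g φ : ℝ → ℝ) (a b : ℝ) : Prop :=
  ∫ θ in a..b, 2 * (lam - 1) * P * φ θ =
    ∫ θ in a..b, ((-(2 * lam - 1) * g θ ^ 2 + lam ^ 2 * ψ θ ^ 2) * φ θ
      - lam * ψ θ * g θ * deriv φ θ)

/-- `ψ ∈ H¹(𝕋)`, viewed as a `2π`-periodic function on `ℝ`, is a distributional solution on the
whole circle with pressure `P`, so that `Ψ = r^λ ψ(θ)` is the stream function. -/
def IsSolution (lam P : ℝ) (ψ : ℝ → ℝ) : Prop :=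
  Function.Periodic ψ (2 * π) ∧
    ∃ g : ℝ → ℝ, IsH1On ψ g 0 (2 * π) ∧
      ∀ φ : ℝ → ℝ, ContDiff ℝ ∞ φ → Function.Periodic φ (2 * π) →
        WeakIdentity lam P ψ g φ 0 (2 * π)

/-- `(ψ, (a,b))` is a local solution with pressure `P`: `ψ ∈ H¹(a,b)` solves the equation on
`(a,b)` in the sense of distributions and `(a,b)` is a life-time of `ψ`. Its life-span is
`b - a`. -/
def IsLocalSolution (lam P : ℝ) (ψ : ℝ → ℝ) (a b : ℝ) : Prop :=
  a < b ∧ ψ a = 0 ∧ ψ b = 0 ∧ (∀ θ ∈ Ioo a b, ψ θ ≠ 0) ∧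
    ∃ g : ℝ → ℝ, IsH1On ψ g a b ∧
      ∀ φ : ℝ → ℝ, ContDiff ℝ ∞ φ → HasCompactSupport φ → tsupport φ ⊆ Ioo a b →
        WeakIdentity lam P ψ g φ a b

/-- `ψ` is differentiable on `(a,b)` and its Bernoulli function
`(2P + λ²ψ² + (ψ')²)|ψ|^(2/λ-2)` is constant there, equal to `B`. -/
def HasBernoulli (lam P B : ℝ) (ψ : ℝ → ℝ) (a b : ℝ) : Prop :=
  ∀ θ ∈ Ioo a b, DifferentiableAt ℝ ψ θ ∧
    (2 * P + lam ^ 2 * ψ θ ^ 2 + deriv ψ θ ^ 2) * |ψ θ| ^ (2 / lam - 2) = B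

/-- For every `B ∈ S` there are local solutions with pressure `P` and Bernoulli constant `B`,
and all of them have life-span `T B`. -/
def IsLifeSpanFunction (lam P : ℝ) (S : Set ℝ) (T : ℝ → ℝ) : Prop :=
  ∀ B ∈ S,
    (∃ (ψ : ℝ → ℝ) (a b : ℝ), IsLocalSolution lam P ψ a b ∧ HasBernoulli lam P B ψ a b) ∧
    ∀ (ψ : ℝ → ℝ) (a b : ℝ), IsLocalSolution lam P ψ a b → HasBernoulli lam P B ψ a b →
      b - a = T B

/-- Parallel shear flow: up to rotation `Ψ = |x|^λ (A 1_{x>0} + C 1_{x≤0})`. -/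
def IsParallelShear (lam : ℝ) (ψ : ℝ → ℝ) : Prop :=
  ∃ A C θ₀ : ℝ, ∀ θ : ℝ,
    ψ θ = |cos (θ - θ₀)| ^ lam * (if 0 < cos (θ - θ₀) then A else C)

/-- A hyperbolic solution: it vanishes at two or more points of the circle and is not a parallel
shear flow. -/
def IsHyperbolic (lam P : ℝ) (ψ : ℝ → ℝ) : Prop :=
  IsSolution lam P ψ ∧
    (∃ θ₁ ∈ Ico 0 (2 * π), ∃ θ₂ ∈ Ico 0 (2 * π), θ₁ ≠ θ₂ ∧ ψ θ₁ = 0 ∧ ψ θ₂ = 0) ∧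
    ¬ IsParallelShear lam ψ

/-- A (proper) parabolic solution: it vanishes at exactly one point of the circle. -/
def IsParabolic (lam P : ℝ) (ψ : ℝ → ℝ) : Prop :=
  IsSolution lam P ψ ∧ ∃! θ : ℝ, θ ∈ Ico 0 (2 * π) ∧ ψ θ = 0

/-- Equivalence under the symmetries rotation, scaling and reflection. -/
def SymEquiv (ψ₁ ψ₂ : ℝ → ℝ) : Prop :=
  ∃ α σ θ₀ : ℝ, α ≠ 0 ∧ (σ = 1 ∨ σ = -1) ∧ ∀ θ : ℝ, ψ₂ θ = α * ψ₁ (σ * θ + θ₀)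

/-- There are infinitely many hyperbolic solutions with pressure `P`, no two of which are
related by the symmetries. -/
def InfinitelyManyHyperbolic (lam P : ℝ) : Prop :=
  ∃ ψ : ℕ → ℝ → ℝ, (∀ n, IsHyperbolic lam P (ψ n)) ∧
    ∀ m n, m ≠ n → ¬ SymEquiv (ψ m) (ψ n)

end HomEuler

namespace HomEuler

open Filter Topology intervalIntegral

/-! The equation prescribes the distributional derivative of the flux `λψψ'`. By du Bois-Reymond the
flux is absolutely continuous, so `ψ` is C¹ where it does not vanish, and differentiating the
Bernoulli function shows that it is conserved. The flux tends to zero at the left end of a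
life-time, since a nonzero limit would make `ψ'²` at least of order `1/(x-a)` (`flux_eq_zero`).
Letting `ψ → 0` in the Bernoulli law gives `B ≥ 0` for `λ < 1` and `P ≤ 0` for `λ > 1`; together
with the vanishing flux it gives `B = 0` for `λ ≤ 1/2`. When `B = 0` the profile solves a harmonic
oscillator and has life-span `π/λ`.

In general let `M` be the maximum of `|ψ|`, `v = (|ψ|/M)^(1/λ)` and `κ = 2P/(λM)²`. Once plateaus
are excluded, `v` rises from 0 to 1 and falls back, with `(v')² = F(v) = 1 - v² + κ(1 - v^(2-2λ))`.
Its life-span is `2∫₀¹ dv/√F`; the mean value identity `IsBump.exists_mean_value` replaces this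
improper integral. If `P(1-λ) ≥ 0`, the substitution `v = sin p` turns the integrand into one
bounded by 1 and decreasing in `s = |κ|`. For `λ ≠ 1` the life-span therefore decreases strictly and
continuously from `π` at `s = 0` to `0` at infinity. For `λ > 1` the value `s = 1` is the case `B =
0`, with life-span `π/λ`, and it separates the two signs of `B`. Since `B` is strictly increasing in
`M`, the life-span is a function of `B`. If `λ < 1`, `P < 0` and `B > 0`, then `-1 < κ < 0`, and
comparing `F` with its values at `κ = 0` and `κ = -1` puts the life-span between `π` and `π/λ`.

For existence of hyperbolic solutions, `N ≥ 3` copies of a profile with life-span `2π/N < π` are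
glued; the spacing of the zeros separates the symmetry classes. For non-existence, two zeros on the
circle leave an arc of length at most `π` between consecutive zeros, which the life-span bounds or
the sign of the pressure forbid. A parabolic solution is one profile of life-span exactly `2π`; for
`λ > 1/2` life-spans are shorter, and for `λ ≤ 1/2` they equal `π/λ`, so `λ = 1/2` and the cosine
formula applies. -/

/-! ### Test functions and the lemma of du Bois-Reymond. -/

lemma contDiff_infty_primitive {θ : ℝ → ℝ} (hθ : ContDiff ℝ ∞ θ) (a : ℝ) :
    ContDiff ℝ ∞ (fun x => ∫ t in a..x, θ t) := by
  have hd : ∀ x, HasDerivAt (fun x => ∫ t in a..x, θ t) (θ x) x := fun x =>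
    integral_hasDerivAt_right (hθ.continuous.intervalIntegrable _ _)
      (hθ.continuous.stronglyMeasurableAtFilter _ _) hθ.continuous.continuousAt
  rw [contDiff_infty_iff_deriv]
  refine ⟨fun x => (hd x).differentiableAt, ?_⟩
  rwa [show deriv (fun x => ∫ t in a..x, θ t) = θ from funext fun x => (hd x).deriv]

/-- A mean-zero test function on `(a,b)` has a primitive that is a test function on `(a,b)`. -/
lemma tsupport_primitive_subset {θ : ℝ → ℝ} {a b : ℝ} (hθ : Continuous θ)
    (hc : HasCompactSupport θ) (hs : tsupport θ ⊆ Ioo a b) (h0 : ∫ t in a..b, θ t = 0) :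
    HasCompactSupport (fun x => ∫ t in a..x, θ t) ∧
      tsupport (fun x => ∫ t in a..x, θ t) ⊆ Ioo a b := by
  rcases (tsupport θ).eq_empty_or_nonempty with he | hne
  · have : θ = 0 := by simpa [tsupport_eq_empty_iff] using he
    subst this
    have h : (fun x => ∫ t in a..x, (0 : ℝ → ℝ) t) = 0 := by ext x; simp
    rw [h]
    refine ⟨HasCompactSupport.zero, ?_⟩
    rw [tsupport_eq_empty_iff.2 rfl]
    exact empty_subset _
  obtain ⟨a', ha'⟩ := hc.isCompact.exists_isLeast hne
  obtain ⟨b', hb'⟩ := hc.isCompact.exists_isGreatest hne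
  have hz : ∀ t, t ∉ Icc a' b' → θ t = 0 := fun t ht => by
    by_contra h
    have : t ∈ tsupport θ := subset_tsupport _ h
    exact ht ⟨ha'.2 this, hb'.2 this⟩
  have hsub : tsupport (fun x => ∫ t in a..x, θ t) ⊆ Icc a' b' := by
    refine closure_minimal (fun x hx => ?_) isClosed_Icc
    by_contra hxn
    apply hx
    rcases lt_or_ge x a' with h | h
    · refine integral_zero_ae (ae_of_all _ fun t ht => hz t fun h' => ?_)
      have := (hs ha'.1).1
      rcases mem_uIoc.1 ht with h2 | h2 <;> linarith [h'.1, h2.2]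
    · have hxb : b' < x := by
        by_contra hxb
        exact hxn ⟨h, not_lt.1 hxb⟩
      have : ∫ t in b..x, θ t = 0 := by
        refine integral_zero_ae (ae_of_all _ fun t ht => hz t fun h' => ?_)
        have := (hs hb'.1).2
        rcases mem_uIoc.1 ht with h2 | h2 <;> linarith [h'.2, h2.1]
      have h3 := integral_add_adjacent_intervals (hθ.intervalIntegrable (μ := volume) a b)
        (hθ.intervalIntegrable b x)
      simp only [h0, this, add_zero] at h3
      exact h3.symm
  exact ⟨HasCompactSupport.of_support_subset_isCompact isCompact_Icc
      ((subset_tsupport _).trans hsub),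
    hsub.trans fun x hx => ⟨(hs ha'.1).1.trans_le hx.1, hx.2.trans_lt (hs hb'.1).2⟩⟩

lemma exists_test_function_integral_eq_one {a b : ℝ} (hab : a < b) :
    ∃ η : ℝ → ℝ, ContDiff ℝ ∞ η ∧ HasCompactSupport η ∧ tsupport η ⊆ Ioo a b ∧
      ∫ x in a..b, η x = 1 := by
  let B : ContDiffBump ((a + b) / 2) := ⟨(b - a) / 8, (b - a) / 4, by linarith, by linarith⟩
  have ht : tsupport (B.normed volume) ⊆ Ioo a b := by
    rw [B.tsupport_normed_eq, Real.closedBall_eq_Icc]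
    intro x hx
    have hr : B.rOut = (b - a) / 4 := rfl
    rw [hr] at hx
    exact ⟨by linarith [hx.1], by linarith [hx.2]⟩
  refine ⟨B.normed volume, B.contDiff_normed, B.hasCompactSupport_normed, ht, ?_⟩
  rw [integral_eq_integral_of_support_subset, B.integral_normed]
  exact (subset_tsupport _).trans (ht.trans Ioo_subset_Ioc_self)

/-- The lemma of du Bois-Reymond. -/
lemma ae_eq_const_of_integral_mul_deriv_eq_zero {f : ℝ → ℝ} {a b : ℝ} (hab : a < b)
    (hf : IntervalIntegrable f volume a b)
    (h : ∀ φ : ℝ → ℝ, ContDiff ℝ ∞ φ → HasCompactSupport φ → tsupport φ ⊆ Ioo a b →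
      ∫ x in a..b, f x * deriv φ x = 0) :
    ∃ c, ∀ᵐ x, x ∈ Ioo a b → f x = c := by
  obtain ⟨η₀, h1s, h1c, h1t, h1i⟩ := exists_test_function_integral_eq_one hab
  have key : ∀ η : ℝ → ℝ, tsupport η ⊆ Ioo a b → ∀ k : ℝ → ℝ,
      ∫ x, η x * k x = ∫ x in a..b, η x * k x := fun η hη k => by
    symm
    apply integral_eq_integral_of_support_subset
    intro x hx
    have hx' : η x ≠ 0 := left_ne_zero_of_mul hx
    exact Ioo_subset_Ioc_self (hη (subset_tsupport _ hx'))
  set c := ∫ x in a..b, f x * η₀ x with hc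
  refine ⟨c, ?_⟩
  have hloc : LocallyIntegrableOn (fun x => f x - c) (Ioo a b) volume := by
    apply IntegrableOn.locallyIntegrableOn
    refine Integrable.sub ?_ (by simp)
    exact ((intervalIntegrable_iff_integrableOn_Ioo_of_le hab.le).1 hf)
  have := isOpen_Ioo.ae_eq_zero_of_integral_contDiff_smul_eq_zero hloc fun η hη hηc hηs => ?_
  · filter_upwards [this] with x hx hxm
    linarith [hx hxm]
  · simp only [smul_eq_mul]
    rw [key η hηs]
    set I := ∫ x in a..b, η x with hI
    -- Subtracting `I * η₀` makes the mean zero, so the result is the derivative of an admissible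
    -- test function.
    set θ : ℝ → ℝ := fun x => η x - I * η₀ x with hθ
    have hθs : ContDiff ℝ ∞ θ := hη.sub (contDiff_const.mul h1s)
    have hts : tsupport θ ⊆ tsupport η ∪ tsupport η₀ := by
      refine closure_minimal (fun x hx => ?_) ((isClosed_tsupport _).union (isClosed_tsupport _))
      by_contra hx2
      rw [mem_union, not_or] at hx2
      apply hx
      simp [hθ, image_eq_zero_of_notMem_tsupport hx2.1, image_eq_zero_of_notMem_tsupport hx2.2]
    have hθc : HasCompactSupport θ :=
      HasCompactSupport.of_support_subset_isCompact (hηc.isCompact.union h1c.isCompact)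
        ((subset_tsupport _).trans hts)
    have hθ0 : ∫ x in a..b, θ x = 0 := by
      have : ∫ x in a..b, θ x = I - ∫ x in a..b, I * η₀ x :=
        integral_sub (hη.continuous.intervalIntegrable _ _)
          ((h1s.continuous.intervalIntegrable _ _).const_mul I)
      rw [this, intervalIntegral.integral_const_mul, h1i]
      ring
    obtain ⟨h2, h3⟩ := tsupport_primitive_subset hθs.continuous hθc
      (hts.trans (union_subset hηs h1t)) hθ0
    have h4 := h _ (contDiff_infty_primitive hθs a) h2 h3
    have h5 : deriv (fun x => ∫ t in a..x, θ t) = θ := funext fun x =>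
      (integral_hasDerivAt_right (hθs.continuous.intervalIntegrable _ _)
        (hθs.continuous.stronglyMeasurableAtFilter _ _) hθs.continuous.continuousAt).deriv
    rw [h5] at h4
    have e1 : IntervalIntegrable (fun x => f x * η x) volume a b :=
      hf.mul_continuousOn hη.continuous.continuousOn
    have e2 : IntervalIntegrable (fun x => f x * η₀ x) volume a b :=
      hf.mul_continuousOn h1s.continuous.continuousOn
    have e3 : ∫ x in a..b, f x * θ x = (∫ x in a..b, f x * η x) - I * c := by
      rw [hc, ← intervalIntegral.integral_const_mul, ← integral_sub e1 (e2.const_mul I)]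
      congr 1; ext x; simp only [hθ]; ring
    have e4 : ∫ x in a..b, η x * (f x - c) = (∫ x in a..b, f x * η x) - c * I := by
      rw [hI, ← intervalIntegral.integral_const_mul,
        ← integral_sub e1 ((hη.continuous.intervalIntegrable _ _).const_mul c)]
      congr 1; ext x; ring
    rw [e4]; linarith

lemma absolutelyContinuousOnInterval_of_contDiff {φ : ℝ → ℝ} (hφ : ContDiff ℝ ∞ φ) (a b : ℝ) :
    AbsolutelyContinuousOnInterval φ a b :=
  (hφ.of_le (by simp)).contDiffOn.absolutelyContinuousOnInterval

/-- Integrating the `h` term by parts moves the derivative onto `φ`, which reduces the claim to du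
Bois-Reymond for `f - ∫ h`. The boundary terms vanish because `φ` does at both ends. -/
lemma ae_eq_primitive_of_integral_eq_zero {f h : ℝ → ℝ} {a b : ℝ} (hab : a < b)
    (hf : IntervalIntegrable f volume a b) (hh : IntervalIntegrable h volume a b)
    (H : ∀ φ : ℝ → ℝ, ContDiff ℝ ∞ φ → HasCompactSupport φ → tsupport φ ⊆ Ioo a b →
      ∫ x in a..b, (h x * φ x + f x * deriv φ x) = 0) :
    ∃ c, ∀ᵐ x, x ∈ Ioo a b → f x = c + ∫ t in a..x, h t := by
  have hac := hh.absolutelyContinuousOnInterval_intervalIntegral (c := a) (by simp)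
  have hcont : ContinuousOn (fun x => ∫ t in a..x, h t) (uIcc a b) := hac.continuousOn
  have hci : IntervalIntegrable (fun x => ∫ t in a..x, h t) volume a b :=
    hcont.intervalIntegrable
  have main : ∀ φ : ℝ → ℝ, ContDiff ℝ ∞ φ → HasCompactSupport φ → tsupport φ ⊆ Ioo a b →
      ∫ x in a..b, (f x - ∫ t in a..x, h t) * deriv φ x = 0 := by
    intro φ hφ hφc hφs
    have hφa : φ a = 0 := by
      by_contra hne
      exact lt_irrefl a (hφs (subset_tsupport _ hne)).1
    have hφb : φ b = 0 := by
      by_contra hne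
      exact lt_irrefl b (hφs (subset_tsupport _ hne)).2
    have h1 := hac.integral_mul_deriv_eq_deriv_mul
      (absolutelyContinuousOnInterval_of_contDiff hφ a b)
    have h2 : ∫ x in a..b, deriv (fun x => ∫ t in a..x, h t) x * φ x = ∫ x in a..b, h x * φ x := by
      apply intervalIntegral.integral_congr_ae
      filter_upwards [hh.ae_hasDerivAt_integral] with x hx hxm
      rw [(hx (uIoc_subset_uIcc hxm) a (by simp)).deriv]
    rw [h2, hφa, hφb] at h1
    have hφd : ContinuousOn (deriv φ) (uIcc a b) :=
      (hφ.continuous_deriv (by simp)).continuousOn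
    have h3 := H φ hφ hφc hφs
    rw [integral_add (hh.mul_continuousOn hφ.continuous.continuousOn)
      (hf.mul_continuousOn hφd)] at h3
    have h4 : ∫ x in a..b, (f x - ∫ t in a..x, h t) * deriv φ x =
        (∫ x in a..b, f x * deriv φ x) - ∫ x in a..b, (∫ t in a..x, h t) * deriv φ x := by
      rw [← integral_sub (hf.mul_continuousOn hφd) (hci.mul_continuousOn hφd)]
      congr 1; ext x; ring
    rw [h4, h1]
    linarith
  obtain ⟨c, hc⟩ := ae_eq_const_of_integral_mul_deriv_eq_zero hab (hf.sub hci) main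
  refine ⟨c, ?_⟩
  filter_upwards [hc] with x hx hxm
  have := hx hxm
  linarith

/-! ### Regularity of local solutions and the Bernoulli constant. -/

lemma IsH1On.intervalIntegrable {ψ g : ℝ → ℝ} {a b : ℝ} (h : IsH1On ψ g a b) (hab : a ≤ b) :
    IntervalIntegrable g volume a b := by
  rw [intervalIntegrable_iff_integrableOn_Ioo_of_le hab]
  exact h.1.integrable (by norm_num)

lemma IsH1On.intervalIntegrable_sq {ψ g : ℝ → ℝ} {a b : ℝ} (h : IsH1On ψ g a b) (hab : a ≤ b) :
    IntervalIntegrable (fun x => g x ^ 2) volume a b := by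
  rw [intervalIntegrable_iff_integrableOn_Ioo_of_le hab]
  exact h.1.integrable_sq

lemma IsH1On.continuousOn {ψ g : ℝ → ℝ} {a b : ℝ} (h : IsH1On ψ g a b) (hab : a ≤ b) :
    ContinuousOn ψ (Icc a b) := by
  have h1 : ContinuousOn (fun x => ψ a + ∫ t in a..x, g t) (Icc a b) := by
    have := ((h.intervalIntegrable hab).absolutelyContinuousOnInterval_intervalIntegral
      (c := a) (by simp)).continuousOn
    rw [uIcc_of_le hab] at this
    exact continuousOn_const.add this
  refine h1.congr fun x hx => ?_
  have := h.2 a (left_mem_Icc.2 hab) x hx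
  linarith

lemma hasDerivAt_primitive_of_continuousOn {k : ℝ → ℝ} {a b c θ : ℝ}
    (hk : ContinuousOn k (Ioo a b)) (hθ : θ ∈ Ioo a b) (hi : IntervalIntegrable k volume c θ) :
    HasDerivAt (fun x => ∫ t in c..x, k t) (k θ) θ :=
  integral_hasDerivAt_right hi (hk.stronglyMeasurableAtFilter isOpen_Ioo θ hθ)
    (hk.continuousAt (isOpen_Ioo.mem_nhds hθ))

/-- A function of class `H¹` whose weak derivative agrees with a continuous function is
continuously differentiable. -/
lemma IsH1On.hasDerivAt {ψ g k : ℝ → ℝ} {a b : ℝ} (h : IsH1On ψ g a b)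
    (hk : ContinuousOn k (Ioo a b)) (hgk : ∀ᵐ x, x ∈ Ioo a b → g x = k x) {θ : ℝ}
    (hθ : θ ∈ Ioo a b) : HasDerivAt ψ (k θ) θ := by
  have h1 := hasDerivAt_primitive_of_continuousOn hk hθ (IntervalIntegrable.refl (a := θ))
  refine (h1.const_add (ψ θ)).congr_of_eventuallyEq ?_
  filter_upwards [isOpen_Ioo.mem_nhds hθ] with y hy
  have h2 := h.2 θ (Ioo_subset_Icc_self hθ) y (Ioo_subset_Icc_self hy)
  have h3 : ∫ t in θ..y, g t = ∫ t in θ..y, k t := by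
    apply intervalIntegral.integral_congr_ae
    filter_upwards [hgk] with x hx hxm
    exact hx ((ordConnected_Ioo (a := a) (b := b)).uIcc_subset hθ hy (uIoc_subset_uIcc hxm))
  linarith

/-- The weak identity is a first-order distributional equation for the flux `λψψ'` with an
integrable right-hand side, so the flux has an absolutely continuous representative. -/
lemma exists_flux_of_weakIdentity {lam P : ℝ} {ψ g : ℝ → ℝ} {a b : ℝ} (hab : a < b)
    (h : IsH1On ψ g a b)
    (H : ∀ φ : ℝ → ℝ, ContDiff ℝ ∞ φ → HasCompactSupport φ → tsupport φ ⊆ Ioo a b →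
        WeakIdentity lam P ψ g φ a b) :
    ∃ c, ∀ᵐ x, x ∈ Ioo a b → lam * ψ x * g x = c + ∫ t in a..x,
      (2 * (lam - 1) * P + (2 * lam - 1) * g t ^ 2 - lam ^ 2 * ψ t ^ 2) := by
  have hψ := h.continuousOn hab.le
  rw [← uIcc_of_le hab.le] at hψ
  have hg := h.intervalIntegrable hab.le
  have hg2 := h.intervalIntegrable_sq hab.le
  have i1 : IntervalIntegrable (fun x => lam * ψ x * g x) volume a b :=
    hg.continuousOn_mul (continuousOn_const.mul hψ)
  have i2 : IntervalIntegrable (fun t => 2 * (lam - 1) * P + (2 * lam - 1) * g t ^ 2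
      - lam ^ 2 * ψ t ^ 2) volume a b :=
    ((intervalIntegrable_const).add (hg2.const_mul _)).sub
      (continuousOn_const.mul (hψ.pow 2)).intervalIntegrable
  refine ae_eq_primitive_of_integral_eq_zero hab i1 i2 fun φ hφ hφc hφs => ?_
  have h1 := H φ hφ hφc hφs
  unfold WeakIdentity at h1
  have hφc := hφ.continuous.continuousOn (s := uIcc a b)
  have hφd : ContinuousOn (deriv φ) (uIcc a b) :=
    (hφ.continuous_deriv (by simp)).continuousOn
  have j1 : IntervalIntegrable (fun θ => 2 * (lam - 1) * P * φ θ) volume a b :=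
    (continuousOn_const.mul hφc).intervalIntegrable
  have j2 : IntervalIntegrable (fun θ => (-(2 * lam - 1) * g θ ^ 2 + lam ^ 2 * ψ θ ^ 2) * φ θ
      - lam * ψ θ * g θ * deriv φ θ) volume a b := by
    refine IntervalIntegrable.sub (IntervalIntegrable.mul_continuousOn ?_ hφc)
      (i1.mul_continuousOn hφd)
    exact (hg2.const_mul _).add (continuousOn_const.mul (hψ.pow 2)).intervalIntegrable
  rw [← sub_eq_zero, ← integral_sub j1 j2] at h1
  rw [← h1]
  congr 1; ext x; ring

/-- The flux `λψψ'` of a local solution vanishes at the left end point. -/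
lemma flux_eq_zero {lam : ℝ} {ψ g w : ℝ → ℝ} {a b : ℝ} (hlam : 0 < lam)
    (hab : a < b) (hψ : ContinuousOn ψ (Icc a b)) (hψa : ψ a = 0)
    (hne : ∀ θ ∈ Ioo a b, ψ θ ≠ 0)
    (hg2 : IntervalIntegrable (fun x => g x ^ 2) volume a b)
    (hw : ContinuousOn w (Icc a b))
    (hgw : ∀ᵐ x, x ∈ Ioo a b → lam * ψ x * g x = w x)
    (hd : ∀ θ ∈ Ioo a b, HasDerivAt ψ (w θ / (lam * ψ θ)) θ) : w a = 0 := by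
  by_contra hc
  have hwa : Tendsto w (𝓝[Icc a b] a) (𝓝 (w a)) := hw a (left_mem_Icc.2 hab.le)
  have hpos : 0 < |w a| := abs_pos.2 hc
  have h1 : ∀ᶠ x in 𝓝[Icc a b] a, |w a| / 2 < |w x| ∧ |w x| < 2 * |w a| :=
    ((hwa.abs.eventually_const_lt (by linarith)).and (hwa.abs.eventually_lt_const (by linarith)))
  rw [nhdsWithin_Icc_eq_nhdsGE hab] at h1
  obtain ⟨d, hd1, hd2⟩ := (mem_nhdsGE_iff_exists_Icc_subset).1 h1
  set e := min d b with he
  have hae : a < e := lt_min hd1 hab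
  have heb : e ≤ b := min_le_right _ _
  have hb : ∀ x ∈ Icc a e, |w a| / 2 < |w x| ∧ |w x| < 2 * |w a| := fun x hx =>
    hd2 ⟨hx.1, hx.2.trans (min_le_left _ _)⟩
  -- Since `(ψ²)' = 2w/λ` and `|w| < 2|w a|` near `a`, the square grows at most linearly from its
  -- zero at `a`.
  have hsq : ∀ x ∈ Ioo a e, ψ x ^ 2 ≤ 4 * |w a| / lam * (x - a) := by
    intro x hx
    have hcont : ContinuousOn (fun t => ψ t ^ 2) (Icc a x) :=
      (hψ.mono (Icc_subset_Icc_right (hx.2.le.trans heb))).pow 2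
    have hder : ∀ t ∈ Ioo a x, HasDerivAt (fun t => ψ t ^ 2) (2 * w t / lam) t := by
      intro t ht
      have htb : t ∈ Ioo a b := ⟨ht.1, ht.2.trans (hx.2.trans_le heb)⟩
      refine ((hd t htb).pow 2).congr_deriv ?_
      have := hne t htb
      field_simp
      simp
      ring
    obtain ⟨ξ, hξ, hξe⟩ := exists_hasDerivAt_eq_slope _ _ hx.1 hcont hder
    rw [hψa] at hξe
    have hxa : 0 < x - a := by linarith [hx.1]
    rw [eq_div_iff hxa.ne'] at hξe
    have : 2 * w ξ / lam ≤ 4 * |w a| / lam := by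
      have := (hb ξ ⟨hξ.1.le, hξ.2.le.trans hx.2.le⟩).2
      have := le_abs_self (w ξ)
      rw [div_le_div_iff_of_pos_right hlam]
      linarith
    nlinarith
  -- Here `g² = w²/(λψ)²` with `|w| > |w a|/2`. The linear bound on `ψ²` in the denominator leaves a
  -- non-integrable singularity at `a`.
  have hK : ∀ᵐ x, x ∈ Ioo a e → |w a| / (16 * lam) * (x - a)⁻¹ ≤ g x ^ 2 := by
    filter_upwards [hgw] with x hx hxe
    have hxb : x ∈ Ioo a b := ⟨hxe.1, hxe.2.trans_le heb⟩
    have e1 := hx hxb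
    have e2 := hsq x hxe
    have e3 := (hb x ⟨hxe.1.le, hxe.2.le⟩).1
    have hxa : 0 < x - a := by linarith [hxe.1]
    have e4 : (|w a| / 2) ^ 2 ≤ w x ^ 2 := by
      rw [← sq_abs (w x)]
      gcongr
    rw [← e1] at e4
    have e5 : lam ^ 2 * ψ x ^ 2 * g x ^ 2 ≤ lam ^ 2 * (4 * |w a| / lam * (x - a)) * g x ^ 2 := by
      gcongr
    have e6 : lam ^ 2 * (4 * |w a| / lam * (x - a)) * g x ^ 2 =
        4 * |w a| * (lam * (x - a) * g x ^ 2) := by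
      field_simp
    have e7 : |w a| * |w a| ≤ |w a| * (16 * (lam * (x - a) * g x ^ 2)) := by
      nlinarith
    have e8 := le_of_mul_le_mul_left e7 hpos
    rw [div_mul_eq_mul_div, div_le_iff₀ (by positivity), mul_inv_le_iff₀ hxa]
    linarith
  have hint : IntervalIntegrable (fun x => (x - a)⁻¹) volume a e := by
    rw [intervalIntegrable_iff_integrableOn_Ioo_of_le hae.le]
    have h2 : IntegrableOn (fun x => (16 * lam / |w a|) * g x ^ 2) (Ioo a e) volume := by
      have := (intervalIntegrable_iff_integrableOn_Ioo_of_le hab.le).1 hg2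
      exact (this.mono_set (Ioo_subset_Ioo_right heb)).const_mul _
    refine Integrable.mono' h2 (Measurable.aestronglyMeasurable (by fun_prop)) ?_
    rw [ae_restrict_iff' measurableSet_Ioo]
    filter_upwards [hK] with x hx hxe
    have hxa : 0 < x - a := by linarith [hxe.1]
    rw [Real.norm_of_nonneg (inv_nonneg.2 hxa.le)]
    have := mul_le_mul_of_nonneg_left (hx hxe) (show 0 ≤ 16 * lam / |w a| by positivity)
    calc (x - a)⁻¹ = 16 * lam / |w a| * (|w a| / (16 * lam) * (x - a)⁻¹) := by
          field_simp
      _ ≤ _ := this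
  rw [intervalIntegrable_sub_inv_iff] at hint
  rcases hint with h | h
  · exact hae.ne h
  · exact h left_mem_uIcc

/-- The regularity of local solutions: `ψ` is differentiable, the flux `λψψ'` is differentiable
with the derivative that the equation prescribes, and it vanishes at the left end point. -/
theorem IsLocalSolution.regularity {lam P : ℝ} {ψ : ℝ → ℝ} {a b : ℝ} (hlam : 0 < lam)
    (H : IsLocalSolution lam P ψ a b) :
    ContinuousOn ψ (Icc a b) ∧ (∀ θ ∈ Ioo a b, HasDerivAt ψ (deriv ψ θ) θ) ∧
    (∀ θ ∈ Ioo a b, HasDerivAt (fun x => lam * ψ x * deriv ψ x)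
      (2 * (lam - 1) * P + (2 * lam - 1) * deriv ψ θ ^ 2 - lam ^ 2 * ψ θ ^ 2) θ) ∧
    Tendsto (fun x => lam * ψ x * deriv ψ x) (𝓝[>] a) (𝓝 0) := by
  obtain ⟨hab, hψa, hψb, hne, g, hg, hw⟩ := H
  have hψ := hg.continuousOn hab.le
  obtain ⟨c, hc⟩ := exists_flux_of_weakIdentity hab hg hw
  set h : ℝ → ℝ := fun t => 2 * (lam - 1) * P + (2 * lam - 1) * g t ^ 2 - lam ^ 2 * ψ t ^ 2 with hh
  have hhi : IntervalIntegrable h volume a b := by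
    refine ((intervalIntegrable_const).add ((hg.intervalIntegrable_sq hab.le).const_mul _)).sub ?_
    rw [← uIcc_of_le hab.le] at hψ
    exact (continuousOn_const.mul (hψ.pow 2)).intervalIntegrable
  set w : ℝ → ℝ := fun x => c + ∫ t in a..x, h t with hwdef
  have hwc : ContinuousOn w (Icc a b) := by
    have := (hhi.absolutelyContinuousOnInterval_intervalIntegral (c := a) (by simp)).continuousOn
    rw [uIcc_of_le hab.le] at this
    exact continuousOn_const.add this
  have hψo := hψ.mono Ioo_subset_Icc_self
  -- Away from the zeros of `ψ`, dividing the continuous flux by `λψ` gives a continuous version of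
  -- the weak derivative.
  have hk : ContinuousOn (fun x => w x / (lam * ψ x)) (Ioo a b) :=
    (hwc.mono Ioo_subset_Icc_self).div (continuousOn_const.mul hψo)
      fun x hx => mul_ne_zero hlam.ne' (hne x hx)
  have hgk : ∀ᵐ x, x ∈ Ioo a b → g x = w x / (lam * ψ x) := by
    filter_upwards [hc] with x hx hxm
    rw [eq_div_iff (mul_ne_zero hlam.ne' (hne x hxm)), mul_comm]
    exact hx hxm
  have hd : ∀ θ ∈ Ioo a b, HasDerivAt ψ (w θ / (lam * ψ θ)) θ := fun θ hθ =>
    hg.hasDerivAt hk hgk hθ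
  have hwa := flux_eq_zero hlam hab hψ hψa hne (hg.intervalIntegrable_sq hab.le) hwc hc hd
  have hwe : ∀ θ ∈ Ioo a b, lam * ψ θ * deriv ψ θ = w θ := fun θ hθ => by
    rw [(hd θ hθ).deriv]
    exact mul_div_cancel₀ _ (mul_ne_zero hlam.ne' (hne θ hθ))
  refine ⟨hψ, fun θ hθ => (hd θ hθ).differentiableAt.hasDerivAt, fun θ hθ => ?_, ?_⟩
  · have hdc : ContinuousOn (deriv ψ) (Ioo a b) := hk.congr fun x hx => (hd x hx).deriv
    set h' : ℝ → ℝ := fun t =>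
      2 * (lam - 1) * P + (2 * lam - 1) * deriv ψ t ^ 2 - lam ^ 2 * ψ t ^ 2 with hh'
    have hh'c : ContinuousOn h' (Ioo a b) :=
      (continuousOn_const.add (continuousOn_const.mul (hdc.pow 2))).sub
        (continuousOn_const.mul (hψo.pow 2))
    have h1 := hasDerivAt_primitive_of_continuousOn hh'c hθ (IntervalIntegrable.refl (a := θ))
    refine (h1.const_add (w θ)).congr_of_eventuallyEq ?_
    filter_upwards [isOpen_Ioo.mem_nhds hθ] with y hy
    rw [hwe y hy]
    have hsub := (ordConnected_Ioo (a := a) (b := b)).uIcc_subset hθ hy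
    have e1 : ∫ t in θ..y, h' t = ∫ t in θ..y, h t := by
      apply intervalIntegral.integral_congr_ae
      filter_upwards [hgk] with x hx hxm
      have hxo := hsub (uIoc_subset_uIcc hxm)
      simp only [hh', hh, hx hxo, (hd x hxo).deriv]
    have hsubI : ∀ x ∈ Icc a b, IntervalIntegrable h volume a x := fun x hx =>
      hhi.mono_set (by rw [uIcc_of_le hab.le, uIcc_of_le hx.1]; exact Icc_subset_Icc_right hx.2)
    rw [e1, ← integral_interval_sub_left (hsubI y (Ioo_subset_Icc_self hy))
      (hsubI θ (Ioo_subset_Icc_self hθ))]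
    simp only [hwdef]
    ring
  · have h2 : Tendsto w (𝓝[>] a) (𝓝 (w a)) := by
      rw [← nhdsWithin_Ioo_eq_nhdsGT hab]
      exact (hwc a (left_mem_Icc.2 hab.le)).mono_left (nhdsWithin_mono _ Ioo_subset_Icc_self)
    rw [hwa] at h2
    refine h2.congr' ?_
    filter_upwards [Ioo_mem_nhdsGT hab] with x hx using (hwe x hx).symm

/-- The Bernoulli function of a local solution is constant. -/
theorem IsLocalSolution.exists_hasBernoulli {lam P : ℝ} {ψ : ℝ → ℝ} {a b : ℝ} (hlam : 0 < lam)
    (H : IsLocalSolution lam P ψ a b) : ∃ B : ℝ, HasBernoulli lam P B ψ a b := by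
  obtain ⟨-, hd, hw, -⟩ := H.regularity hlam
  obtain ⟨hab, -, -, hne, -⟩ := H
  set E : ℝ → ℝ := fun θ =>
    (2 * P + lam ^ 2 * ψ θ ^ 2 + deriv ψ θ ^ 2) * |ψ θ| ^ (2 / lam - 2) with hE
  have hEd : ∀ θ ∈ Ioo a b, HasDerivAt E 0 θ := by
    intro θ hθ
    have h0 := hne θ hθ
    have hsq : 0 < ψ θ ^ 2 := by positivity
    -- The second derivative comes from writing `ψ'` as the flux divided by `λψ`.
    have hdd : HasDerivAt (deriv ψ) ((2 * (lam - 1) * P + (lam - 1) * deriv ψ θ ^ 2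
        - lam ^ 2 * ψ θ ^ 2) / (lam * ψ θ)) θ := by
      have h1 := (hw θ hθ).div ((hd θ hθ).const_mul lam) (mul_ne_zero hlam.ne' h0)
      refine (h1.congr_of_eventuallyEq ?_).congr_deriv ?_
      · filter_upwards [isOpen_Ioo.mem_nhds hθ] with y hy
        have := hne y hy
        simp only [Pi.div_apply]
        field_simp
      · field_simp
        ring
    -- The weight `|ψ|^(2/λ-2)` is treated as a power of `ψ²`, which avoids a case split on the sign
    -- of `ψ`.
    have h2 : HasDerivAt (fun x => (ψ x ^ 2) ^ (1 / lam - 1))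
        (2 * ψ θ * deriv ψ θ * (1 / lam - 1) * (ψ θ ^ 2) ^ (1 / lam - 1 - 1)) θ := by
      have := ((hd θ hθ).pow 2).rpow_const (p := 1 / lam - 1) (Or.inl hsq.ne')
      refine this.congr_deriv ?_
      simp
    have h3 := ((((hd θ hθ).pow 2).const_mul (lam ^ 2)).const_add (2 * P)).add (hdd.pow 2)
    have h4 := h3.mul h2
    have hfun : E = (fun θ => 2 * P + lam ^ 2 * ψ θ ^ 2 + deriv ψ θ ^ 2) *
        fun x => (ψ x ^ 2) ^ (1 / lam - 1) := by
      ext x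
      simp only [hE, Pi.mul_apply]
      congr 1
      rw [← sq_abs, ← Real.rpow_natCast, ← Real.rpow_mul (abs_nonneg _)]
      congr 1
      push_cast
      ring
    rw [hfun]
    refine h4.congr_deriv ?_
    have h5 : (ψ θ ^ 2) ^ (1 / lam - 1) = (ψ θ ^ 2) ^ (1 / lam - 1 - 1) * ψ θ ^ 2 := by
      rw [← Real.rpow_add_one hsq.ne']
      congr 1
      ring
    simp only [Pi.add_apply, Pi.pow_apply]
    rw [h5]
    push_cast
    field_simp
    ring
  have hmid : (a + b) / 2 ∈ Ioo a b := ⟨by linarith, by linarith⟩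
  refine ⟨E ((a + b) / 2), fun θ hθ => ⟨(hd θ hθ).differentiableAt, ?_⟩⟩
  exact (convex_Ioo a b).is_const_of_fderivWithin_eq_zero
    (fun x hx => (hEd x hx).differentiableAt.differentiableWithinAt)
    (fun x hx => by
      have := (hEd x hx).hasFDerivAt.hasFDerivWithinAt (s := Ioo a b)
      rw [this.fderivWithin (isOpen_Ioo.uniqueDiffWithinAt hx)]
      simp) hθ hmid

/-! ### Positive profiles: limits at the left end point and the case `B = 0`. -/

/-- A positive local solution in the classical sense, with Bernoulli constant `B`. -/
structure IsProfile (lam P B : ℝ) (ψ : ℝ → ℝ) (a b : ℝ) : Prop where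
  lt : a < b
  continuousOn : ContinuousOn ψ (Icc a b)
  left : ψ a = 0
  right : ψ b = 0
  pos : ∀ θ ∈ Ioo a b, 0 < ψ θ
  hasDerivAt : ∀ θ ∈ Ioo a b, HasDerivAt ψ (deriv ψ θ) θ
  flux : ∀ θ ∈ Ioo a b, HasDerivAt (fun x => lam * ψ x * deriv ψ x)
      (2 * (lam - 1) * P + (2 * lam - 1) * deriv ψ θ ^ 2 - lam ^ 2 * ψ θ ^ 2) θ
  flux_left : Tendsto (fun x => lam * ψ x * deriv ψ x) (𝓝[>] a) (𝓝 0)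
  bernoulli : ∀ θ ∈ Ioo a b,
    (2 * P + lam ^ 2 * ψ θ ^ 2 + deriv ψ θ ^ 2) * ψ θ ^ (2 / lam - 2) = B

lemma IsH1On.neg {ψ g : ℝ → ℝ} {a b : ℝ} (h : IsH1On ψ g a b) :
    IsH1On (fun x => -ψ x) (fun x => -g x) a b := by
  refine ⟨h.1.neg, fun x hx y hy => ?_⟩
  rw [intervalIntegral.integral_neg, ← h.2 x hx y hy]
  ring

lemma WeakIdentity.neg {lam P : ℝ} {ψ g φ : ℝ → ℝ} {a b : ℝ} (h : WeakIdentity lam P ψ g φ a b) :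
    WeakIdentity lam P (fun x => -ψ x) (fun x => -g x) φ a b := by
  unfold WeakIdentity at *
  rw [h]
  congr 1; ext x; ring

lemma IsLocalSolution.neg {lam P : ℝ} {ψ : ℝ → ℝ} {a b : ℝ} (H : IsLocalSolution lam P ψ a b) :
    IsLocalSolution lam P (fun x => -ψ x) a b := by
  obtain ⟨hab, h1, h2, h3, g, hg, hw⟩ := H
  exact ⟨hab, by simp [h1], by simp [h2], fun θ hθ => neg_ne_zero.2 (h3 θ hθ), _, hg.neg,
    fun φ h1 h2 h3 => (hw φ h1 h2 h3).neg⟩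

lemma HasBernoulli.neg {lam P B : ℝ} {ψ : ℝ → ℝ} {a b : ℝ} (H : HasBernoulli lam P B ψ a b) :
    HasBernoulli lam P B (fun x => -ψ x) a b := by
  intro θ hθ
  obtain ⟨h1, h2⟩ := H θ hθ
  refine ⟨h1.neg, ?_⟩
  rw [← h2, deriv.fun_neg, abs_neg]
  ring

lemma IsLocalSolution.isProfile_of_pos {lam P B : ℝ} {ψ : ℝ → ℝ} {a b : ℝ} (hlam : 0 < lam)
    (H : IsLocalSolution lam P ψ a b) (HB : HasBernoulli lam P B ψ a b)
    (hpos : ∀ θ ∈ Ioo a b, 0 < ψ θ) : IsProfile lam P B ψ a b := by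
  obtain ⟨h1, h2, h3, h4⟩ := H.regularity hlam
  refine ⟨H.1, h1, H.2.1, H.2.2.1, hpos, h2, h3, h4, fun θ hθ => ?_⟩
  rw [← (HB θ hθ).2, abs_of_pos (hpos θ hθ)]

/-- A local solution is a positive profile up to sign. -/
theorem IsLocalSolution.isProfile {lam P B : ℝ} {ψ : ℝ → ℝ} {a b : ℝ} (hlam : 0 < lam)
    (H : IsLocalSolution lam P ψ a b) (HB : HasBernoulli lam P B ψ a b) :
    IsProfile lam P B ψ a b ∨ IsProfile lam P B (fun x => -ψ x) a b := by
  have hc := (H.regularity hlam).1.mono Ioo_subset_Icc_self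
  have hne := H.2.2.2.1
  have hmid : (a + b) / 2 ∈ Ioo a b := ⟨by linarith [H.1], by linarith [H.1]⟩
  have hz : ∀ θ ∈ Ioo a b, ∀ θ' ∈ Ioo a b, ψ θ < 0 → 0 < ψ θ' → False := by
    intro θ hθ θ' hθ' h1 h2
    obtain ⟨x, hx, hx0⟩ := isPreconnected_Ioo.intermediate_value hθ hθ' hc ⟨h1.le, h2.le⟩
    exact hne x hx hx0
  rcases lt_or_gt_of_ne (hne _ hmid) with h | h
  · right
    refine H.neg.isProfile_of_pos hlam HB.neg fun θ hθ => ?_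
    rcases lt_or_gt_of_ne (hne _ hθ) with h' | h'
    · linarith
    · exact (hz _ hmid _ hθ h h').elim
  · left
    refine H.isProfile_of_pos hlam HB fun θ hθ => ?_
    rcases lt_or_gt_of_ne (hne _ hθ) with h' | h'
    · exact (hz _ hθ _ hmid h' h).elim
    · exact h'

namespace IsProfile

variable {lam P B : ℝ} {ψ : ℝ → ℝ} {a b : ℝ}

lemma tendsto_left (H : IsProfile lam P B ψ a b) : Tendsto ψ (𝓝[>] a) (𝓝 0) := by
  have := H.continuousOn a (left_mem_Icc.2 H.lt.le)
  rw [ContinuousWithinAt, H.left] at this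
  rw [← nhdsWithin_Ioo_eq_nhdsGT H.lt]
  exact this.mono_left (nhdsWithin_mono _ Ioo_subset_Icc_self)

lemma eventually_mem (H : IsProfile lam P B ψ a b) : ∀ᶠ x in 𝓝[>] a, x ∈ Ioo a b :=
  Ioo_mem_nhdsGT H.lt

lemma tendsto_rpow (H : IsProfile lam P B ψ a b) {p : ℝ} (hp : 0 ≤ p) :
    Tendsto (fun x => ψ x ^ p) (𝓝[>] a) (𝓝 (0 ^ p)) :=
  (Real.continuousAt_rpow_const 0 p (Or.inr hp)).tendsto.comp H.tendsto_left

/-- For `λ < 1` the weight `ψ^(2/λ-2)` tends to zero at `a`. Dropping the squares bounds `B` below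
by `2P` times this weight. -/
lemma bernoulli_nonneg_of_lt_one (H : IsProfile lam P B ψ a b) (h0 : 0 < lam) (h1 : lam < 1) :
    0 ≤ B := by
  have hp : 0 < 2 / lam - 2 := by
    rw [sub_pos, lt_div_iff₀ h0]; linarith
  have h := (H.tendsto_rpow hp.le).const_mul (2 * P)
  rw [Real.zero_rpow hp.ne', mul_zero] at h
  refine le_of_tendsto h ?_
  filter_upwards [H.eventually_mem] with x hx
  rw [← H.bernoulli x hx]
  have := Real.rpow_nonneg (H.pos x hx).le (2 / lam - 2)
  gcongr
  nlinarith [sq_nonneg (lam * ψ x), sq_nonneg (deriv ψ x)]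

/-- For `λ > 1` the inverse weight `ψ^(2-2/λ)` tends to zero at `a`. Multiplying the Bernoulli law
by it bounds `2P` above by a quantity that tends to zero. -/
lemma pressure_nonpos_of_one_lt (H : IsProfile lam P B ψ a b) (h1 : 1 < lam) : P ≤ 0 := by
  have hp : 0 < 2 - 2 / lam := by
    rw [sub_pos, div_lt_iff₀ (by linarith)]; linarith
  have h := (H.tendsto_rpow hp.le).const_mul B
  rw [Real.zero_rpow hp.ne', mul_zero] at h
  suffices 2 * P ≤ 0 by linarith
  refine ge_of_tendsto h ?_
  filter_upwards [H.eventually_mem] with x hx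
  have hx0 := H.pos x hx
  rw [← H.bernoulli x hx, mul_assoc, ← Real.rpow_add hx0]
  simp only [sub_add_sub_cancel, sub_self, Real.rpow_zero, mul_one]
  nlinarith [sq_nonneg (lam * ψ x), sq_nonneg (deriv ψ x)]

/-- Multiplied by `λ²`, the Bernoulli law reads `λ²B = (2Pλ²ψ² + λ⁴ψ⁴ + (λψψ')²) ψ^(2/λ-4)`. For `λ
≤ 1/2` the last exponent is nonnegative, so the right side tends to zero with `ψ` and the flux. -/
lemma bernoulli_eq_zero_of_le_half (H : IsProfile lam P B ψ a b) (h0 : 0 < lam)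
    (h1 : lam ≤ 1 / 2) : B = 0 := by
  have hp : 0 ≤ 2 / lam - 4 := by
    rw [sub_nonneg, le_div_iff₀ h0]; linarith
  have h := (((H.tendsto_left.pow 2).const_mul (2 * P * lam ^ 2)).add
    (((H.tendsto_left.pow 4).const_mul (lam ^ 4)).add (H.flux_left.pow 2))).mul
    (H.tendsto_rpow hp)
  have h2 : Tendsto (fun _ : ℝ => lam ^ 2 * B) (𝓝[>] a) (𝓝 (lam ^ 2 * B)) := tendsto_const_nhds
  have h3 := tendsto_nhds_unique (h2.congr' ?_) h
  · simp only [ne_eq, OfNat.ofNat_ne_zero, not_false_eq_true, zero_pow, mul_zero, add_zero,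
      zero_mul, mul_eq_zero, pow_eq_zero_iff] at h3
    exact h3.resolve_left h0.ne'
  · filter_upwards [H.eventually_mem] with x hx
    have hx0 := H.pos x hx
    have e : ψ x ^ (2 / lam - 2) = ψ x ^ (2 / lam - 4) * ψ x ^ 2 := by
      rw [← Real.rpow_natCast, ← Real.rpow_add hx0]
      congr 1
      push_cast
      ring
    rw [← H.bernoulli x hx, e]
    ring

lemma exists_isMax (H : IsProfile lam P B ψ a b) :
    ∃ c ∈ Ioo a b, (∀ θ ∈ Icc a b, ψ θ ≤ ψ c) ∧ deriv ψ c = 0 := by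
  obtain ⟨c, hc, hmax⟩ := isCompact_Icc.exists_isMaxOn (nonempty_Icc.2 H.lt.le) H.continuousOn
  have hmid : (a + b) / 2 ∈ Ioo a b := ⟨by linarith [H.lt], by linarith [H.lt]⟩
  have hpos : 0 < ψ c := (H.pos _ hmid).trans_le (hmax (Ioo_subset_Icc_self hmid))
  have hcm : c ∈ Ioo a b := by
    refine ⟨lt_of_le_of_ne hc.1 ?_, lt_of_le_of_ne hc.2 ?_⟩
    · rintro rfl
      exact hpos.ne' H.left
    · rintro rfl
      exact hpos.ne' H.right
  refine ⟨c, hcm, fun θ hθ => hmax hθ, ?_⟩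
  exact (hmax.isLocalMax (Icc_mem_nhds hcm.1 hcm.2)).deriv_eq_zero

/-- With vanishing Bernoulli constant the profile is a cosine. -/
lemma eq_cos_of_bernoulli_eq_zero (H : IsProfile lam P 0 ψ a b) (h0 : 0 < lam) :
    b - a = π / lam ∧ ∃ M, 0 < M ∧ lam ^ 2 * M ^ 2 = -2 * P ∧
      ∀ θ ∈ Icc a b, ψ θ = M * cos (lam * (θ - (a + b) / 2)) := by
  have hE : ∀ θ ∈ Ioo a b, 2 * P + lam ^ 2 * ψ θ ^ 2 + deriv ψ θ ^ 2 = 0 := fun θ hθ =>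
    (mul_eq_zero.1 (H.bernoulli θ hθ)).resolve_right (Real.rpow_pos_of_pos (H.pos θ hθ) _).ne'
  -- Eliminating `ψ'²` through the Bernoulli law with `B = 0` makes the second-order equation
  -- linear.
  have hdd : ∀ θ ∈ Ioo a b, HasDerivAt (deriv ψ) (-lam ^ 2 * ψ θ) θ := by
    intro θ hθ
    have hp := H.pos θ hθ
    have h1 := (H.flux θ hθ).div ((H.hasDerivAt θ hθ).const_mul lam) (mul_ne_zero h0.ne' hp.ne')
    refine (h1.congr_of_eventuallyEq ?_).congr_deriv ?_
    · filter_upwards [isOpen_Ioo.mem_nhds hθ] with y hy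
      have := H.pos y hy
      simp only [Pi.div_apply]
      field_simp
    · have hd : deriv ψ θ ^ 2 = -2 * P - lam ^ 2 * ψ θ ^ 2 := by linarith [hE θ hθ]
      field_simp
      rw [hd]
      ring
  obtain ⟨c, hc, -, hc0⟩ := H.exists_isMax
  have hM := H.pos c hc
  have hcos : ∀ θ, HasDerivAt (fun x => cos (lam * (x - c))) (-sin (lam * (θ - c)) * lam) θ :=
    fun θ => (((hasDerivAt_id θ).sub_const c).const_mul lam).cos.congr_deriv (by simp)
  have hsin : ∀ θ, HasDerivAt (fun x => sin (lam * (x - c))) (cos (lam * (θ - c)) * lam) θ :=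
    fun θ => (((hasDerivAt_id θ).sub_const c).const_mul lam).sin.congr_deriv (by simp)
  have hconst : ∀ f : ℝ → ℝ, (∀ θ ∈ Ioo a b, HasDerivAt f 0 θ) → ∀ θ ∈ Ioo a b, f θ = f c := by
    intro f hf θ hθ
    exact isOpen_Ioo.is_const_of_deriv_eq_zero isPreconnected_Ioo
      (fun x hx => (hf x hx).differentiableAt.differentiableWithinAt)
      (fun x hx => (hf x hx).deriv) hθ hc
  -- In the plane of `(ψ, ψ'/λ)` the oscillator is a rotation by the angle `λ(x-c)`. Undoing that
  -- rotation leaves two conserved quantities, evaluated at the maximum `c`.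
  have e1 := hconst (fun x => ψ x * cos (lam * (x - c)) - deriv ψ x / lam * sin (lam * (x - c)))
    fun θ hθ => (((H.hasDerivAt θ hθ).mul (hcos θ)).sub
      (((hdd θ hθ).div_const lam).mul (hsin θ))).congr_deriv (by field_simp; ring)
  have e2 := hconst (fun x => ψ x * sin (lam * (x - c)) + deriv ψ x / lam * cos (lam * (x - c)))
    fun θ hθ => (((H.hasDerivAt θ hθ).mul (hsin θ)).add
      (((hdd θ hθ).div_const lam).mul (hcos θ))).congr_deriv (by field_simp; ring)
  have e3 : ∀ θ ∈ Ioo a b, ψ θ = ψ c * cos (lam * (θ - c)) := by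
    intro θ hθ
    have f1 := e1 θ hθ
    have f2 := e2 θ hθ
    simp only [sub_self, mul_zero, cos_zero, sin_zero, hc0, mul_one, sub_zero, zero_div,
      add_zero] at f1 f2
    linear_combination cos (lam * (θ - c)) * f1 + sin (lam * (θ - c)) * f2
      - ψ θ * sin_sq_add_cos_sq (lam * (θ - c))
  have e4 : ∀ θ ∈ Icc a b, ψ θ = ψ c * cos (lam * (θ - c)) := by
    have : EqOn ψ (fun θ => ψ c * cos (lam * (θ - c))) (Icc a b) :=
      EqOn.of_subset_closure e3 H.continuousOn (by fun_prop) Ioo_subset_Icc_self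
        (closure_Ioo H.lt.ne).ge
    exact this
  have hcosb : cos (lam * (b - c)) = 0 := by
    have := e4 b (right_mem_Icc.2 H.lt.le)
    rw [H.right] at this
    exact (mul_eq_zero.1 this.symm).resolve_left hM.ne'
  have hcosa : cos (lam * (a - c)) = 0 := by
    have := e4 a (left_mem_Icc.2 H.lt.le)
    rw [H.left] at this
    exact (mul_eq_zero.1 this.symm).resolve_left hM.ne'
  have hposc : ∀ θ ∈ Ioo a b, 0 < cos (lam * (θ - c)) := fun θ hθ => by
    have := H.pos θ hθ
    rw [e3 θ hθ] at this
    exact pos_of_mul_pos_right this hM.le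
  -- The cosine vanishes at `b` and is positive on `(c, b)`, so `b` is its first zero after `c`.
  have hb : lam * (b - c) = π / 2 := by
    have hbc : 0 < lam * (b - c) := mul_pos h0 (by linarith [hc.2])
    rcases lt_trichotomy (lam * (b - c)) (π / 2) with h | h | h
    · exact absurd hcosb (cos_pos_of_mem_Ioo ⟨by linarith, h⟩).ne'
    · exact h
    · have h1 : π / 2 / lam < b - c := by rwa [div_lt_iff₀ h0, mul_comm]
      have h2 : 0 < π / 2 / lam := by positivity
      have := hposc (c + π / 2 / lam) ⟨by linarith [hc.1], by linarith⟩
      rw [add_sub_cancel_left, mul_div_cancel₀ _ h0.ne', cos_pi_div_two] at this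
      exact absurd this (lt_irrefl _)
  have ha : lam * (a - c) = -(π / 2) := by
    have hbc : 0 < lam * (c - a) := mul_pos h0 (by linarith [hc.1])
    rcases lt_trichotomy (lam * (a - c)) (-(π / 2)) with h | h | h
    · have h1 : π / 2 / lam < c - a := by
        rw [div_lt_iff₀ h0]
        linarith
      have h2 : 0 < π / 2 / lam := by positivity
      have := hposc (c - π / 2 / lam) ⟨by linarith [hc.1], by linarith [hc.2]⟩
      rw [sub_sub_cancel_left, mul_neg, mul_div_cancel₀ _ h0.ne', cos_neg, cos_pi_div_two] at this
      exact absurd this (lt_irrefl _)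
    · exact h
    · exact absurd hcosa (cos_pos_of_mem_Ioo ⟨by linarith, by linarith [pi_pos]⟩).ne'
  have hmid : c = (a + b) / 2 := by
    have : lam * (a + b - 2 * c) = 0 := by linarith
    have := (mul_eq_zero.1 this).resolve_left h0.ne'
    linarith
  refine ⟨?_, ψ c, hM, ?_, ?_⟩
  · rw [eq_div_iff h0.ne']
    linarith
  · have := hE c hc
    rw [hc0] at this
    linarith
  · rw [← hmid]
    exact e4

end IsProfile

/-! ### The rescaled equation and a mean value identity for the life-span. -/

/-- The right-hand side of `(v')² = 1 - v² + κ (1 - v^(2-2λ))`, the equation of `v = (ψ/M)^(1/λ)`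
for a local solution `ψ` with maximum `M` and `κ = 2P/(λM)²`. -/
noncomputable def profileRate (lam κ v : ℝ) : ℝ := 1 - v ^ 2 + κ * (1 - v ^ (2 - 2 * lam))

/-- The condition `κ(1-λ) ≥ 0` matches the sign of `κ` to that of `1 - v^(2-2λ)`. It is what allows
`κ` to be replaced by `|κ|` in the time map. -/
lemma mul_one_sub_rpow_nonneg {lam κ v : ℝ} (hκ : 0 ≤ κ * (1 - lam)) (hv : v ∈ Ioo (0 : ℝ) 1) :
    0 ≤ κ * (1 - v ^ (2 - 2 * lam)) := by
  rcases lt_trichotomy lam 1 with h | h | h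
  · have hk : 0 ≤ κ := nonneg_of_mul_nonneg_left hκ (by linarith)
    have := Real.rpow_le_one hv.1.le hv.2.le (show 0 ≤ 2 - 2 * lam by linarith)
    exact mul_nonneg hk (by linarith)
  · simp [h]
  · have hk : κ ≤ 0 := by
      by_contra hk
      nlinarith
    have := Real.one_le_rpow_of_pos_of_le_one_of_nonpos hv.1 hv.2.le
      (show 2 - 2 * lam ≤ 0 by linarith)
    exact mul_nonneg_of_nonpos_of_nonpos hk (by linarith)

lemma profileRate_pos {lam κ v : ℝ} (hκ : 0 ≤ κ * (1 - lam)) (hv : v ∈ Ioo (0 : ℝ) 1) :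
    0 < profileRate lam κ v := by
  have := mul_one_sub_rpow_nonneg hκ hv
  unfold profileRate
  nlinarith [hv.1, hv.2]

/-- A rescaled profile: it rises from `0` to its maximum `1` and returns to `0`, and solves
`(v')² = F v`. -/
structure IsBump (F : ℝ → ℝ) (v : ℝ → ℝ) (a c b : ℝ) : Prop where
  mem : c ∈ Ioo a b
  continuousOn : ContinuousOn v (Icc a b)
  left : v a = 0
  right : v b = 0
  top : v c = 1
  pos : ∀ θ ∈ Ioo a b, 0 < v θ
  le_one : ∀ θ ∈ Icc a b, v θ ≤ 1
  deriv : ∀ θ ∈ Ioo a b, ∃ d, HasDerivAt v d θ ∧ d ^ 2 = F (v θ)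
  not_flat : ∀ x ∈ Ioo a b, ∀ y ∈ Ioo a b, x < y → ∃ t ∈ Icc x y, v t ≠ 1

/-- As `F > 0`, the derivative of `v` never vanishes. Darboux's theorem then gives it a constant
sign, and the end values make it positive, so `v' = √(F v)` and the mean value theorem applies to `Z
∘ v`. No change of variables in an improper integral is needed. -/
lemma exists_mean_value_of_sq_deriv {F v Z z : ℝ → ℝ} {a c : ℝ} (hac : a < c)
    (hF : ∀ x ∈ Ioo (0 : ℝ) 1, 0 < F x) (hv : ContinuousOn v (Icc a c)) (ha : v a = 0)
    (hc : v c = 1) (hmem : ∀ θ ∈ Ioo a c, v θ ∈ Ioo (0 : ℝ) 1)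
    (hd : ∀ θ ∈ Ioo a c, ∃ d, HasDerivAt v d θ ∧ d ^ 2 = F (v θ))
    (hZ : ContinuousOn Z (Icc 0 1)) (hz : ∀ x ∈ Ioo (0 : ℝ) 1, HasDerivAt Z (z x) x) :
    ∃ ξ ∈ Ioo (0 : ℝ) 1, Z 1 - Z 0 = z ξ * √(F ξ) * (c - a) := by
  choose! d hd1 hd2 using hd
  have hpos : ∀ θ ∈ Ioo a c, 0 < d θ := by
    have hne : ∀ θ ∈ Ioo a c, d θ ≠ 0 := fun θ hθ h0 => by
      have := hF _ (hmem θ hθ)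
      rw [← hd2 θ hθ, h0] at this
      norm_num at this
    rcases hasDerivWithinAt_forall_lt_or_forall_gt_of_forall_ne (convex_Ioo a c)
      (fun x hx => (hd1 x hx).hasDerivWithinAt) hne with h | h
    · exfalso
      obtain ⟨ξ, hξ, e⟩ := exists_hasDerivAt_eq_slope v d hac hv hd1
      have := h ξ hξ
      rw [e, ha, hc] at this
      have : 0 < (1 - 0) / (c - a) := by
        have : 0 < c - a := by linarith
        positivity
      linarith
    · exact h
  have hdF : ∀ θ ∈ Ioo a c, d θ = √(F (v θ)) := fun θ hθ => by
    rw [← hd2 θ hθ, Real.sqrt_sq (hpos θ hθ).le]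
  have hmaps : MapsTo v (Icc a c) (Icc 0 1) := by
    intro θ hθ
    rcases eq_or_lt_of_le hθ.1 with h | h
    · rw [← h, ha]; simp
    rcases eq_or_lt_of_le hθ.2 with h' | h'
    · rw [h', hc]; simp
    exact Ioo_subset_Icc_self (hmem θ ⟨h, h'⟩)
  obtain ⟨ξ, hξ, e⟩ := exists_hasDerivAt_eq_slope (fun θ => Z (v θ)) (fun θ => z (v θ) * d θ) hac
    (hZ.comp hv hmaps) fun θ hθ => (hz _ (hmem θ hθ)).comp θ (hd1 θ hθ)
  refine ⟨v ξ, hmem ξ hξ, ?_⟩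
  simp only [ha, hc] at e
  rw [← hdF ξ hξ, e, div_mul_cancel₀]
  linarith

namespace IsBump

variable {F v : ℝ → ℝ} {a c b : ℝ}

/-- Between two points at height 1 the exclusion of plateaus yields an interior minimum below 1.
There `v' = 0`, against `F > 0`. -/
lemma lt_one (H : IsBump F v a c b) (hF : ∀ x ∈ Ioo (0 : ℝ) 1, 0 < F x) {θ : ℝ}
    (hθ : θ ∈ Ioo a b) (hne : θ ≠ c) : v θ < 1 := by
  by_contra hlt
  have h1 : v θ = 1 := le_antisymm (H.le_one θ (Ioo_subset_Icc_self hθ)) (not_lt.1 hlt)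
  have key : ∀ x ∈ Ioo a b, ∀ y ∈ Ioo a b, x < y → v x = 1 → v y = 1 → False := by
    intro x hx y hy hxy hvx hvy
    obtain ⟨t, ht, htne⟩ := H.not_flat x hx y hy hxy
    have hsub : Icc x y ⊆ Ioo a b := fun s hs => ⟨hx.1.trans_le hs.1, hs.2.trans_lt hy.2⟩
    obtain ⟨m, hm, hmin⟩ := isCompact_Icc.exists_isMinOn (nonempty_Icc.2 hxy.le)
      (H.continuousOn.mono (hsub.trans Ioo_subset_Icc_self))
    have hm1 : v m < 1 := (hmin ht).trans_lt
      (lt_of_le_of_ne (H.le_one t (Ioo_subset_Icc_self (hsub ht))) htne)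
    have hmo : m ∈ Ioo x y := by
      refine ⟨lt_of_le_of_ne hm.1 ?_, lt_of_le_of_ne hm.2 ?_⟩
      · rintro rfl; linarith
      · rintro rfl; linarith
    obtain ⟨d, hd, hd2⟩ := H.deriv m (hsub hm)
    have hd0 : d = 0 := (hmin.isLocalMin (Icc_mem_nhds hmo.1 hmo.2)).hasDerivAt_eq_zero hd
    have := hF (v m) ⟨H.pos m (hsub hm), hm1⟩
    rw [← hd2, hd0] at this
    norm_num at this
  rcases lt_or_gt_of_ne hne with h | h
  · exact key θ hθ c H.mem h h1 H.top
  · exact key c H.mem θ hθ h H.top h1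

/-- The one-sided identity is applied to the rising half and to the reflection of the falling half.
If `z * √F` is identically 1 the right side is the life-span; a bound on `z * √F` gives a bound on
the life-span. -/
lemma exists_mean_value (H : IsBump F v a c b) (hF : ∀ x ∈ Ioo (0 : ℝ) 1, 0 < F x)
    {Z z : ℝ → ℝ} (hZ : ContinuousOn Z (Icc 0 1))
    (hz : ∀ x ∈ Ioo (0 : ℝ) 1, HasDerivAt Z (z x) x) :
    ∃ ξ ∈ Ioo (0 : ℝ) 1, ∃ η ∈ Ioo (0 : ℝ) 1,
      2 * (Z 1 - Z 0) = z ξ * √(F ξ) * (c - a) + z η * √(F η) * (b - c) := by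
  obtain ⟨ξ, hξ, e1⟩ := exists_mean_value_of_sq_deriv H.mem.1 hF
    (H.continuousOn.mono (Icc_subset_Icc_right H.mem.2.le)) H.left H.top
    (fun θ hθ => by
      have hθ' : θ ∈ Ioo a b := ⟨hθ.1, hθ.2.trans H.mem.2⟩
      exact ⟨H.pos θ hθ', H.lt_one hF hθ' hθ.2.ne⟩)
    (fun θ hθ => H.deriv θ ⟨hθ.1, hθ.2.trans H.mem.2⟩) hZ hz
  have hneg : ∀ θ ∈ Ioo (-b) (-c), -θ ∈ Ioo a b ∧ -θ ≠ c := fun θ hθ =>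
    ⟨⟨by linarith [hθ.2, H.mem.1], by linarith [hθ.1]⟩, by linarith [hθ.2]⟩
  obtain ⟨η, hη, e2⟩ := exists_mean_value_of_sq_deriv (v := fun θ => v (-θ)) (a := -b) (c := -c)
    (by linarith [H.mem.2]) hF
    (H.continuousOn.comp continuousOn_neg
      fun θ hθ => ⟨by linarith [hθ.2, H.mem.1], by linarith [hθ.1]⟩)
    (by simp [H.right]) (by simp [H.top])
    (fun θ hθ => ⟨H.pos _ (hneg θ hθ).1, H.lt_one hF (hneg θ hθ).1 (hneg θ hθ).2⟩)
    (fun θ hθ => by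
      obtain ⟨d, hd, hd2⟩ := H.deriv (-θ) (hneg θ hθ).1
      refine ⟨-d, ?_, by rw [neg_sq, hd2]⟩
      exact (hd.comp θ (hasDerivAt_neg θ)).congr_deriv (by ring)) hZ hz
  refine ⟨ξ, hξ, η, hη, ?_⟩
  rw [← sub_neg_eq_add] at *
  linarith

end IsBump

/-- Rescaling a local solution by its maximum. -/
lemma IsProfile.exists_isBump {lam P B : ℝ} {ψ : ℝ → ℝ} {a b : ℝ} (H : IsProfile lam P B ψ a b)
    (h0 : 0 < lam) : ∃ M, 0 < M ∧ B = (2 * P + lam ^ 2 * M ^ 2) * M ^ (2 / lam - 2) ∧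
      (2 * (lam - 1) * P ≠ lam ^ 2 * M ^ 2 →
        ∃ v c, IsBump (profileRate lam (2 * P / (lam ^ 2 * M ^ 2))) v a c b) := by
  obtain ⟨c, hc, hmax, hdc⟩ := H.exists_isMax
  have hM := H.pos c hc
  set M := ψ c with hMdef
  have hB : B = (2 * P + lam ^ 2 * M ^ 2) * M ^ (2 / lam - 2) := by
    rw [← H.bernoulli c hc, hdc, ← hMdef]
    ring
  refine ⟨M, hM, hB, fun hne => ⟨fun θ => (ψ θ / M) ^ (1 / lam), c, hc, ?_, ?_, ?_, ?_, ?_, ?_,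
    ?_, ?_⟩⟩
  · exact (H.continuousOn.div_const M).rpow_const fun x _ => Or.inr (by positivity)
  · simp [H.left, Real.zero_rpow, h0.ne']
  · simp [H.right, Real.zero_rpow, h0.ne']
  · simp [← hMdef, hM.ne']
  · exact fun θ hθ => Real.rpow_pos_of_pos (div_pos (H.pos θ hθ) hM) _
  · intro θ hθ
    have h1 : 0 ≤ ψ θ := by
      rcases eq_or_lt_of_le hθ.1 with h | h
      · rw [← h, H.left]
      rcases eq_or_lt_of_le hθ.2 with h' | h'
      · rw [h', H.right]
      exact (H.pos θ ⟨h, h'⟩).le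
    exact Real.rpow_le_one (by positivity) ((div_le_one hM).2 (hmax θ hθ)) (by positivity)
  · intro θ hθ
    have hp := H.pos θ hθ
    have hu : 0 < ψ θ / M := div_pos hp hM
    refine ⟨_, ((H.hasDerivAt θ hθ).div_const M).rpow_const (Or.inl hu.ne'), ?_⟩
    set u := ψ θ / M with hudef
    have hψ : ψ θ = u * M := by rw [hudef, div_mul_cancel₀ _ hM.ne']
    have e1 : (u ^ (1 / lam - 1)) ^ 2 = u ^ (2 / lam - 2) := by
      rw [← Real.rpow_natCast, ← Real.rpow_mul hu.le]
      congr 1; push_cast; ring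
    have e2 : (u ^ (1 / lam)) ^ 2 = u ^ (2 / lam - 2) * u ^ 2 := by
      rw [← Real.rpow_natCast, ← Real.rpow_mul hu.le, ← Real.rpow_natCast u, ← Real.rpow_add hu]
      congr 1; push_cast; ring
    have e3 : (u ^ (1 / lam)) ^ (2 - 2 * lam) = u ^ (2 / lam - 2) := by
      rw [← Real.rpow_mul hu.le]
      congr 1; field_simp
    have e4 := H.bernoulli θ hθ
    rw [hB, hψ, Real.mul_rpow hu.le hM.le] at e4
    have hMp := Real.rpow_pos_of_pos hM (2 / lam - 2)
    have e5 : (2 * P + lam ^ 2 * (u * M) ^ 2 + deriv ψ θ ^ 2) * u ^ (2 / lam - 2) =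
        2 * P + lam ^ 2 * M ^ 2 := by
      apply mul_right_cancel₀ hMp.ne'
      linarith
    unfold profileRate
    rw [mul_pow, e1, e2, e3]
    clear_value u
    generalize u ^ (2 / lam - 2) = X at e5 ⊢
    field_simp
    linear_combination e5
  -- The first-order equation alone admits plateaus at height 1. On a plateau `ψ = M` the flux
  -- equation would give `2(λ-1)P = λ²M²`, which `hne` excludes.
  · intro x hx y hy hxy
    by_contra hcon
    push Not at hcon
    have hsub : Icc x y ⊆ Ioo a b := fun s hs => ⟨hx.1.trans_le hs.1, hs.2.trans_lt hy.2⟩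
    have hψM : ∀ t ∈ Ioo x y, ψ t = M := by
      intro t ht
      have h1 := hcon t (Ioo_subset_Icc_self ht)
      have hu : 0 ≤ ψ t / M := (div_pos (H.pos t (hsub (Ioo_subset_Icc_self ht))) hM).le
      have h2 : ψ t / M = 1 := by
        rw [← Real.rpow_rpow_inv hu (one_div_pos.2 h0).ne', h1, Real.one_rpow]
      rwa [div_eq_one_iff_eq hM.ne'] at h2
    have hder : ∀ t ∈ Ioo x y, deriv ψ t = 0 := by
      intro t ht
      have : ψ =ᶠ[𝓝 t] fun _ => M := by
        filter_upwards [isOpen_Ioo.mem_nhds ht] with s hs using hψM s hs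
      rw [this.deriv_eq]
      simp
    have hmid : (x + y) / 2 ∈ Ioo x y := ⟨by linarith, by linarith⟩
    have h1 := H.flux _ (hsub (Ioo_subset_Icc_self hmid))
    have h2 : (fun x => lam * ψ x * deriv ψ x) =ᶠ[𝓝 ((x + y) / 2)] fun _ => 0 := by
      filter_upwards [isOpen_Ioo.mem_nhds hmid] with s hs
      rw [hder s hs, mul_zero]
    have h3 := h1.unique ((hasDerivAt_const _ (0 : ℝ)).congr_of_eventuallyEq h2)
    rw [hder _ hmid, hψM _ hmid] at h3
    apply hne
    linarith

/-! ### The time map and the exact life-span for `P(1-λ) ≥ 0`. -/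

/-- The excess of `(p')² - 1` per unit of `s`, where `v = sin p`. -/
noncomputable def timeExcess (lam p : ℝ) : ℝ := |1 - |sin p| ^ (2 - 2 * lam)| / cos p ^ 2

/-- The density of time with respect to the phase `p`. -/
noncomputable def timeDensity (lam s p : ℝ) : ℝ := 1 / √(1 + s * timeExcess lam p)

/-- The time that the phase needs to increase from `0` to `p`. -/
noncomputable def phaseTime (lam s p : ℝ) : ℝ := ∫ q in 0..p, timeDensity lam s q

/-- The life-span as a function of `s = 2|P|/(λM)²`. -/
noncomputable def timeMap (lam s : ℝ) : ℝ := phaseTime lam s π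

lemma timeExcess_nonneg (lam p : ℝ) : 0 ≤ timeExcess lam p := by
  unfold timeExcess; positivity

lemma measurable_timeExcess (lam : ℝ) : Measurable (timeExcess lam) := by
  unfold timeExcess
  have : Measurable fun p : ℝ => |sin p| ^ (2 - 2 * lam) := by fun_prop
  have h2 : Measurable fun p : ℝ => |1 - |sin p| ^ (2 - 2 * lam)| := by
    exact (measurable_const.sub this).abs
  fun_prop

lemma measurable_timeDensity (lam s : ℝ) : Measurable (timeDensity lam s) := by
  have := measurable_timeExcess lam
  unfold timeDensity
  fun_prop

section

variable {lam s : ℝ}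

lemma timeDensity_pos (hs : 0 ≤ s) (p : ℝ) : 0 < timeDensity lam s p := by
  have := timeExcess_nonneg lam p
  unfold timeDensity
  have h1 : 0 ≤ s * timeExcess lam p := by positivity
  positivity

lemma timeDensity_le_one (hs : 0 ≤ s) (p : ℝ) : timeDensity lam s p ≤ 1 := by
  have h1 := mul_nonneg hs (timeExcess_nonneg lam p)
  unfold timeDensity
  rw [div_le_one (by positivity)]
  exact Real.one_le_sqrt.2 (by linarith)

lemma timeDensity_intervalIntegrable (hs : 0 ≤ s) (x y : ℝ) :
    IntervalIntegrable (timeDensity lam s) volume x y := by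
  rw [intervalIntegrable_iff]
  refine Integrable.mono' (g := fun _ => (1 : ℝ))
    (intervalIntegrable_iff.1 intervalIntegrable_const)
    (measurable_timeDensity lam s).aestronglyMeasurable (ae_of_all _ fun p => ?_)
  rw [Real.norm_of_nonneg (timeDensity_pos hs p).le]
  exact timeDensity_le_one hs p

lemma timeDensity_add_pi (p : ℝ) : timeDensity lam s (p + π) = timeDensity lam s p := by
  simp [timeDensity, timeExcess, sin_add_pi, cos_add_pi]

lemma timeDensity_neg (p : ℝ) : timeDensity lam s (-p) = timeDensity lam s p := by
  simp [timeDensity, timeExcess]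

lemma continuousAt_timeDensity (hs : 0 ≤ s) {p : ℝ} (h1 : sin p ≠ 0) (h2 : cos p ≠ 0) :
    ContinuousAt (timeDensity lam s) p := by
  have h3 : ContinuousAt (timeExcess lam) p := by
    unfold timeExcess
    refine ContinuousAt.div ?_ (by fun_prop) (by positivity)
    refine (continuousAt_const.sub (ContinuousAt.rpow_const ?_ (Or.inl (by positivity)))).abs
    fun_prop
  have := mul_nonneg hs (timeExcess_nonneg lam p)
  unfold timeDensity
  exact continuousAt_const.div (continuousAt_const.add (continuousAt_const.mul h3)).sqrt
    (by positivity)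

lemma continuous_phaseTime (hs : 0 ≤ s) : Continuous (phaseTime lam s) :=
  continuous_primitive (fun _ _ => timeDensity_intervalIntegrable hs _ _) 0

lemma hasDerivAt_phaseTime (hs : 0 ≤ s) {p : ℝ} (h1 : sin p ≠ 0) (h2 : cos p ≠ 0) :
    HasDerivAt (phaseTime lam s) (timeDensity lam s p) p :=
  integral_hasDerivAt_right (timeDensity_intervalIntegrable hs _ _)
    (measurable_timeDensity lam s).stronglyMeasurable.stronglyMeasurableAtFilter
    (continuousAt_timeDensity hs h1 h2)

lemma phaseTime_pi_div_two (hs : 0 ≤ s) : 2 * phaseTime lam s (π / 2) = timeMap lam s := by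
  have h1 := integral_comp_sub_left (timeDensity lam s) π (a := 0) (b := π / 2)
  have h2 : ∀ p, timeDensity lam s (π - p) = timeDensity lam s p := fun p => by
    rw [sub_eq_neg_add, timeDensity_add_pi, timeDensity_neg]
  simp only [h2, sub_zero, show π - π / 2 = π / 2 by ring] at h1
  have h3 := integral_add_adjacent_intervals
    (timeDensity_intervalIntegrable (lam := lam) hs 0 (π / 2))
    (timeDensity_intervalIntegrable hs (π / 2) π)
  unfold timeMap phaseTime
  linarith

end

/-- On the branch `v = sin p` the density of time is `√(1-v²)/√F(v)`. -/
lemma timeDensity_arcsin_mul {lam κ x : ℝ} (hκ : 0 ≤ κ * (1 - lam)) (hx : x ∈ Ioo (0 : ℝ) 1) :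
    timeDensity lam |κ| (arcsin x) * (1 / √(1 - x ^ 2)) * √(profileRate lam κ x) = 1 := by
  have h1 : 0 < 1 - x ^ 2 := by nlinarith [hx.1, hx.2]
  have h2 := profileRate_pos hκ hx
  have h3 : 1 + |κ| * timeExcess lam (arcsin x) = profileRate lam κ x / (1 - x ^ 2) := by
    unfold timeExcess
    rw [cos_arcsin, Real.sq_sqrt h1.le, sin_arcsin (by linarith [hx.1]) hx.2.le, abs_of_pos hx.1,
      ← mul_div_assoc, ← abs_mul, abs_of_nonneg (mul_one_sub_rpow_nonneg hκ hx)]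
    unfold profileRate
    field_simp
  have h4 := Real.sqrt_pos.2 h1
  have h5 := Real.sqrt_pos.2 h2
  unfold timeDensity
  rw [h3, Real.sqrt_div h2.le]
  field_simp

/-- With `Z = phaseTime ∘ arcsin` the product `z * √F` is 1, so the intermediate points disappear
from the mean value identity. It reads `2 * phaseTime (π/2) = b - a`. -/
lemma IsBump.lifespan_eq {lam κ : ℝ} {v : ℝ → ℝ} {a c b : ℝ} (hκ : 0 ≤ κ * (1 - lam))
    (H : IsBump (profileRate lam κ) v a c b) : b - a = timeMap lam |κ| := by
  obtain ⟨ξ, hξ, η, hη, e⟩ := H.exists_mean_value (fun x hx => profileRate_pos hκ hx)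
    (Z := fun x => phaseTime lam |κ| (arcsin x))
    (z := fun x => timeDensity lam |κ| (arcsin x) * (1 / √(1 - x ^ 2)))
    ((continuous_phaseTime (abs_nonneg κ)).comp continuous_arcsin).continuousOn
    (fun x hx => by
      have h1 : 0 < 1 - x ^ 2 := by nlinarith [hx.1, hx.2]
      refine (hasDerivAt_phaseTime (abs_nonneg κ) ?_ ?_).comp x
        (hasDerivAt_arcsin (by linarith [hx.1]) hx.2.ne)
      · rw [sin_arcsin (by linarith [hx.1]) hx.2.le]
        exact hx.1.ne'
      · rw [cos_arcsin]
        exact (Real.sqrt_pos.2 h1).ne')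
  simp only [timeDensity_arcsin_mul hκ hξ, timeDensity_arcsin_mul hκ hη, arcsin_one, arcsin_zero]
    at e
  have h0 : phaseTime lam |κ| 0 = 0 := by simp [phaseTime]
  rw [h0, sub_zero, phaseTime_pi_div_two (abs_nonneg κ)] at e
  linarith

/-- The life-span of a local solution with `P(1-λ) ≥ 0` in terms of its maximum `M`. -/
theorem IsProfile.lifespan_eq {lam P B : ℝ} {ψ : ℝ → ℝ} {a b : ℝ} (H : IsProfile lam P B ψ a b)
    (h0 : 0 < lam) (hP : 0 ≤ P * (1 - lam)) :
    ∃ M, 0 < M ∧ B = (2 * P + lam ^ 2 * M ^ 2) * M ^ (2 / lam - 2) ∧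
      b - a = timeMap lam |2 * P / (lam ^ 2 * M ^ 2)| := by
  obtain ⟨M, hM, hB, h⟩ := H.exists_isBump h0
  obtain ⟨v, c, hv⟩ := h (by
    have : 0 < lam ^ 2 * M ^ 2 := by positivity
    nlinarith)
  refine ⟨M, hM, hB, hv.lifespan_eq ?_⟩
  have : 2 * P / (lam ^ 2 * M ^ 2) * (1 - lam) = 2 * (P * (1 - lam)) / (lam ^ 2 * M ^ 2) := by
    ring
  rw [this]
  positivity

/-! ### Comparison bounds for `λ < 1` and negative pressure. -/

/-- For `λ < 1`, `P < 0` and `B > 0` the life-span lies strictly between `π` and `π/λ`. -/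
theorem IsProfile.lifespan_mem_Ioo {lam P B : ℝ} {ψ : ℝ → ℝ} {a b : ℝ}
    (H : IsProfile lam P B ψ a b) (h0 : 0 < lam) (h1 : lam < 1) (hP : P < 0) (hB : 0 < B) :
    b - a ∈ Ioo π (π / lam) := by
  obtain ⟨M, hM, hBM, h⟩ := H.exists_isBump h0
  have hM2 : 0 < lam ^ 2 * M ^ 2 := by positivity
  -- Positivity of `B` amounts to `κ > -1`. It also rules out the plateau condition, since `2(λ-1)P
  -- < -2P < λ²M²`.
  have hpos : 0 < 2 * P + lam ^ 2 * M ^ 2 := by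
    rw [hBM] at hB
    exact pos_of_mul_pos_left hB (Real.rpow_nonneg hM.le _)
  obtain ⟨v, c, hv⟩ := h (by nlinarith)
  set κ := 2 * P / (lam ^ 2 * M ^ 2) with hκdef
  have hκ0 : κ < 0 := div_neg_of_neg_of_pos (by linarith) hM2
  have hκ1 : -1 < κ := by
    rw [hκdef, lt_div_iff₀ hM2]
    linarith
  have hle : ∀ x ∈ Ioo (0 : ℝ) 1, x ^ 2 < x ^ (2 - 2 * lam) ∧ x ^ (2 - 2 * lam) < 1 := by
    intro x hx
    refine ⟨?_, Real.rpow_lt_one hx.1.le hx.2 (by linarith)⟩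
    rw [← Real.rpow_natCast]
    exact Real.rpow_lt_rpow_of_exponent_gt hx.1 hx.2 (by push_cast; linarith)
  -- The rate lies strictly between its values at `κ = -1` and `κ = 0`. Both have explicit
  -- primitives of `1/√F`: `arcsin (x^λ) / λ` and `arcsin x`.
  have hlow : ∀ x ∈ Ioo (0 : ℝ) 1, x ^ (2 - 2 * lam) - x ^ 2 < profileRate lam κ x := by
    intro x hx
    unfold profileRate
    nlinarith [hle x hx]
  have hup : ∀ x ∈ Ioo (0 : ℝ) 1, profileRate lam κ x < 1 - x ^ 2 := by
    intro x hx
    unfold profileRate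
    nlinarith [hle x hx]
  have hF : ∀ x ∈ Ioo (0 : ℝ) 1, 0 < profileRate lam κ x := fun x hx =>
    (by linarith [hle x hx] : (0 : ℝ) < x ^ (2 - 2 * lam) - x ^ 2).trans (hlow x hx)
  have hca := hv.mem.1
  have hcb := hv.mem.2
  constructor
  · have hk : ∀ x ∈ Ioo (0 : ℝ) 1, 1 / √(1 - x ^ 2) * √(profileRate lam κ x) < 1 := by
      intro x hx
      have h2 := Real.sqrt_lt_sqrt (hF x hx).le (hup x hx)
      have h3 : 0 < √(1 - x ^ 2) := (Real.sqrt_nonneg _).trans_lt h2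
      rw [one_div_mul_eq_div, div_lt_one h3]
      exact h2
    obtain ⟨ξ, hξ, η, hη, e⟩ := hv.exists_mean_value hF continuous_arcsin.continuousOn
      fun x hx => hasDerivAt_arcsin (by linarith [hx.1]) hx.2.ne
    rw [arcsin_one, arcsin_zero] at e
    nlinarith [hk ξ hξ, hk η hη]
  · have hder : ∀ x ∈ Ioo (0 : ℝ) 1, HasDerivAt (fun x => 1 / lam * arcsin (x ^ lam))
        (1 / √(x ^ (2 - 2 * lam) - x ^ 2)) x := by
      intro x hx
      have hxl : x ^ lam < 1 := Real.rpow_lt_one hx.1.le hx.2 h0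
      have hxl0 : 0 < x ^ lam := Real.rpow_pos_of_pos hx.1 _
      have h2 := ((hasDerivAt_arcsin (by linarith) hxl.ne).comp x
        (Real.hasDerivAt_rpow_const (p := lam) (Or.inl hx.1.ne'))).const_mul (1 / lam)
      refine h2.congr_deriv ?_
      have e1 : x ^ (2 - 2 * lam) - x ^ 2 = (1 - (x ^ lam) ^ 2) * (x ^ (1 - lam)) ^ 2 := by
        have f1 : x ^ (2 - 2 * lam) = (x ^ (1 - lam)) ^ 2 := by
          rw [← Real.rpow_natCast, ← Real.rpow_mul hx.1.le]
          congr 1; push_cast; ring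
        have f2 : x = x ^ lam * x ^ (1 - lam) := by
          rw [← Real.rpow_add hx.1]
          simp
        rw [f1]
        nth_rewrite 2 [f2]
        ring
      have e2 : x ^ (1 - lam) * x ^ (lam - 1) = 1 := by
        rw [← Real.rpow_add hx.1]
        simp
      have e3 := Real.rpow_pos_of_pos hx.1 (1 - lam)
      have e4 : 0 < √(1 - (x ^ lam) ^ 2) := Real.sqrt_pos.2 (by nlinarith)
      rw [e1, Real.sqrt_mul' _ (by positivity), Real.sqrt_sq e3.le]
      field_simp
      linear_combination e2
    have hk : ∀ x ∈ Ioo (0 : ℝ) 1,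
        1 < 1 / √(x ^ (2 - 2 * lam) - x ^ 2) * √(profileRate lam κ x) := by
      intro x hx
      have h3 : 0 < √(x ^ (2 - 2 * lam) - x ^ 2) := Real.sqrt_pos.2 (by linarith [hle x hx])
      rw [one_div_mul_eq_div, one_lt_div h3]
      exact Real.sqrt_lt_sqrt (by linarith [hle x hx]) (hlow x hx)
    obtain ⟨ξ, hξ, η, hη, e⟩ := hv.exists_mean_value hF
      (Z := fun x => 1 / lam * arcsin (x ^ lam))
      (continuousOn_const.mul (continuous_arcsin.comp_continuousOn
        (continuousOn_id.rpow_const fun x _ => Or.inr h0.le))) hder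
    simp only [Real.one_rpow, Real.zero_rpow h0.ne', arcsin_one, arcsin_zero, mul_zero,
      sub_zero] at e
    have : 2 * (1 / lam * (π / 2)) = π / lam := by field_simp
    rw [this] at e
    nlinarith [hk ξ hξ, hk η hη]

/-! ### Monotonicity and range of the time map; the phase as its inverse. -/

section

variable {lam s : ℝ}

lemma timeMap_zero (lam : ℝ) : timeMap lam 0 = π := by
  simp [timeMap, phaseTime, timeDensity]

lemma phaseTime_strictMono (hs : 0 ≤ s) : StrictMono (phaseTime lam s) := by
  intro x y hxy
  have h1 := integral_interval_sub_left (timeDensity_intervalIntegrable (lam := lam) hs 0 y)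
    (timeDensity_intervalIntegrable hs 0 x)
  have h2 := intervalIntegral_pos_of_pos (timeDensity_intervalIntegrable (lam := lam) hs x y)
    (timeDensity_pos hs) hxy
  unfold phaseTime
  linarith

lemma phaseTime_zero : phaseTime lam s 0 = 0 := by simp [phaseTime]

lemma timeMap_pos (hs : 0 ≤ s) : 0 < timeMap lam s := by
  rw [← phaseTime_zero (lam := lam) (s := s)]
  exact phaseTime_strictMono hs pi_pos

lemma timeMap_le_pi (hs : 0 ≤ s) : timeMap lam s ≤ π := by
  have h := integral_mono_on pi_pos.le (timeDensity_intervalIntegrable (lam := lam) hs 0 π)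
    (intervalIntegrable_const (c := (1 : ℝ))) fun p _ => timeDensity_le_one hs p
  simpa [timeMap, phaseTime] using h

lemma timeExcess_pos (hlam : lam ≠ 1) {p : ℝ} (h1 : sin p ≠ 0) (h2 : cos p ≠ 0) :
    0 < timeExcess lam p := by
  unfold timeExcess
  refine div_pos (abs_pos.2 fun h => ?_) (by positivity)
  have h3 : 0 < |sin p| := abs_pos.2 h1
  have h4 : |sin p| ≠ 1 := by
    intro h4
    have := sin_sq_add_cos_sq p
    rw [← sq_abs (sin p), h4] at this
    apply h2
    have : cos p ^ 2 = 0 := by linarith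
    exact pow_eq_zero_iff (two_ne_zero) |>.1 this
  have h5 : |sin p| ^ (2 - 2 * lam) = 1 := by linarith
  have h6 : |sin p| = 1 := by
    rw [← Real.rpow_rpow_inv h3.le (show 2 - 2 * lam ≠ 0 by intro h; apply hlam; linarith), h5,
      Real.one_rpow]
  exact h4 h6

lemma timeMap_strictAntiOn (hlam : lam ≠ 1) : StrictAntiOn (timeMap lam) (Ici 0) := by
  intro s hs t ht hst
  rw [mem_Ici] at hs ht
  rw [← phaseTime_pi_div_two hs, ← phaseTime_pi_div_two ht]
  have h1 := integral_sub (timeDensity_intervalIntegrable (lam := lam) hs 0 (π / 2))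
    (timeDensity_intervalIntegrable (lam := lam) ht 0 (π / 2))
  have h2 := intervalIntegral_pos_of_pos_on
    ((timeDensity_intervalIntegrable (lam := lam) hs 0 (π / 2)).sub
      (timeDensity_intervalIntegrable (lam := lam) ht 0 (π / 2))) (fun p hp => ?_) (by positivity)
  · unfold phaseTime
    linarith
  · have hsin : 0 < sin p := sin_pos_of_pos_of_lt_pi hp.1 (by linarith [hp.2, pi_pos])
    have hcos : 0 < cos p := cos_pos_of_mem_Ioo ⟨by linarith [hp.1, pi_pos], hp.2⟩
    have he := timeExcess_pos hlam hsin.ne' hcos.ne'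
    rw [sub_pos]
    unfold timeDensity
    have : 0 ≤ s * timeExcess lam p := by positivity
    apply one_div_lt_one_div_of_lt (by positivity)
    apply Real.sqrt_lt_sqrt (by positivity)
    nlinarith

lemma timeMap_continuousOn (lam : ℝ) : ContinuousOn (timeMap lam) (Ici 0) := by
  intro s hs
  refine continuousWithinAt_of_dominated_interval (bound := fun _ => 1) ?_ ?_
    intervalIntegrable_const ?_
  · exact Eventually.of_forall fun t => (measurable_timeDensity lam t).aestronglyMeasurable
  · filter_upwards [self_mem_nhdsWithin] with t ht
    refine ae_of_all _ fun p _ => ?_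
    rw [Real.norm_of_nonneg (timeDensity_pos ht p).le]
    exact timeDensity_le_one ht p
  · refine ae_of_all _ fun p _ => ContinuousAt.continuousWithinAt ?_
    have := mul_nonneg hs (timeExcess_nonneg lam p)
    unfold timeDensity
    exact continuousAt_const.div (by fun_prop) (by positivity)

/-- The density is bounded by 1 and tends to zero at every point of `(0, π/2)`, where the excess is
positive, so dominated convergence applies. -/
lemma timeMap_tendsto_zero (hlam : lam ≠ 1) : Tendsto (timeMap lam) atTop (𝓝 0) := by
  have h : Tendsto (fun s => phaseTime lam s (π / 2)) atTop
      (𝓝 (∫ _ in (0 : ℝ)..(π / 2), (0 : ℝ))) := by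
    refine tendsto_integral_filter_of_dominated_convergence (fun _ => 1) ?_ ?_
      intervalIntegrable_const ?_
    · exact Eventually.of_forall fun t => (measurable_timeDensity lam t).aestronglyMeasurable
    · filter_upwards [eventually_ge_atTop 0] with t ht
      refine ae_of_all _ fun p _ => ?_
      rw [Real.norm_of_nonneg (timeDensity_pos ht p).le]
      exact timeDensity_le_one ht p
    · have hne : ∀ᵐ p : ℝ, p ≠ π / 2 := by simp [ae_iff, measure_singleton]
      filter_upwards [hne] with p hp hpm
      rw [uIoc_of_le (by positivity)] at hpm
      have hp2 : p < π / 2 := lt_of_le_of_ne hpm.2 hp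
      have hsin : 0 < sin p := sin_pos_of_pos_of_lt_pi hpm.1 (by linarith [pi_pos])
      have hcos : 0 < cos p := cos_pos_of_mem_Ioo ⟨by linarith [hpm.1, pi_pos], hp2⟩
      have he := timeExcess_pos hlam hsin.ne' hcos.ne'
      have h1 : Tendsto (fun s => √(1 + s * timeExcess lam p)) atTop atTop :=
        tendsto_sqrt_atTop.comp
          (tendsto_atTop_add_const_left _ _ (tendsto_id.atTop_mul_const he))
      simp only [timeDensity, one_div]
      exact h1.inv_tendsto_atTop
  have h2 := h.const_mul 2
  simp only [intervalIntegral.integral_zero, mul_zero] at h2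
  refine h2.congr' ?_
  filter_upwards [eventually_ge_atTop 0] with t ht
  exact phaseTime_pi_div_two ht

/-- Every value in `(0, T(s))` is attained by the time map beyond `s`. -/
lemma exists_timeMap_eq (hlam : lam ≠ 1) (hs : 0 ≤ s) {y : ℝ} (hy : y ∈ Ioo 0 (timeMap lam s)) :
    ∃ t, s < t ∧ timeMap lam t = y := by
  obtain ⟨u, hu1, hu2⟩ := (((timeMap_tendsto_zero hlam).eventually_lt_const hy.1).and
    (eventually_ge_atTop s)).exists
  obtain ⟨t, ht, hty⟩ := intermediate_value_Icc' hu2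
    ((timeMap_continuousOn lam).mono fun x hx => hs.trans hx.1) ⟨hu1.le, hy.2.le⟩
  refine ⟨t, lt_of_le_of_ne ht.1 ?_, hty⟩
  rintro rfl
  exact hy.2.ne' hty

lemma phaseTime_add_pi (hs : 0 ≤ s) (p : ℝ) :
    phaseTime lam s (p + π) = phaseTime lam s p + timeMap lam s := by
  have h : Function.Periodic (timeDensity lam s) π := timeDensity_add_pi
  have h1 := h.intervalIntegral_add_eq p 0
  have h2 := integral_add_adjacent_intervals
    (timeDensity_intervalIntegrable (lam := lam) hs 0 p)
    (timeDensity_intervalIntegrable hs p (p + π))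
  rw [zero_add] at h1
  unfold timeMap phaseTime
  rw [← h2, h1]

/-- The density is periodic with positive integral over a period, so its primitive is unbounded in
both directions. -/
lemma phaseTime_surjective (hs : 0 ≤ s) : Function.Surjective (phaseTime lam s) := by
  have h : Function.Periodic (timeDensity lam s) π := timeDensity_add_pi
  have hi := fun t₁ t₂ => timeDensity_intervalIntegrable (lam := lam) hs t₁ t₂
  exact (continuous_phaseTime hs).surjective
    (h.tendsto_atTop_intervalIntegral_of_pos (timeMap_pos hs) pi_pos)
    (h.tendsto_atBot_intervalIntegral_of_pos (timeMap_pos hs) pi_pos)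

/-- The phase as a function of time. -/
noncomputable def phase (hs : 0 ≤ s) : ℝ ≃o ℝ :=
  ((phaseTime_strictMono (lam := lam) hs).orderIsoOfSurjective _ (phaseTime_surjective hs)).symm

lemma phaseTime_phase (hs : 0 ≤ s) (θ : ℝ) : phaseTime lam s (phase (lam := lam) hs θ) = θ :=
  StrictMono.orderIsoOfSurjective_self_symm_apply _ _ _ θ

lemma phase_phaseTime (hs : 0 ≤ s) (p : ℝ) : phase (lam := lam) hs (phaseTime lam s p) = p :=
  StrictMono.orderIsoOfSurjective_symm_apply_self _ _ _ p

lemma phase_add_timeMap (hs : 0 ≤ s) (θ : ℝ) :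
    phase (lam := lam) hs (θ + timeMap lam s) = phase (lam := lam) hs θ + π := by
  rw [← phase_phaseTime (lam := lam) hs (phase (lam := lam) hs θ + π), phaseTime_add_pi hs,
    phaseTime_phase]

lemma continuous_phase (hs : 0 ≤ s) : Continuous (phase (lam := lam) hs) :=
  (phase (lam := lam) hs).continuous

lemma phase_zero (hs : 0 ≤ s) : phase (lam := lam) hs 0 = 0 := by
  rw [← phaseTime_zero (lam := lam) (s := s), phase_phaseTime, phaseTime_zero]

lemma phase_int_mul (hs : 0 ≤ s) (k : ℤ) :
    phase (lam := lam) hs (k * timeMap lam s) = k * π := by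
  induction k using Int.induction_on with
  | zero => simp [phase_zero]
  | succ n ih =>
    push_cast at ih ⊢
    rw [add_mul, one_mul, phase_add_timeMap, ih]
    ring
  | pred n ih =>
    push_cast at ih ⊢
    have h := phase_add_timeMap (lam := lam) hs ((-n - 1) * timeMap lam s)
    rw [show (-(n : ℝ) - 1) * timeMap lam s + timeMap lam s = -n * timeMap lam s by ring, ih] at h
    linarith

lemma sin_phase_eq_zero_iff (hs : 0 ≤ s) {θ : ℝ} :
    sin (phase (lam := lam) hs θ) = 0 ↔ ∃ k : ℤ, θ = k * timeMap lam s := by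
  rw [sin_eq_zero_iff]
  refine exists_congr fun k => ?_
  rw [← phase_int_mul (lam := lam) hs k, (phase (lam := lam) hs).injective.eq_iff, eq_comm]

lemma countable_phase_singular (hs : 0 ≤ s) :
    {θ | sin (phase (lam := lam) hs θ) * cos (phase (lam := lam) hs θ) = 0}.Countable := by
  have h : {θ | sin (phase (lam := lam) hs θ) * cos (phase (lam := lam) hs θ) = 0} ⊆
      range fun k : ℤ => phaseTime lam s (k * π / 2) := by
    intro θ hθ
    have h1 : sin (2 * phase (lam := lam) hs θ) = 0 := by
      rw [sin_two_mul]
      rw [mem_ofPred_eq] at hθ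
      linarith
    obtain ⟨k, hk⟩ := sin_eq_zero_iff.1 h1
    refine ⟨k, ?_⟩
    simp only
    rw [hk, mul_div_cancel_left₀ _ two_ne_zero, phaseTime_phase]
  exact (countable_range _).mono h

lemma hasDerivAt_phase (hs : 0 ≤ s) {θ : ℝ}
    (hθ : sin (phase (lam := lam) hs θ) * cos (phase (lam := lam) hs θ) ≠ 0) :
    HasDerivAt (phase (lam := lam) hs) (timeDensity lam s (phase (lam := lam) hs θ))⁻¹ θ :=
  HasDerivAt.of_local_left_inverse (continuous_phase hs).continuousAt
    (hasDerivAt_phaseTime hs (left_ne_zero_of_mul hθ) (right_ne_zero_of_mul hθ))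
    (timeDensity_pos hs _).ne' (Eventually.of_forall (phaseTime_phase hs))

end

/-! ### Construction of solutions from the phase. -/

/-- A continuous function that is differentiable off a countable set, with locally square
integrable derivative, is of class `H¹`. -/
lemma isH1On_of_hasDerivAt_off_countable {ψ g : ℝ → ℝ} {S : Set ℝ} (hS : S.Countable)
    (hψ : Continuous ψ) (hg : Measurable g) (hd : ∀ θ ∉ S, HasDerivAt ψ (g θ) θ)
    (hg2 : ∀ x y, IntervalIntegrable (fun t => g t ^ 2) volume x y) {a b : ℝ} (hab : a ≤ b) :
    IsH1On ψ g a b := by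
  have hgi : ∀ x y, IntervalIntegrable g volume x y := fun x y =>
    (intervalIntegrable_const (c := (1 : ℝ))).add (hg2 x y) |>.mono_fun'
      hg.aestronglyMeasurable (ae_of_all _ fun t => by
        simp only [Real.norm_eq_abs, abs_le]
        constructor <;> nlinarith [sq_nonneg (g t + 1), sq_nonneg (g t - 1)])
  refine ⟨?_, fun x _ y _ => ?_⟩
  · rw [memLp_two_iff_integrable_sq hg.aestronglyMeasurable]
    exact (intervalIntegrable_iff_integrableOn_Ioo_of_le hab).1 (hg2 a b)
  · exact (integral_eq_of_hasDerivAt_off_countable ψ g hS hψ.continuousOn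
      (fun t ht => hd t ht.2) (hgi x y)).symm

/-- The weak identity from the flux `W = λψψ'` by integration by parts. -/
lemma weakIdentity_of_flux {lam P : ℝ} {ψ g W φ : ℝ → ℝ} {S : Set ℝ} (hS : S.Countable)
    (hψ : Continuous ψ) (hW : Continuous W) (hWg : ∀ θ ∉ S, W θ = lam * ψ θ * g θ)
    (hWd : ∀ θ ∉ S, HasDerivAt W
      (2 * (lam - 1) * P + (2 * lam - 1) * g θ ^ 2 - lam ^ 2 * ψ θ ^ 2) θ)
    (hg2 : ∀ x y, IntervalIntegrable (fun t => g t ^ 2) volume x y) (hφ : ContDiff ℝ ∞ φ)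
    {a b : ℝ} (hb : W b * φ b = W a * φ a) : WeakIdentity lam P ψ g φ a b := by
  have hφc := hφ.continuous
  have hφd : Continuous (deriv φ) := hφ.continuous_deriv (by simp)
  have i1 : IntervalIntegrable (fun θ => 2 * (lam - 1) * P * φ θ) volume a b :=
    (continuous_const.mul hφc).intervalIntegrable _ _
  have i2 : IntervalIntegrable (fun θ => (-(2 * lam - 1) * g θ ^ 2 + lam ^ 2 * ψ θ ^ 2) * φ θ)
      volume a b := by
    refine IntervalIntegrable.mul_continuousOn ?_ hφc.continuousOn
    exact ((hg2 a b).const_mul _).add ((continuous_const.mul (hψ.pow 2)).intervalIntegrable _ _)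
  have i3 : IntervalIntegrable (fun θ => W θ * deriv φ θ) volume a b :=
    (hW.mul hφd).intervalIntegrable _ _
  have key := integral_eq_of_hasDerivAt_off_countable (fun θ => W θ * φ θ) (fun θ =>
      2 * (lam - 1) * P * φ θ - ((-(2 * lam - 1) * g θ ^ 2 + lam ^ 2 * ψ θ ^ 2) * φ θ)
        + W θ * deriv φ θ) (a := a) (b := b) hS (hW.mul hφc).continuousOn
    (fun θ hθ => ((hWd θ hθ.2).mul
      ((hφ.differentiable (by simp)) θ).hasDerivAt).congr_deriv (by ring))
    ((i1.sub i2).add i3)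
  rw [hb, sub_self, integral_add (i1.sub i2) i3, integral_sub i1 i2] at key
  have h2 : ∫ θ in a..b, ((-(2 * lam - 1) * g θ ^ 2 + lam ^ 2 * ψ θ ^ 2) * φ θ
      - lam * ψ θ * g θ * deriv φ θ) =
      ∫ θ in a..b, ((-(2 * lam - 1) * g θ ^ 2 + lam ^ 2 * ψ θ ^ 2) * φ θ - W θ * deriv φ θ) := by
    apply intervalIntegral.integral_congr_ae
    filter_upwards [hS.ae_notMem volume] with θ hθ _
    rw [hWg θ hθ]
  unfold WeakIdentity
  rw [h2, integral_sub i2 i3]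
  linarith

/-- The factor `f/|f|` jumps only at zeros of `f`. It is bounded by 1 and `Q` vanishes there, so the
product has no jump. -/
lemma continuous_sign_mul {f Q : ℝ → ℝ} (hf : Continuous f) (hQ : Continuous Q)
    (h0 : ∀ x, f x = 0 → Q x = 0) : Continuous fun x => f x / |f x| * Q x := by
  rw [continuous_iff_continuousAt]
  intro x
  by_cases hx : f x = 0
  · have h1 : Tendsto (fun y => |Q y|) (𝓝 x) (𝓝 0) := by
      have := (hQ.abs).tendsto x
      rwa [h0 x hx, abs_zero] at this
    rw [ContinuousAt, h0 x hx, mul_zero]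
    refine squeeze_zero_norm (fun y => ?_) h1
    rw [Real.norm_eq_abs, abs_mul, abs_div, abs_abs]
    exact mul_le_of_le_one_left (abs_nonneg _) (div_self_le_one _)
  · exact (hf.continuousAt.div hf.continuousAt.abs (abs_pos.2 hx).ne').mul hQ.continuousAt

lemma eventually_sign_eq {f : ℝ → ℝ} (hf : Continuous f) {x : ℝ} (hx : f x ≠ 0) :
    ∀ᶠ y in 𝓝 x, f y / |f y| = f x / |f x| := by
  rcases lt_or_gt_of_ne hx with h | h
  · filter_upwards [hf.continuousAt.eventually_lt_const h] with y hy
    rw [abs_of_neg hy, abs_of_neg h, div_neg_self hy.ne, div_neg_self h.ne]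
  · filter_upwards [hf.continuousAt.eventually_const_lt h] with y hy
    rw [abs_of_pos hy, abs_of_pos h, div_self hy.ne', div_self h.ne']

section

variable {lam κ : ℝ}

/-- `sin p cos p`, where `p` is the phase; its sign is the sign of `v'`. -/
noncomputable def waveSlope (lam κ θ : ℝ) : ℝ :=
  sin (phase (lam := lam) (abs_nonneg κ) θ) * cos (phase (lam := lam) (abs_nonneg κ) θ)

/-- The periodic solution of `(v')² = 1 - v² + κ (1 - v^(2-2λ))` with values in `[0,1]`. -/
noncomputable def wave (lam κ θ : ℝ) : ℝ := |sin (phase (lam := lam) (abs_nonneg κ) θ)|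

lemma continuous_waveSlope : Continuous (waveSlope lam κ) := by
  have := continuous_phase (lam := lam) (abs_nonneg κ)
  unfold waveSlope
  fun_prop

lemma continuous_wave : Continuous (wave lam κ) := by
  have := continuous_phase (lam := lam) (abs_nonneg κ)
  unfold wave
  fun_prop

lemma wave_periodic : Function.Periodic (wave lam κ) (timeMap lam |κ|) := fun θ => by
  simp [wave, phase_add_timeMap, sin_add_pi]

lemma waveSlope_periodic : Function.Periodic (waveSlope lam κ) (timeMap lam |κ|) := fun θ => by
  simp [waveSlope, phase_add_timeMap, sin_add_pi, cos_add_pi]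

lemma wave_nonneg (θ : ℝ) : 0 ≤ wave lam κ θ := abs_nonneg _

lemma wave_le_one (θ : ℝ) : wave lam κ θ ≤ 1 := abs_sin_le_one _

lemma wave_eq_zero_iff {θ : ℝ} : wave lam κ θ = 0 ↔ ∃ k : ℤ, θ = k * timeMap lam |κ| := by
  rw [wave, abs_eq_zero, sin_phase_eq_zero_iff]

lemma wave_eq_zero_or_one {θ : ℝ} (h : waveSlope lam κ θ = 0) :
    wave lam κ θ = 0 ∨ wave lam κ θ = 1 := by
  rcases mul_eq_zero.1 h with h | h
  · left; rw [wave, h, abs_zero]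
  · right
    rw [wave, ← Real.sqrt_sq_eq_abs, sin_sq, h]
    simp

lemma wave_mem_Ioo {θ : ℝ} (h : waveSlope lam κ θ ≠ 0) : wave lam κ θ ∈ Ioo (0 : ℝ) 1 := by
  have h1 := abs_pos.2 (left_ne_zero_of_mul h)
  refine ⟨h1, lt_of_le_of_ne (wave_le_one θ) fun h2 => right_ne_zero_of_mul h ?_⟩
  have h3 := sin_sq_add_cos_sq (phase (lam := lam) (abs_nonneg κ) θ)
  rw [wave] at h2
  rw [← sq_abs (sin _), h2] at h3
  exact pow_eq_zero_iff two_ne_zero |>.1 (by linarith)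

lemma waveSlope_pos {θ : ℝ} (hθ : θ ∈ Ioo 0 (timeMap lam |κ| / 2)) : 0 < waveSlope lam κ θ := by
  have hm := (phase (lam := lam) (abs_nonneg κ)).strictMono
  have h1 := hm hθ.1
  have h2 := hm hθ.2
  rw [phase_zero] at h1
  rw [← phaseTime_pi_div_two (abs_nonneg κ), mul_div_cancel_left₀ _ two_ne_zero,
    phase_phaseTime] at h2
  exact mul_pos (sin_pos_of_pos_of_lt_pi h1 (by linarith [pi_pos]))
    (cos_pos_of_mem_Ioo ⟨by linarith [pi_pos], h2⟩)

lemma waveSlope_neg {θ : ℝ} (hθ : θ ∈ Ioo (timeMap lam |κ| / 2) (timeMap lam |κ|)) :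
    waveSlope lam κ θ < 0 := by
  have hm := (phase (lam := lam) (abs_nonneg κ)).strictMono
  have h1 := hm hθ.1
  have h2 := hm hθ.2
  rw [timeMap, phase_phaseTime] at h2
  rw [← phaseTime_pi_div_two (abs_nonneg κ), mul_div_cancel_left₀ _ two_ne_zero,
    phase_phaseTime] at h1
  exact mul_neg_of_pos_of_neg (sin_pos_of_pos_of_lt_pi (by linarith [pi_pos]) h2)
    (cos_neg_of_pi_div_two_lt_of_lt h1 (by linarith))

lemma countable_waveSlope_eq_zero : {θ | waveSlope lam κ θ = 0}.Countable :=
  countable_phase_singular (abs_nonneg κ)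

/-- The phase moves at speed `√F/|cos p|`, so the chain rule for `|sin p|` leaves `√F` times the
sign of `sin p cos p`. -/
lemma hasDerivAt_wave (hκ : 0 ≤ κ * (1 - lam)) {θ : ℝ} (h : waveSlope lam κ θ ≠ 0) :
    HasDerivAt (wave lam κ) (waveSlope lam κ θ / |waveSlope lam κ θ| *
      √(profileRate lam κ (wave lam κ θ))) θ := by
  have hmem := wave_mem_Ioo h
  have hp := hasDerivAt_phase (abs_nonneg κ) h
  have hsc : sin (phase (lam := lam) (abs_nonneg κ) θ) ≠ 0 := left_ne_zero_of_mul h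
  have hcc : cos (phase (lam := lam) (abs_nonneg κ) θ) ≠ 0 := right_ne_zero_of_mul h
  have hF := profileRate_pos hκ hmem
  have hcos : cos (phase (lam := lam) (abs_nonneg κ) θ) ^ 2 = 1 - wave lam κ θ ^ 2 := by
    rw [wave, sq_abs, cos_sq']
  have hdens : (timeDensity lam |κ| (phase (lam := lam) (abs_nonneg κ) θ))⁻¹ =
      √(profileRate lam κ (wave lam κ θ)) / |cos (phase (lam := lam) (abs_nonneg κ) θ)| := by
    have h3 : 1 + |κ| * timeExcess lam (phase (lam := lam) (abs_nonneg κ) θ) =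
        profileRate lam κ (wave lam κ θ) / cos (phase (lam := lam) (abs_nonneg κ) θ) ^ 2 := by
      unfold timeExcess
      change 1 + |κ| * (|1 - wave lam κ θ ^ (2 - 2 * lam)| / _) = _
      rw [← mul_div_assoc, ← abs_mul, abs_of_nonneg (mul_one_sub_rpow_nonneg hκ hmem)]
      unfold profileRate
      rw [← hcos, add_div, div_self (by positivity)]
    unfold timeDensity
    rw [h3, one_div, inv_inv, Real.sqrt_div hF.le, Real.sqrt_sq_eq_abs]
  have h1 := (hp.sin.pow 2).sqrt (pow_ne_zero 2 hsc)
  have h2 : wave lam κ = fun y => √(((fun x => sin (phase (lam := lam) (abs_nonneg κ) x)) ^ 2) y) := by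
    ext y
    simp [wave, Real.sqrt_sq_eq_abs]
  rw [h2]
  refine h1.congr_deriv ?_
  rw [← h2, hdens]
  simp only [Pi.pow_apply, Real.sqrt_sq_eq_abs, waveSlope, abs_mul]
  have := abs_pos.2 hsc
  have := abs_pos.2 hcc
  field_simp
  simp

/-- The derivative of the stream function `M v^λ`. -/
noncomputable def waveDeriv (lam κ M θ : ℝ) : ℝ :=
  lam * M * wave lam κ θ ^ (lam - 1) *
    (waveSlope lam κ θ / |waveSlope lam κ θ| * √(profileRate lam κ (wave lam κ θ)))

/-- The flux `λψψ'` of the stream function `ψ = M v^λ`. -/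
noncomputable def waveFlux (lam κ M θ : ℝ) : ℝ :=
  lam ^ 2 * M ^ 2 * (waveSlope lam κ θ / |waveSlope lam κ θ| *
    √((1 + κ) * wave lam κ θ ^ (4 * lam - 2) - wave lam κ θ ^ (4 * lam)
      - κ * wave lam κ θ ^ (2 * lam)))

lemma waveSlope_sign_sq {θ : ℝ} (h : waveSlope lam κ θ ≠ 0) :
    (waveSlope lam κ θ / |waveSlope lam κ θ|) ^ 2 = 1 := by
  rw [div_pow, sq_abs, div_self (by positivity)]

lemma continuous_waveFlux (hlam : 1 / 2 < lam) (M : ℝ) : Continuous (waveFlux lam κ M) := by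
  have hv := continuous_wave (lam := lam) (κ := κ)
  have hpow : ∀ p : ℝ, 0 ≤ p → Continuous fun θ => wave lam κ θ ^ p := fun p hp =>
    hv.rpow_const fun _ => Or.inr hp
  have h1 := hpow (4 * lam - 2) (by linarith)
  have h2 := hpow (4 * lam) (by linarith)
  have h3 := hpow (2 * lam) (by linarith)
  refine continuous_const.mul (continuous_sign_mul continuous_waveSlope
    (by fun_prop) fun θ hθ => ?_)
  rcases wave_eq_zero_or_one hθ with h | h
  · rw [h, Real.zero_rpow (by linarith), Real.zero_rpow (by linarith),
      Real.zero_rpow (by linarith)]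
    simp
  · simp [h]

lemma waveFlux_periodic (M : ℝ) : Function.Periodic (waveFlux lam κ M) (timeMap lam |κ|) :=
  fun θ => by
    simp only [waveFlux, wave_periodic θ, waveSlope_periodic θ]

lemma waveDeriv_periodic (M : ℝ) : Function.Periodic (waveDeriv lam κ M) (timeMap lam |κ|) :=
  fun θ => by
    simp only [waveDeriv, wave_periodic θ, waveSlope_periodic θ]

lemma measurable_waveDeriv (M : ℝ) : Measurable (waveDeriv lam κ M) := by
  have h1 := (continuous_wave (lam := lam) (κ := κ)).measurable
  have h2 := (continuous_waveSlope (lam := lam) (κ := κ)).measurable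
  have h3 : Measurable fun θ => |waveSlope lam κ θ| := h2.abs
  unfold waveDeriv profileRate
  fun_prop

lemma hasDerivAt_wave_rpow (hκ : 0 ≤ κ * (1 - lam)) (M : ℝ) {θ : ℝ}
    (h : waveSlope lam κ θ ≠ 0) :
    HasDerivAt (fun x => M * wave lam κ x ^ lam) (waveDeriv lam κ M θ) θ := by
  refine (((hasDerivAt_wave hκ h).rpow_const (p := lam)
    (Or.inl (wave_mem_Ioo h).1.ne')).const_mul M).congr_deriv ?_
  unfold waveDeriv
  ring

/-- The product on the right may combine a vanishing factor with an unbounded `profileRate` at `v =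
0`. Under a single root all exponents are positive once `λ > 1/2`, so the flux extends continuously
through the zeros. -/
lemma sqrt_flux_eq {v : ℝ} (hv : 0 < v) :
    √((1 + κ) * v ^ (4 * lam - 2) - v ^ (4 * lam) - κ * v ^ (2 * lam)) =
      v ^ (2 * lam - 1) * √(profileRate lam κ v) := by
  have e1 : v ^ (4 * lam - 2) = (v ^ (2 * lam - 1)) ^ 2 := by
    rw [← Real.rpow_natCast, ← Real.rpow_mul hv.le]
    congr 1; push_cast; ring
  have e2 : v ^ (4 * lam) = (v ^ (2 * lam - 1)) ^ 2 * v ^ 2 := by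
    rw [← e1, ← Real.rpow_natCast v, ← Real.rpow_add hv]
    congr 1; push_cast; ring
  have e3 : v ^ (2 * lam) = (v ^ (2 * lam - 1)) ^ 2 * v ^ (2 - 2 * lam) := by
    rw [← e1, ← Real.rpow_add hv]
    congr 1; ring
  rw [e1, e2, e3, ← Real.sqrt_sq (Real.rpow_nonneg hv.le (2 * lam - 1)),
    ← Real.sqrt_mul (by positivity), Real.sqrt_sq (Real.rpow_nonneg hv.le (2 * lam - 1))]
  congr 1
  unfold profileRate
  ring

lemma waveFlux_eq (M : ℝ) {θ : ℝ} (h : waveSlope lam κ θ ≠ 0) :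
    waveFlux lam κ M θ = lam * (M * wave lam κ θ ^ lam) * waveDeriv lam κ M θ := by
  have hv := (wave_mem_Ioo h).1
  have e : wave lam κ θ ^ (2 * lam - 1) = wave lam κ θ ^ lam * wave lam κ θ ^ (lam - 1) := by
    rw [← Real.rpow_add hv]
    congr 1; ring
  unfold waveFlux waveDeriv
  rw [sqrt_flux_eq hv, e]
  ring

/-- Differentiating the first-order equation recovers the second-order one wherever the sign of the
slope is locally constant. The quantity `κ * lam ^ 2 * M ^ 2` plays the role of `2P`. -/
lemma hasDerivAt_waveFlux (hκ : 0 ≤ κ * (1 - lam)) (M : ℝ) {θ : ℝ}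
    (h : waveSlope lam κ θ ≠ 0) :
    HasDerivAt (waveFlux lam κ M) ((lam - 1) * (κ * lam ^ 2 * M ^ 2)
      + (2 * lam - 1) * waveDeriv lam κ M θ ^ 2
      - lam ^ 2 * (M * wave lam κ θ ^ lam) ^ 2) θ := by
  have hmem := wave_mem_Ioo h
  have hv := hmem.1
  have hF := profileRate_pos hκ hmem
  have hd := hasDerivAt_wave hκ h
  set σ := waveSlope lam κ θ / |waveSlope lam κ θ| with hσ
  have hσ2 : σ ^ 2 = 1 := waveSlope_sign_sq h
  set v := wave lam κ θ with hvdef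
  have hrate : HasDerivAt (profileRate lam κ)
      (-(2 * v) - κ * ((2 - 2 * lam) * v ^ (2 - 2 * lam - 1))) v := by
    have h1 := ((hasDerivAt_id v).pow 2).const_sub 1
    have h2 := ((Real.hasDerivAt_rpow_const (x := v) (p := 2 - 2 * lam)
      (Or.inl hv.ne')).const_sub 1).const_mul κ
    refine (h1.add h2).congr_deriv ?_
    simp
    ring
  have hc : HasDerivAt (fun y => profileRate lam κ (wave lam κ y)) _ θ :=
    HasDerivAt.comp (h₂ := profileRate lam κ) (h := wave lam κ) θ hrate hd
  have hs := (hc.sqrt hF.ne').const_mul σ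
  have hq := hd.rpow_const (p := 2 * lam - 1) (Or.inl hv.ne')
  have hW := (hq.mul hs).const_mul (lam ^ 2 * M ^ 2)
  refine (hW.congr_of_eventuallyEq ?_).congr_deriv ?_
  · filter_upwards [eventually_sign_eq continuous_waveSlope h,
      continuous_waveSlope.continuousAt.eventually_ne h] with y hy hyne
    have hvy := (wave_mem_Ioo hyne).1
    simp only [waveFlux, Pi.mul_apply]
    rw [sqrt_flux_eq hvy, hy]
    ring
  · have hr := Real.sqrt_pos.2 hF
    have hr2 := Real.sq_sqrt hF.le
    simp only [waveDeriv, ← hvdef, ← hσ]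
    set r := √(profileRate lam κ v)
    have e1 : v ^ (2 * lam - 1) = (v ^ lam) ^ 2 / v := by
      rw [← Real.rpow_natCast, ← Real.rpow_mul hv.le, ← Real.rpow_sub_one hv.ne']
      congr 1; push_cast; ring
    have e2 : v ^ (2 * lam - 1 - 1) = (v ^ lam) ^ 2 / v ^ 2 := by
      rw [Real.rpow_sub_one hv.ne', e1]
      field_simp
    have e3 : v ^ (2 - 2 * lam - 1) = v / (v ^ lam) ^ 2 := by
      rw [← Real.rpow_natCast (v ^ lam), ← Real.rpow_mul hv.le, eq_div_iff (by positivity),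
        ← Real.rpow_add hv]
      push_cast
      rw [show 2 - 2 * lam - 1 + lam * 2 = 1 by ring, Real.rpow_one]
    have e4 : v ^ (lam - 1) = v ^ lam / v := Real.rpow_sub_one hv.ne' _
    have hX := Real.rpow_pos_of_pos hv lam
    rw [e1, e2, e3, e4]
    generalize v ^ lam = X at hX ⊢
    clear_value v σ r
    -- The sign `σ` enters only through `σ² = 1`, so the rising and falling branches share one
    -- computation.
    have e5 : ∀ t : ℝ, σ * (t * (σ * r) / (2 * r)) = t / 2 := fun t => by
      field_simp
      linear_combination t * hσ2
    rw [e5]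
    have e6 : (σ * r) * (σ * r) = r ^ 2 := by linear_combination r ^ 2 * hσ2
    have e7 : (lam * M * (X / v) * (σ * r)) ^ 2 = lam ^ 2 * M ^ 2 * X ^ 2 / v ^ 2 * r ^ 2 := by
      rw [mul_pow, sq (σ * r), e6]; ring
    rw [e7]
    have e8 : σ * r * (2 * lam - 1) * (X ^ 2 / v ^ 2) * (σ * r) =
        (2 * lam - 1) * (X ^ 2 / v ^ 2) * r ^ 2 := by rw [← e6]; ring
    rw [e8]
    field_simp
    ring

end

section

variable {lam κ : ℝ}

/-- On a half period, `(2λ-1)ψ'²` is the nonnegative derivative of a continuous function, the flux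
minus a primitive of the bounded terms. It is therefore integrable up to the ends, even if `ψ'` is
unbounded there. -/
lemma intervalIntegrable_waveDeriv_sq (hlam : 1 / 2 < lam) (hκ : 0 ≤ κ * (1 - lam)) (M : ℝ)
    (x y : ℝ) : IntervalIntegrable (fun θ => waveDeriv lam κ M θ ^ 2) volume x y := by
  have hT := timeMap_pos (lam := lam) (abs_nonneg κ)
  have hper : Function.Periodic (fun θ => waveDeriv lam κ M θ ^ 2) (timeMap lam |κ|) :=
    fun θ => by simp only [waveDeriv_periodic M θ]
  have hv := continuous_wave (lam := lam) (κ := κ)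
  have hψ : Continuous fun θ => wave lam κ θ ^ lam := hv.rpow_const fun _ => Or.inr (by linarith)
  set k : ℝ → ℝ := fun θ => (lam - 1) * (κ * lam ^ 2 * M ^ 2)
      - lam ^ 2 * (M * wave lam κ θ ^ lam) ^ 2 with hk
  have hkc : Continuous k := by fun_prop
  have key : ∀ a b, a ≤ b → (∀ θ ∈ Ioo a b, waveSlope lam κ θ ≠ 0) →
      IntervalIntegrable (fun θ => waveDeriv lam κ M θ ^ 2) volume a b := by
    intro a b hab hne
    have h1 : IntervalIntegrable (fun θ => (2 * lam - 1) * waveDeriv lam κ M θ ^ 2)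
        volume a b := by
      refine intervalIntegrable_deriv_of_nonneg
        (g := fun θ => waveFlux lam κ M θ - ∫ t in 0..θ, k t) ?_ ?_ ?_
      · exact ((continuous_waveFlux hlam M).sub
          (continuous_primitive (fun _ _ => hkc.intervalIntegrable _ _) 0)).continuousOn
      · intro θ hθ
        rw [min_eq_left hab, max_eq_right hab] at hθ
        refine ((hasDerivAt_waveFlux hκ M (hne θ hθ)).sub
          (integral_hasDerivAt_right (hkc.intervalIntegrable _ _)
            (hkc.stronglyMeasurableAtFilter _ _) hkc.continuousAt)).congr_deriv ?_
        simp only [hk]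
        ring
      · intro θ _
        have : 0 < 2 * lam - 1 := by linarith
        positivity
    have h2 := h1.const_mul (2 * lam - 1)⁻¹
    have h3 : 2 * lam - 1 ≠ 0 := by linarith
    simpa only [inv_mul_cancel_left₀ h3] using h2
  refine hper.intervalIntegrable₀ hT.ne' ?_ x y
  exact (key 0 (timeMap lam |κ| / 2) (by linarith) fun θ hθ => (waveSlope_pos hθ).ne').trans
    (key _ _ (by linarith) fun θ hθ => (waveSlope_neg hθ).ne)

lemma continuous_wave_rpow (hlam : 0 ≤ lam) (M : ℝ) :
    Continuous fun θ => M * wave lam κ θ ^ lam :=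
  continuous_const.mul (continuous_wave.rpow_const fun _ => Or.inr hlam)

lemma isH1On_wave (hlam : 1 / 2 < lam) (hκ : 0 ≤ κ * (1 - lam)) (M : ℝ) {a b : ℝ} (hab : a ≤ b) :
    IsH1On (fun θ => M * wave lam κ θ ^ lam) (waveDeriv lam κ M) a b :=
  isH1On_of_hasDerivAt_off_countable countable_waveSlope_eq_zero
    (continuous_wave_rpow (by linarith) M) (measurable_waveDeriv M)
    (fun _ hθ => hasDerivAt_wave_rpow hκ M hθ) (intervalIntegrable_waveDeriv_sq hlam hκ M) hab

lemma weakIdentity_wave (hlam : 1 / 2 < lam) (hκ : 0 ≤ κ * (1 - lam)) {M P : ℝ}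
    (hP : 2 * P = κ * lam ^ 2 * M ^ 2) {φ : ℝ → ℝ} (hφ : ContDiff ℝ ∞ φ) {a b : ℝ}
    (hb : waveFlux lam κ M b * φ b = waveFlux lam κ M a * φ a) :
    WeakIdentity lam P (fun θ => M * wave lam κ θ ^ lam) (waveDeriv lam κ M) φ a b :=
  weakIdentity_of_flux countable_waveSlope_eq_zero
    (continuous_wave_rpow (by linarith) M) (continuous_waveFlux hlam M)
    (fun _ hθ => waveFlux_eq M hθ)
    (fun _ hθ => (hasDerivAt_waveFlux hκ M hθ).congr_deriv (by rw [← hP]; ring))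
    (intervalIntegrable_waveDeriv_sq hlam hκ M) hφ hb

lemma wave_rpow_eq_zero_iff (hlam : 0 < lam) {M : ℝ} (hM : 0 < M) {θ : ℝ} :
    M * wave lam κ θ ^ lam = 0 ↔ ∃ k : ℤ, θ = k * timeMap lam |κ| := by
  rw [mul_eq_zero, or_iff_right hM.ne', Real.rpow_eq_zero (wave_nonneg θ) hlam.ne',
    wave_eq_zero_iff]

lemma bernoulli_wave (hlam : 0 < lam) (hκ : 0 ≤ κ * (1 - lam)) {M P : ℝ} (hM : 0 < M)
    (hP : 2 * P = κ * lam ^ 2 * M ^ 2) {θ : ℝ} (h : waveSlope lam κ θ ≠ 0) :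
    (2 * P + lam ^ 2 * (M * wave lam κ θ ^ lam) ^ 2 + waveDeriv lam κ M θ ^ 2) *
      |M * wave lam κ θ ^ lam| ^ (2 / lam - 2) =
    (2 * P + lam ^ 2 * M ^ 2) * M ^ (2 / lam - 2) := by
  have hmem := wave_mem_Ioo h
  have hv := hmem.1
  have hX := Real.rpow_pos_of_pos hv lam
  have hF := profileRate_pos hκ hmem
  have e1 : (M * wave lam κ θ ^ lam) ^ (2 / lam - 2) =
      M ^ (2 / lam - 2) * wave lam κ θ ^ (2 - 2 * lam) := by
    rw [Real.mul_rpow hM.le hX.le, ← Real.rpow_mul hv.le]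
    congr 2; field_simp
  have e2 : waveDeriv lam κ M θ ^ 2 =
      lam ^ 2 * M ^ 2 * (wave lam κ θ ^ (lam - 1)) ^ 2 * profileRate lam κ (wave lam κ θ) := by
    unfold waveDeriv
    rw [mul_pow, mul_pow (_ / _), waveSlope_sign_sq h, Real.sq_sqrt hF.le]
    ring
  have e3 : wave lam κ θ ^ (lam - 1) = wave lam κ θ ^ lam / wave lam κ θ :=
    Real.rpow_sub_one hv.ne' _
  have e4 : wave lam κ θ ^ (2 - 2 * lam) = wave lam κ θ ^ 2 / (wave lam κ θ ^ lam) ^ 2 := by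
    rw [eq_div_iff (by positivity), ← Real.rpow_natCast (_ ^ lam), ← Real.rpow_mul hv.le,
      ← Real.rpow_add hv, ← Real.rpow_natCast]
    congr 1; push_cast; ring
  rw [abs_of_pos (mul_pos hM hX), e1, e2, e3]
  unfold profileRate
  rw [e4, hP]
  generalize wave lam κ θ ^ lam = X at hX ⊢
  field_simp
  ring

/-- There is a local solution with any prescribed maximum `M`. -/
theorem exists_isLocalSolution {P M : ℝ} (hlam : 1 / 2 < lam) (hP : 0 ≤ P * (1 - lam))
    (hM : 0 < M) :
    ∃ ψ, IsLocalSolution lam P ψ 0 (timeMap lam |2 * P / (lam ^ 2 * M ^ 2)|) ∧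
      HasBernoulli lam P ((2 * P + lam ^ 2 * M ^ 2) * M ^ (2 / lam - 2)) ψ 0
        (timeMap lam |2 * P / (lam ^ 2 * M ^ 2)|) := by
  have h0 : 0 < lam := by linarith
  set κ := 2 * P / (lam ^ 2 * M ^ 2) with hκdef
  have hκP : 2 * P = κ * lam ^ 2 * M ^ 2 := by
    rw [hκdef]; field_simp
  have hκ : 0 ≤ κ * (1 - lam) := by
    have : κ * (1 - lam) = 2 * (P * (1 - lam)) / (lam ^ 2 * M ^ 2) := by rw [hκdef]; ring
    rw [this]
    positivity
  have hT := timeMap_pos (lam := lam) (abs_nonneg κ)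
  have hloc : IsLocalSolution lam P (fun θ => M * wave lam κ θ ^ lam) 0 (timeMap lam |κ|) := by
    refine ⟨hT, (wave_rpow_eq_zero_iff h0 hM).2 ⟨0, by simp⟩,
      (wave_rpow_eq_zero_iff h0 hM).2 ⟨1, by simp⟩, fun θ hθ hz => ?_, waveDeriv lam κ M,
      isH1On_wave hlam hκ M hT.le, fun φ hφ _ hφs => weakIdentity_wave hlam hκ hκP hφ ?_⟩
    · obtain ⟨k, hk⟩ := (wave_rpow_eq_zero_iff h0 hM).1 hz
      have h1 : (0 : ℝ) < k := by
        by_contra hcon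
        have := mul_nonpos_of_nonpos_of_nonneg (not_lt.1 hcon) hT.le
        linarith [hθ.1]
      have h2 : (k : ℝ) < 1 := by
        by_contra hcon
        have := mul_le_mul_of_nonneg_right (not_lt.1 hcon) hT.le
        linarith [hθ.2]
      have h3 : 0 < k := by exact_mod_cast h1
      have h4 : k < 1 := by exact_mod_cast h2
      omega
    · have hz : ∀ x, x ∉ Ioo 0 (timeMap lam |κ|) → φ x = 0 := fun x hx => by
        by_contra hne
        exact hx (hφs (subset_tsupport _ hne))
      rw [hz 0 (by simp), hz (timeMap lam |κ|) (by simp)]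
      simp
  refine ⟨_, hloc, ?_⟩
  obtain ⟨B, hB⟩ := hloc.exists_hasBernoulli h0
  -- A Bernoulli constant is already known to exist, so one point of nonzero slope identifies it.
  -- This avoids the top of the wave, where the derivative formula does not apply directly.
  have hq : timeMap lam |κ| / 4 ∈ Ioo 0 (timeMap lam |κ| / 2) := ⟨by linarith, by linarith⟩
  have hs := (waveSlope_pos hq).ne'
  have h1 := (hB _ ⟨hq.1, by linarith [hq.2]⟩).2
  rw [(hasDerivAt_wave_rpow hκ M hs).deriv, bernoulli_wave h0 hκ hM hκP hs] at h1
  rwa [h1]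

lemma exists_amplitude {P t : ℝ} (hP : P ≠ 0) (hlam : 0 < lam) (ht : 0 < t) :
    ∃ M, 0 < M ∧ |2 * P / (lam ^ 2 * M ^ 2)| = t := by
  have hP' := abs_pos.2 hP
  have hM : 0 < √(2 * |P| / (lam ^ 2 * t)) := Real.sqrt_pos.2 (by positivity)
  refine ⟨_, hM, ?_⟩
  rw [abs_div, abs_of_pos (show 0 < lam ^ 2 * √(2 * |P| / (lam ^ 2 * t)) ^ 2 by positivity),
    Real.sq_sqrt (by positivity), abs_mul, abs_of_pos (zero_lt_two' ℝ)]
  field_simp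

/-- Gluing `N` copies of a local solution with life-span `2π/N`. -/
theorem exists_isSolution_of_three_le {P : ℝ} (hlam : 1 / 2 < lam) (hP : 0 < P * (1 - lam)) {N : ℕ}
    (hN : 3 ≤ N) :
    ∃ ψ, IsSolution lam P ψ ∧ ∀ θ, ψ θ = 0 ↔ ∃ k : ℤ, θ = k * (2 * π / N) := by
  have h0 : 0 < lam := by linarith
  have hlam1 : lam ≠ 1 := by rintro rfl; simp at hP
  have hP0 : P ≠ 0 := by rintro rfl; simp at hP
  have hN' : (3 : ℝ) ≤ N := by exact_mod_cast hN
  have hNpos : (0 : ℝ) < N := by linarith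
  -- The time map starts at `π` and decreases to 0, so `2π/N` is attained because `N ≥ 3` gives
  -- `2π/N < π`.
  obtain ⟨t, ht, hty⟩ := exists_timeMap_eq hlam1 (le_refl 0) (y := 2 * π / N) (by
    rw [timeMap_zero]
    refine ⟨by positivity, ?_⟩
    rw [div_lt_iff₀ hNpos]
    nlinarith [pi_pos])
  obtain ⟨M, hM, hκabs⟩ := exists_amplitude hP0 h0 ht
  set κ := 2 * P / (lam ^ 2 * M ^ 2) with hκdef
  have hκP : 2 * P = κ * lam ^ 2 * M ^ 2 := by
    rw [hκdef]; field_simp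
  have hκ : 0 ≤ κ * (1 - lam) := by
    have : κ * (1 - lam) = 2 * (P * (1 - lam)) / (lam ^ 2 * M ^ 2) := by rw [hκdef]; ring
    rw [this]
    positivity
  have hT : timeMap lam |κ| = 2 * π / N := by rw [hκabs, hty]
  have hNT : (N : ℝ) * timeMap lam |κ| = 2 * π := by rw [hT]; field_simp
  refine ⟨fun θ => M * wave lam κ θ ^ lam, ⟨?_, waveDeriv lam κ M,
    isH1On_wave hlam hκ M (by positivity), fun φ hφ hφp => weakIdentity_wave hlam hκ hκP hφ ?_⟩,
    fun θ => by rw [wave_rpow_eq_zero_iff h0 hM, hT]⟩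
  · have := (wave_periodic (lam := lam) (κ := κ)).nat_mul N
    rw [hNT] at this
    intro θ
    simp only [this θ]
  · have := (waveFlux_periodic (lam := lam) (κ := κ) M).nat_mul N
    rw [hNT] at this
    rw [this.eq, hφp.eq]

end

/-! ### Zero sets, shear flows and symmetry classes. -/

/-- Where the cosine is nonzero, a shear flow can vanish only on a whole neighbourhood, which
isolated zeros forbid. All zeros of `ψ` would then be zeros of one cosine, but these are `π` apart
and `2π/N < π`. -/
lemma not_isParallelShear_of_zeros {lam : ℝ} {ψ : ℝ → ℝ} {N : ℕ} (hN : 3 ≤ N)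
    (hz : ∀ θ, ψ θ = 0 ↔ ∃ k : ℤ, θ = k * (2 * π / N)) : ¬ IsParallelShear lam ψ := by
  rintro ⟨A, C, θ₀, h⟩
  have hN' : (3 : ℝ) ≤ N := by exact_mod_cast hN
  set τ : ℝ := 2 * π / N with hτ
  have hτ0 : 0 < τ := by positivity
  have hτπ : τ < π := by
    rw [hτ, div_lt_iff₀ (by linarith)]
    nlinarith [pi_pos]
  have key : ∀ k : ℤ, cos (k * τ - θ₀) = 0 := by
    intro k
    by_contra hc
    have h0 := (hz (k * τ)).2 ⟨k, rfl⟩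
    rw [h, mul_eq_zero, or_iff_right (Real.rpow_pos_of_pos (abs_pos.2 hc) _).ne'] at h0
    have hcont : Continuous fun θ => cos (θ - θ₀) := by fun_prop
    have hev : ∀ᶠ θ in 𝓝 (k * τ), ψ θ = 0 := by
      rcases lt_or_gt_of_ne hc with hl | hl
      · filter_upwards [hcont.continuousAt.eventually_lt_const hl] with θ hθ
        rw [if_neg (not_lt.2 hl.le)] at h0
        rw [h, if_neg (not_lt.2 hθ.le), h0, mul_zero]
      · filter_upwards [hcont.continuousAt.eventually_const_lt hl] with θ hθ
        rw [if_pos hl] at h0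
        rw [h, if_pos hθ, h0, mul_zero]
    obtain ⟨ε, hε, hball⟩ := Metric.eventually_nhds_iff.1 hev
    have hδ : 0 < min (ε / 2) (τ / 2) := lt_min (by linarith) (by linarith)
    have h1 := hball (y := k * τ + min (ε / 2) (τ / 2)) (by
      rw [Real.dist_eq, add_sub_cancel_left, abs_of_pos hδ]
      exact (min_le_left _ _).trans_lt (by linarith))
    obtain ⟨j, hj⟩ := (hz _).1 h1
    have h2 : ((j - k : ℤ) : ℝ) * τ = min (ε / 2) (τ / 2) := by
      push_cast
      linarith
    have h3 : (0 : ℝ) < ((j - k : ℤ) : ℝ) := by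
      rw [← h2] at hδ
      exact pos_of_mul_pos_left hδ hτ0.le
    have h4 : ((j - k : ℤ) : ℝ) < 1 := by
      have := min_le_right (ε / 2) (τ / 2)
      rw [← h2] at this
      nlinarith
    have h5 : 0 < j - k := by exact_mod_cast h3
    have h6 : j - k < 1 := by exact_mod_cast h4
    omega
  have k0 := key 0
  have k1 := key 1
  simp only [Int.cast_zero, zero_mul, zero_sub, cos_neg, Int.cast_one, one_mul] at k0 k1
  rw [cos_sub, k0, mul_zero, zero_add] at k1
  have hs : sin θ₀ ≠ 0 := fun hs => by
    have := sin_sq_add_cos_sq θ₀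
    rw [k0, hs] at this
    norm_num at this
  exact (sin_pos_of_pos_of_lt_pi hτ0 hτπ).ne' ((mul_eq_zero.1 k1).resolve_right hs)

/-- A symmetry carries one lattice of zeros onto the other by an isometry of the line. Each spacing
is then an integer multiple of the other, so the positive spacings agree. -/
lemma not_symEquiv_of_zeros {ψ₁ ψ₂ : ℝ → ℝ} {τ₁ τ₂ : ℝ} (h1 : 0 < τ₁) (h2 : 0 < τ₂)
    (hz1 : ∀ θ, ψ₁ θ = 0 ↔ ∃ k : ℤ, θ = k * τ₁) (hz2 : ∀ θ, ψ₂ θ = 0 ↔ ∃ k : ℤ, θ = k * τ₂)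
    (hne : τ₁ ≠ τ₂) : ¬ SymEquiv ψ₁ ψ₂ := by
  rintro ⟨α, σ, θ₀, hα, hσ, h⟩
  have hiff : ∀ θ, (∃ k : ℤ, θ = k * τ₂) ↔ ∃ k : ℤ, σ * θ + θ₀ = k * τ₁ := fun θ => by
    rw [← hz1, ← hz2, h, mul_eq_zero, or_iff_right hα]
  obtain ⟨k₀, hk₀⟩ := (hiff 0).1 ⟨0, by simp⟩
  rw [mul_zero, zero_add] at hk₀
  have hσ1 : σ * σ = 1 := by rcases hσ with rfl | rfl <;> norm_num
  have hσz : ∃ m : ℤ, σ = m := by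
    rcases hσ with rfl | rfl
    · exact ⟨1, by simp⟩
    · exact ⟨-1, by simp⟩
  obtain ⟨m, hm⟩ := hσz
  obtain ⟨i, hi⟩ := (hiff τ₂).1 ⟨1, by simp⟩
  obtain ⟨j, hj⟩ := (hiff τ₁).2 ⟨m + k₀, by push_cast; rw [← hm, hk₀]; ring⟩
  have e1 : τ₂ = ((m * (i - k₀) : ℤ) : ℝ) * τ₁ := by
    push_cast
    rw [← hm]
    linear_combination (-τ₂) * hσ1 + σ * hi - σ * hk₀
  set n : ℤ := m * (i - k₀)
  have e2 : ((j * n : ℤ) : ℝ) * τ₁ = 1 * τ₁ := by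
    push_cast
    rw [mul_assoc, ← e1, ← hj, one_mul]
  have e3 : j * n = 1 := by exact_mod_cast mul_right_cancel₀ h1.ne' e2
  have e4 : (0 : ℝ) < (n : ℝ) := by
    rw [e1] at h2
    exact pos_of_mul_pos_left h2 h1.le
  have e5 : 0 < n := by exact_mod_cast e4
  have e6 : n = 1 := by
    rcases Int.mul_eq_one_iff_eq_one_or_neg_one.1 e3 with h | h <;> omega
  rw [e6] at e1
  apply hne
  simpa using e1.symm

theorem infinitelyManyHyperbolic {lam P : ℝ} (hlam : 1 / 2 < lam) (hP : 0 < P * (1 - lam)) :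
    InfinitelyManyHyperbolic lam P := by
  choose ψ hψ hz using fun n : ℕ => exists_isSolution_of_three_le hlam hP
    (show 3 ≤ n + 3 by omega)
  refine ⟨ψ, fun n => ⟨hψ n, ?_, not_isParallelShear_of_zeros (by omega) (hz n)⟩, ?_⟩
  · have hn : (0 : ℝ) < ((n + 3 : ℕ) : ℝ) := by positivity
    refine ⟨0, ⟨le_rfl, by positivity⟩, 2 * π / (n + 3 : ℕ), ⟨by positivity, ?_⟩, ?_,
      (hz n 0).2 ⟨0, by simp⟩, (hz n _).2 ⟨1, by simp⟩⟩
    · rw [div_lt_iff₀ hn]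
      push_cast
      nlinarith [pi_pos, (Nat.cast_nonneg n : (0 : ℝ) ≤ n)]
    · exact (by positivity : 0 < 2 * π / ((n + 3 : ℕ) : ℝ)).ne
  · intro m n hmn
    refine not_symEquiv_of_zeros (by positivity) (by positivity) (hz m) (hz n) fun h => hmn ?_
    have hp : 2 * π ≠ 0 := by positivity
    rw [div_eq_div_iff (by positivity) (by positivity)] at h
    have := mul_left_cancel₀ hp h
    have : n + 3 = m + 3 := by exact_mod_cast this
    omega

/-! ### From the circle to arcs between consecutive zeros. -/

/-- The `2π`-periodic extension of the restriction of `φ` to `[a, a + 2π)`. -/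
noncomputable def periodize (a : ℝ) (φ : ℝ → ℝ) (x : ℝ) : ℝ := φ (toIcoMod two_pi_pos a x)

lemma periodize_periodic (a : ℝ) (φ : ℝ → ℝ) : Function.Periodic (periodize a φ) (2 * π) :=
  fun x => by rw [periodize, periodize, toIcoMod_periodic]

lemma periodize_eq {a : ℝ} {φ : ℝ → ℝ} {x : ℝ} (hx : x ∈ Ico a (a + 2 * π)) :
    periodize a φ x = φ x := by
  rw [periodize, (toIcoMod_eq_self two_pi_pos).2 hx]

lemma eq_zero_of_notMem_of_tsupport_subset {φ : ℝ → ℝ} {U : Set ℝ} (h : tsupport φ ⊆ U) {x : ℝ}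
    (hx : x ∉ U) : φ x = 0 := by
  by_contra hne
  exact hx (h (subset_tsupport _ hne))

lemma contDiff_periodize {φ : ℝ → ℝ} {a b : ℝ} (hb : b ≤ a + 2 * π) (hφ : ContDiff ℝ ∞ φ)
    (hs : tsupport φ ⊆ Ioo a b) : ContDiff ℝ ∞ (periodize a φ) := by
  rw [contDiff_iff_contDiffAt]
  intro x
  set n := toIcoDiv two_pi_pos a x with hn
  have hx : x - n • (2 * π) ∈ Ico a (a + 2 * π) := sub_toIcoDiv_zsmul_mem_Ico two_pi_pos a x
  -- If `x` is the left end of its cell, points just below `x` belong to the previous cell, and the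
  -- second translate represents them. On either side of the end the other translate lies outside
  -- the support.
  have h1 : ContDiffAt ℝ ∞ (fun y => φ (y - n • (2 * π)) + φ (y - n • (2 * π) + 2 * π)) x := by
    have e1 : ContDiff ℝ ∞ fun y : ℝ => y - n • (2 * π) := contDiff_id.sub contDiff_const
    have e2 : ContDiff ℝ ∞ fun y : ℝ => y - n • (2 * π) + 2 * π := e1.add contDiff_const
    exact ((hφ.comp e1).add (hφ.comp e2)).contDiffAt
  refine h1.congr_of_eventuallyEq ?_
  have hopen : ∀ᶠ y in 𝓝 x, y - n • (2 * π) ∈ Ioo (a - 2 * π) (a + 2 * π) := by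
    have hc : ContinuousAt (fun y : ℝ => y - n • (2 * π)) x := by fun_prop
    exact hc.eventually (isOpen_Ioo.mem_nhds ⟨by linarith [hx.1, pi_pos], hx.2⟩)
  filter_upwards [hopen] with y hy
  rcases lt_or_ge (y - n • (2 * π)) a with h | h
  · have : toIcoMod two_pi_pos a y = y - n • (2 * π) + 2 * π :=
      (toIcoMod_eq_iff two_pi_pos).2 ⟨⟨by linarith [hy.1], by linarith⟩, n - 1, by
        rw [sub_smul]; simp⟩
    rw [periodize, this, eq_zero_of_notMem_of_tsupport_subset (x := y - n • (2 * π)) hs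
      fun h' => by linarith [h'.1], zero_add]
  · have : toIcoMod two_pi_pos a y = y - n • (2 * π) :=
      (toIcoMod_eq_iff two_pi_pos).2 ⟨⟨h, hy.2⟩, n, by simp⟩
    rw [periodize, this, eq_zero_of_notMem_of_tsupport_subset (x := y - n • (2 * π) + 2 * π) hs
      fun h' => by linarith [h'.2], add_zero]

/-- A solution on the circle has a periodic weak derivative, and the equation may be tested on any
interval no longer than the period. -/
theorem IsSolution.exists_derivative {lam P : ℝ} {ψ : ℝ → ℝ} (H : IsSolution lam P ψ) :
    ∃ g : ℝ → ℝ, (∀ a b, a ≤ b → IsH1On ψ g a b) ∧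
      ∀ a b, a ≤ b → b ≤ a + 2 * π → ∀ φ : ℝ → ℝ, ContDiff ℝ ∞ φ → tsupport φ ⊆ Ioo a b →
        WeakIdentity lam P ψ g φ a b := by
  obtain ⟨hper, g₀, hg₀, hw⟩ := H
  have h2π := two_pi_pos
  set g := periodize 0 g₀ with hg
  have hgp : Function.Periodic g (2 * π) := periodize_periodic 0 g₀
  have hne : ∀ᵐ t : ℝ, t ≠ 2 * π := by simp [ae_iff, measure_singleton]
  have hae : ∀ᵐ t, t ∈ Icc 0 (2 * π) → g t = g₀ t := by
    filter_upwards [hne] with t ht htm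
    exact periodize_eq ⟨htm.1, by rw [zero_add]; exact lt_of_le_of_ne htm.2 ht⟩
  have hsub : ∀ x ∈ Icc 0 (2 * π), ∀ y ∈ Icc 0 (2 * π), uIoc x y ⊆ Icc 0 (2 * π) :=
    fun x hx y hy => uIoc_subset_uIcc.trans ((ordConnected_Icc).uIcc_subset hx hy)
  have h0m : (0 : ℝ) ∈ Icc 0 (2 * π) := left_mem_Icc.2 h2π.le
  have hTm : 2 * π ∈ Icc 0 (2 * π) := right_mem_Icc.2 h2π.le
  have hgi : ∀ x y, IntervalIntegrable g volume x y := by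
    refine hgp.intervalIntegrable₀ h2π.ne' ?_
    refine (hg₀.intervalIntegrable h2π.le).congr_ae ?_
    rw [EventuallyEq, ae_restrict_iff' measurableSet_uIoc]
    filter_upwards [hae] with t ht htm using (ht (hsub _ h0m _ hTm htm)).symm
  have hgi2 : ∀ x y, IntervalIntegrable (fun t => g t ^ 2) volume x y := by
    have hp2 : Function.Periodic (fun t => g t ^ 2) (2 * π) := fun t => by simp only [hgp t]
    refine hp2.intervalIntegrable₀ h2π.ne' ?_
    refine (hg₀.intervalIntegrable_sq h2π.le).congr_ae ?_
    rw [EventuallyEq, ae_restrict_iff' measurableSet_uIoc]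
    filter_upwards [hae] with t ht htm
    simp only [ht (hsub _ h0m _ hTm htm)]
  have hint : ∀ x ∈ Icc 0 (2 * π), ψ x = ψ 0 + ∫ t in 0..x, g t := by
    intro x hx
    have h1 := hg₀.2 0 h0m x hx
    have h2 : ∫ t in 0..x, g t = ∫ t in 0..x, g₀ t := by
      apply intervalIntegral.integral_congr_ae
      filter_upwards [hae] with t ht htm using ht (hsub _ h0m _ hx htm)
    linarith
  have hzero : ∫ t in 0..(2 * π), g t = 0 := by
    have h1 := hint _ hTm
    have h2 := hper 0
    rw [zero_add] at h2
    linarith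
  -- The difference of `ψ` and the primitive is periodic because `g` has mean zero. It is constant
  -- on one period, hence everywhere.
  have hprim : ∀ x, ψ x = ψ 0 + ∫ t in 0..x, g t := by
    have hD : Function.Periodic (fun x => ψ x - ∫ t in 0..x, g t) (2 * π) := by
      intro x
      have h1 := integral_add_adjacent_intervals (hgi 0 x) (hgi x (x + 2 * π))
      have h2 := hgp.intervalIntegral_add_eq x 0
      rw [zero_add, hzero] at h2
      simp only [hper x]
      linarith
    intro x
    obtain ⟨y, hy, hxy⟩ := hD.exists_mem_Ico₀ h2π x
    have h3 := hint y (Ico_subset_Icc_self hy)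
    linarith
  have hH1 : ∀ a b, a ≤ b → IsH1On ψ g a b := by
    intro a b hab
    refine ⟨?_, fun x _ y _ => ?_⟩
    · have hm : AEStronglyMeasurable g (volume.restrict (Ioo a b)) :=
        ((intervalIntegrable_iff_integrableOn_Ioo_of_le hab).1 (hgi a b)).aestronglyMeasurable
      rw [memLp_two_iff_integrable_sq hm]
      exact (intervalIntegrable_iff_integrableOn_Ioo_of_le hab).1 (hgi2 a b)
    · have h1 := integral_add_adjacent_intervals (hgi 0 x) (hgi x y)
      rw [hprim x, hprim y, ← h1]
      ring
  refine ⟨g, hH1, fun a b hab hb φ hφ hs => ?_⟩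
  have hper' := periodize_periodic a φ
  have hsm := contDiff_periodize hb hφ hs
  have hdper : Function.Periodic (deriv (periodize a φ)) (2 * π) := fun x => by
    have : (fun y => periodize a φ (y + 2 * π)) = periodize a φ := funext hper'
    conv_rhs => rw [← this]
    rw [deriv_comp_add_const]
  have h1 := hw _ hsm hper'
  unfold WeakIdentity at h1 ⊢
  have e1 : ∫ θ in (0 : ℝ)..(2 * π), 2 * (lam - 1) * P * periodize a φ θ =
      ∫ θ in a..b, 2 * (lam - 1) * P * φ θ := by
    have p1 : Function.Periodic (fun θ => 2 * (lam - 1) * P * periodize a φ θ) (2 * π) :=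
      fun θ => by simp only [hper' θ]
    have q1 := p1.intervalIntegral_add_eq 0 a
    rw [zero_add] at q1
    rw [q1]
    have q2 : ∫ θ in a..(a + 2 * π), 2 * (lam - 1) * P * periodize a φ θ =
        ∫ θ in a..(a + 2 * π), 2 * (lam - 1) * P * φ θ := by
      rw [integral_of_le (by linarith), integral_of_le (by linarith),
        ← integral_Ico_eq_integral_Ioc, ← integral_Ico_eq_integral_Ioc]
      exact setIntegral_congr_fun measurableSet_Ico fun θ hθ => by simp only [periodize_eq hθ]
    rw [q2]
    have hsupp : Function.support (fun θ => 2 * (lam - 1) * P * φ θ) ⊆ Ioc a b := fun θ hθ =>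
      Ioo_subset_Ioc_self (hs (subset_tsupport _ (right_ne_zero_of_mul hθ)))
    rw [integral_eq_integral_of_support_subset hsupp,
      integral_eq_integral_of_support_subset (hsupp.trans (Ioc_subset_Ioc_right hb))]
  have e2 : ∫ θ in (0 : ℝ)..(2 * π), ((-(2 * lam - 1) * g₀ θ ^ 2 + lam ^ 2 * ψ θ ^ 2)
        * periodize a φ θ - lam * ψ θ * g₀ θ * deriv (periodize a φ) θ) =
      ∫ θ in a..b, ((-(2 * lam - 1) * g θ ^ 2 + lam ^ 2 * ψ θ ^ 2) * φ θ
        - lam * ψ θ * g θ * deriv φ θ) := by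
    have q0 : ∫ θ in (0 : ℝ)..(2 * π), ((-(2 * lam - 1) * g₀ θ ^ 2 + lam ^ 2 * ψ θ ^ 2)
        * periodize a φ θ - lam * ψ θ * g₀ θ * deriv (periodize a φ) θ) =
        ∫ θ in (0 : ℝ)..(2 * π), ((-(2 * lam - 1) * g θ ^ 2 + lam ^ 2 * ψ θ ^ 2)
        * periodize a φ θ - lam * ψ θ * g θ * deriv (periodize a φ) θ) := by
      apply intervalIntegral.integral_congr_ae
      filter_upwards [hae] with t ht htm
      rw [ht (hsub _ h0m _ hTm htm)]
    have p1 : Function.Periodic (fun θ => (-(2 * lam - 1) * g θ ^ 2 + lam ^ 2 * ψ θ ^ 2)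
        * periodize a φ θ - lam * ψ θ * g θ * deriv (periodize a φ) θ) (2 * π) :=
      fun θ => by simp only [hper' θ, hper θ, hgp θ, hdper θ]
    have q1 := p1.intervalIntegral_add_eq 0 a
    rw [zero_add] at q1
    rw [q0, q1]
    have q2 : ∫ θ in a..(a + 2 * π), ((-(2 * lam - 1) * g θ ^ 2 + lam ^ 2 * ψ θ ^ 2)
        * periodize a φ θ - lam * ψ θ * g θ * deriv (periodize a φ) θ) =
        ∫ θ in a..(a + 2 * π), ((-(2 * lam - 1) * g θ ^ 2 + lam ^ 2 * ψ θ ^ 2) * φ θ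
        - lam * ψ θ * g θ * deriv φ θ) := by
      rw [integral_of_le (by linarith), integral_of_le (by linarith),
        integral_Ioc_eq_integral_Ioo, integral_Ioc_eq_integral_Ioo]
      refine setIntegral_congr_fun measurableSet_Ioo fun θ hθ => ?_
      have hev : periodize a φ =ᶠ[𝓝 θ] φ := by
        filter_upwards [isOpen_Ioo.mem_nhds hθ] with y hy
        exact periodize_eq (Ioo_subset_Ico_self hy)
      simp only [hev.deriv_eq, hev.eq_of_nhds]
    rw [q2]
    have hsupp : Function.support (fun θ => (-(2 * lam - 1) * g θ ^ 2 + lam ^ 2 * ψ θ ^ 2) * φ θ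
        - lam * ψ θ * g θ * deriv φ θ) ⊆ Ioc a b := by
      intro θ hθ
      by_contra hθb
      have hθo : θ ∉ tsupport φ := fun h => hθb (Ioo_subset_Ioc_self (hs h))
      apply hθ
      have h3 : deriv φ θ = 0 := by
        by_contra h4
        exact hθo (support_deriv_subset h4)
      simp only [image_eq_zero_of_notMem_tsupport hθo, h3, mul_zero, sub_zero]
    rw [integral_eq_integral_of_support_subset hsupp,
      integral_eq_integral_of_support_subset (hsupp.trans (Ioc_subset_Ioc_right hb))]
  rw [← e1, ← e2]
  exact h1

lemma IsSolution.continuous {lam P : ℝ} {ψ : ℝ → ℝ} (H : IsSolution lam P ψ) : Continuous ψ := by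
  obtain ⟨g, hg, -⟩ := H.exists_derivative
  rw [continuous_iff_continuousAt]
  intro x
  exact ((hg (x - 1) (x + 1) (by linarith)).continuousOn (by linarith)).continuousAt
    (Icc_mem_nhds (by linarith) (by linarith))

/-- The arcs between consecutive zeros of a solution carry local solutions. -/
lemma IsSolution.isLocalSolution {lam P : ℝ} {ψ : ℝ → ℝ} (H : IsSolution lam P ψ) {a b : ℝ}
    (hab : a < b) (hb : b ≤ a + 2 * π) (h1 : ψ a = 0) (h2 : ψ b = 0)
    (hne : ∀ θ ∈ Ioo a b, ψ θ ≠ 0) : IsLocalSolution lam P ψ a b := by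
  obtain ⟨g, hg, hw⟩ := H.exists_derivative
  exact ⟨hab, h1, h2, hne, g, hg a b hab.le, fun φ hφ _ hs => hw a b hab.le hb φ hφ hs⟩

/-- A solution with `P ≠ 0` and `λ ≠ 1` does not vanish on an interval. -/
lemma IsSolution.exists_ne_zero {lam P : ℝ} {ψ : ℝ → ℝ} (H : IsSolution lam P ψ) (hP : P ≠ 0)
    (hlam : lam ≠ 1) {a b : ℝ} (hab : a < b) (hb : b ≤ a + 2 * π) :
    ∃ θ ∈ Ioo a b, ψ θ ≠ 0 := by
  by_contra hcon
  push Not at hcon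
  obtain ⟨g, hg, hw⟩ := H.exists_derivative
  have hgi := (hg a b hab.le).intervalIntegrable hab.le
  have hmid : (a + b) / 2 ∈ Ioo a b := ⟨by linarith, by linarith⟩
  have hg0 : ∀ᵐ x, x ∈ Ioo a b → g x = 0 := by
    filter_upwards [hgi.ae_hasDerivAt_integral] with x hx hxm
    have h1 := hx (by rw [uIcc_of_le hab.le]; exact Ioo_subset_Icc_self hxm) ((a + b) / 2)
      (by rw [uIcc_of_le hab.le]; exact Ioo_subset_Icc_self hmid)
    refine h1.unique ((hasDerivAt_const x (0 : ℝ)).congr_of_eventuallyEq ?_)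
    filter_upwards [isOpen_Ioo.mem_nhds hxm] with y hy
    rw [← (hg a b hab.le).2 _ (Ioo_subset_Icc_self hmid) _ (Ioo_subset_Icc_self hy),
      hcon y hy, hcon _ hmid, sub_zero]
  obtain ⟨η, h1, -, h3, h4⟩ := exists_test_function_integral_eq_one hab
  have h5 := hw a b hab.le hb η h1 h3
  unfold WeakIdentity at h5
  rw [intervalIntegral.integral_const_mul, h4, mul_one] at h5
  have hne : ∀ᵐ t : ℝ, t ≠ b := by simp [ae_iff, measure_singleton]
  rw [integral_zero_ae] at h5
  · have h6 : lam - 1 ≠ 0 := sub_ne_zero.2 hlam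
    exact mul_ne_zero (mul_ne_zero two_ne_zero h6) hP h5
  · filter_upwards [hg0, hne] with x hx hxb hxm
    rw [uIoc_of_le hab.le] at hxm
    have hxo : x ∈ Ioo a b := ⟨hxm.1, lt_of_le_of_ne hxm.2 hxb⟩
    rw [hx hxo, hcon x hxo]
    ring

/-- The ends are the last zero before `x` and the first one after it, which exist by compactness. -/
lemma exists_arc {ψ : ℝ → ℝ} (hψ : Continuous ψ) {a b x : ℝ} (hx : x ∈ Ioo a b) (ha : ψ a = 0)
    (hb : ψ b = 0) (hne : ψ x ≠ 0) :
    ∃ c d, a ≤ c ∧ c < x ∧ x < d ∧ d ≤ b ∧ ψ c = 0 ∧ ψ d = 0 ∧ ∀ θ ∈ Ioo c d, ψ θ ≠ 0 := by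
  have hcl : IsClosed {θ | ψ θ = 0} := isClosed_eq hψ continuous_const
  obtain ⟨c, hc, hcmax⟩ := (isCompact_Icc.inter_right hcl (s := Icc a x)).exists_isGreatest
    ⟨a, left_mem_Icc.2 hx.1.le, ha⟩
  obtain ⟨d, hd, hdmin⟩ := (isCompact_Icc.inter_right hcl (s := Icc x b)).exists_isLeast
    ⟨b, right_mem_Icc.2 hx.2.le, hb⟩
  have hc0 : ψ c = 0 := hc.2
  have hd0 : ψ d = 0 := hd.2
  have hcx : c < x := lt_of_le_of_ne hc.1.2 fun h => hne (h ▸ hc0)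
  have hdx : x < d := lt_of_le_of_ne hd.1.1 fun h => hne (h ▸ hd0)
  refine ⟨c, d, hc.1.1, hcx, hdx, hd.1.2, hc0, hd0, fun θ hθ hz => ?_⟩
  rcases le_total θ x with h | h
  · exact absurd (hcmax ⟨⟨hc.1.1.trans hθ.1.le, h⟩, hz⟩) (not_le.2 hθ.1)
  · exact absurd (hdmin ⟨⟨h, hθ.2.le.trans hd.1.2⟩, hz⟩) (not_le.2 hθ.2)

/-- Two zeros on the circle force a local solution with life-span at most `π`. -/
lemma IsSolution.exists_isLocalSolution_le_pi {lam P : ℝ} {ψ : ℝ → ℝ} (H : IsSolution lam P ψ)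
    (hP : P ≠ 0) (hlam : lam ≠ 1) {θ₁ θ₂ : ℝ} (h1 : θ₁ ∈ Ico 0 (2 * π)) (h2 : θ₂ ∈ Ico 0 (2 * π))
    (hne : θ₁ ≠ θ₂) (hz1 : ψ θ₁ = 0) (hz2 : ψ θ₂ = 0) :
    ∃ a b, IsLocalSolution lam P ψ a b ∧ b - a ≤ π := by
  wlog hlt : θ₁ < θ₂ generalizing θ₁ θ₂
  · exact this h2 h1 hne.symm hz2 hz1 (lt_of_le_of_ne (not_lt.1 hlt) hne.symm)
  have key : ∀ a b, a < b → b - a ≤ π → ψ a = 0 → ψ b = 0 →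
      ∃ a b, IsLocalSolution lam P ψ a b ∧ b - a ≤ π := by
    intro a b hab hle ha hb
    obtain ⟨x, hx, hx0⟩ := H.exists_ne_zero hP hlam hab (by linarith [pi_pos])
    obtain ⟨c, d, hac, hcx, hxd, hdb, hc, hd, hcd⟩ := exists_arc H.continuous hx ha hb hx0
    exact ⟨c, d, H.isLocalSolution (hcx.trans hxd) (by linarith [pi_pos]) hc hd hcd, by linarith⟩
  -- Two points cut the circle into complementary arcs, one of which has length at most `π`.
  rcases le_or_gt (θ₂ - θ₁) π with h | h
  · exact key θ₁ θ₂ hlt h hz1 hz2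
  · exact key θ₂ (θ₁ + 2 * π) (by linarith [h1.1, h2.2]) (by linarith) hz2 (by rw [H.1, hz1])

/-- Properties of positive profiles that do not depend on the sign hold for local solutions. -/
lemma IsLocalSolution.elim_profile {lam P : ℝ} {ψ : ℝ → ℝ} {a b : ℝ} (hlam : 0 < lam)
    (H : IsLocalSolution lam P ψ a b) {q : Prop} (h : ∀ B ψ', IsProfile lam P B ψ' a b → q) :
    q := by
  obtain ⟨B, hB⟩ := H.exists_hasBernoulli hlam
  rcases H.isProfile hlam hB with h1 | h1
  · exact h _ _ h1
  · exact h _ _ h1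

lemma IsLocalSolution.exists_profile {lam P B : ℝ} {ψ : ℝ → ℝ} {a b : ℝ} (hlam : 0 < lam)
    (H : IsLocalSolution lam P ψ a b) (HB : HasBernoulli lam P B ψ a b) :
    ∃ ψ', IsProfile lam P B ψ' a b := by
  rcases H.isProfile hlam HB with h | h
  · exact ⟨_, h⟩
  · exact ⟨_, h⟩

lemma IsLocalSolution.pressure_nonpos_of_one_lt {lam P : ℝ} {ψ : ℝ → ℝ} {a b : ℝ}
    (H : IsLocalSolution lam P ψ a b) (h1 : 1 < lam) : P ≤ 0 :=
  H.elim_profile (by linarith) fun _ _ h => h.pressure_nonpos_of_one_lt h1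

lemma IsProfile.pressure_neg_of_le_half {lam P B : ℝ} {ψ : ℝ → ℝ} {a b : ℝ}
    (H : IsProfile lam P B ψ a b) (h0 : 0 < lam) (h1 : lam ≤ 1 / 2) :
    P < 0 ∧ b - a = π / lam := by
  obtain rfl := H.bernoulli_eq_zero_of_le_half h0 h1
  obtain ⟨hl, M, hM, hP, -⟩ := H.eq_cos_of_bernoulli_eq_zero h0
  have : 0 < lam ^ 2 * M ^ 2 := by positivity
  exact ⟨by linarith, hl⟩

lemma IsProfile.pi_lt_lifespan {lam P B : ℝ} {ψ : ℝ → ℝ} {a b : ℝ}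
    (H : IsProfile lam P B ψ a b) (h0 : 0 < lam) (h1 : lam < 1) (hP : P < 0) :
    b - a ∈ Ioc π (π / lam) := by
  rcases (H.bernoulli_nonneg_of_lt_one h0 h1).eq_or_lt with h | h
  · rw [← h] at H
    rw [(H.eq_cos_of_bernoulli_eq_zero h0).1]
    refine ⟨?_, le_rfl⟩
    rw [lt_div_iff₀ h0]
    nlinarith [pi_pos]
  · exact Ioo_subset_Ioc_self (H.lifespan_mem_Ioo h0 h1 hP h)

/-- For `λ > 1/2` no local solution fills the circle. -/
lemma IsProfile.lifespan_lt_two_pi {lam P B : ℝ} {ψ : ℝ → ℝ} {a b : ℝ}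
    (H : IsProfile lam P B ψ a b) (hlam : 1 / 2 < lam) : b - a < 2 * π := by
  have h0 : 0 < lam := by linarith
  have hmain : 0 ≤ P * (1 - lam) → b - a < 2 * π := fun hP => by
    obtain ⟨M, -, -, h⟩ := H.lifespan_eq h0 hP
    rw [h]
    exact (timeMap_le_pi (abs_nonneg _)).trans_lt (by linarith [pi_pos])
  rcases lt_trichotomy lam 1 with h1 | h1 | h1
  · rcases lt_or_ge P 0 with hP | hP
    · refine (H.pi_lt_lifespan h0 h1 hP).2.trans_lt ?_
      rw [div_lt_iff₀ h0]
      nlinarith [pi_pos]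
    · exact hmain (mul_nonneg hP (by linarith))
  · exact hmain (by simp [h1])
  · exact hmain (mul_nonneg_of_nonpos_of_nonpos (H.pressure_nonpos_of_one_lt h1) (by linarith))

/-- Every local solution would last longer than `π`, while two zeros produce one that does not. -/
theorem not_isHyperbolic_of_lt_one {lam P : ℝ} {ψ : ℝ → ℝ} (h0 : 0 < lam) (h1 : lam < 1)
    (hP : P < 0) : ¬ IsHyperbolic lam P ψ := by
  rintro ⟨H, ⟨θ₁, h1', θ₂, h2', hne, hz1, hz2⟩, -⟩
  obtain ⟨a, b, hl, hle⟩ := H.exists_isLocalSolution_le_pi hP.ne h1.ne h1' h2' hne hz1 hz2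
  exact hl.elim_profile h0 fun _ _ h => not_lt.2 hle (h.pi_lt_lifespan h0 h1 hP).1

theorem not_isHyperbolic_of_one_lt {lam P : ℝ} {ψ : ℝ → ℝ} (h1 : 1 < lam)
    (hP : 0 < P) : ¬ IsHyperbolic lam P ψ := by
  rintro ⟨H, ⟨θ₁, h1', θ₂, h2', hne, hz1, hz2⟩, -⟩
  obtain ⟨a, b, hl, -⟩ := H.exists_isLocalSolution_le_pi hP.ne' h1.ne' h1' h2' hne hz1 hz2
  exact not_lt.2 (hl.pressure_nonpos_of_one_lt h1) hP

theorem not_isHyperbolic_of_le_half {lam P : ℝ} {ψ : ℝ → ℝ} (h0 : 0 < lam) (h1 : lam ≤ 1 / 2) :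
    ¬ IsHyperbolic lam P ψ := by
  rintro ⟨H, ⟨θ₁, h1', θ₂, h2', hne, hz1, hz2⟩, hsh⟩
  rcases eq_or_ne P 0 with hP | hP
  -- Local solutions with `λ ≤ 1/2` have strictly negative pressure. For `P = 0` a nonzero value of
  -- `ψ` would produce one, so `ψ` vanishes identically and is the trivial shear flow.
  · apply hsh
    refine ⟨0, 0, 0, fun θ => ?_⟩
    rw [ite_self, mul_zero]
    by_contra hθ
    obtain ⟨y, hy, hyθ⟩ := H.1.exists_mem_Ico two_pi_pos θ θ₁
    rw [hyθ] at hθ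
    have hy1 : θ₁ < y := lt_of_le_of_ne hy.1 fun h => hθ (h ▸ hz1)
    obtain ⟨c, d, hac, hcx, hxd, hdb, hc, hd, hcd⟩ := exists_arc H.continuous ⟨hy1, hy.2⟩ hz1
      (by rw [H.1, hz1]) hθ
    exact (H.isLocalSolution (hcx.trans hxd) (by linarith) hc hd hcd).elim_profile h0
      fun _ _ h => (h.pressure_neg_of_le_half h0 h1).1.ne hP
  · obtain ⟨a, b, hl, hle⟩ := H.exists_isLocalSolution_le_pi hP (by linarith) h1' h2' hne hz1 hz2
    refine hl.elim_profile h0 fun _ _ h => ?_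
    rw [(h.pressure_neg_of_le_half h0 h1).2, div_le_iff₀ h0] at hle
    nlinarith [pi_pos]

/-! ### Parabolic solutions. -/

/-- The flows with `Ψ = r^(1/2) ψ`, `ψ² = γ + γ cos(θ - θ₀)`. -/
lemma isSolution_sqrt {γ ε θ₀ : ℝ} (hγ : 0 < γ) (hε : ε = 1 ∨ ε = -1) :
    IsSolution (1 / 2) (-γ / 4) (fun θ => ε * √(γ + γ * cos (θ - θ₀))) := by
  have hε2 : ε ^ 2 = 1 := by rcases hε with rfl | rfl <;> norm_num
  set ψ : ℝ → ℝ := fun θ => ε * √(γ + γ * cos (θ - θ₀)) with hψ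
  set g : ℝ → ℝ := fun θ => ε * (-(γ * sin (θ - θ₀)) / (2 * √(γ + γ * cos (θ - θ₀)))) with hg
  -- The flux is `(1/2)ψψ' = (ψ²)'/4`, which is smooth even at the zeros of `ψ`.
  set W : ℝ → ℝ := fun θ => -(γ / 4) * sin (θ - θ₀) with hW
  set S : Set ℝ := {θ | γ + γ * cos (θ - θ₀) = 0} with hS
  have hnn : ∀ θ, 0 ≤ γ + γ * cos (θ - θ₀) := fun θ => by
    nlinarith [neg_one_le_cos (θ - θ₀)]
  have hScount : S.Countable := by
    refine (countable_range fun k : ℤ => θ₀ + π + k * (2 * π)).mono fun θ hθ => ?_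
    have h1 : cos (θ - θ₀ - π) = 1 := by
      have h2 : γ * (1 + cos (θ - θ₀)) = 0 := by
        rw [hS, mem_ofPred_eq] at hθ
        linarith
      rw [cos_sub_pi]
      linarith [(mul_eq_zero.1 h2).resolve_left hγ.ne']
    obtain ⟨k, hk⟩ := (cos_eq_one_iff _).1 h1
    exact ⟨k, by simp only; linarith⟩
  have hψc : Continuous ψ := by fun_prop
  have hgm : Measurable g := by fun_prop
  have hpos : ∀ θ ∉ S, 0 < γ + γ * cos (θ - θ₀) := fun θ hθ =>
    lt_of_le_of_ne (hnn θ) fun h => hθ h.symm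
  have hd : ∀ θ ∉ S, HasDerivAt ψ (g θ) θ := by
    intro θ hθ
    have h1 : HasDerivAt (fun x => γ + γ * cos (x - θ₀)) (-(γ * sin (θ - θ₀))) θ :=
      ((((hasDerivAt_id θ).sub_const θ₀).cos.const_mul γ).const_add γ).congr_deriv (by simp)
    exact (h1.sqrt (hpos θ hθ).ne').const_mul ε
  have hψ2 : ∀ θ, ψ θ ^ 2 = γ + γ * cos (θ - θ₀) := fun θ => by
    simp only [hψ]
    rw [mul_pow, hε2, one_mul, Real.sq_sqrt (hnn θ)]
  -- Off the zeros, `sin² = (1 - cos)(1 + cos)` cancels the vanishing denominator, so `g²` is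
  -- bounded.
  have hg2 : ∀ θ ∉ S, g θ ^ 2 = γ * (1 - cos (θ - θ₀)) / 4 := by
    intro θ hθ
    simp only [hg]
    rw [mul_pow, hε2, one_mul, div_pow, mul_pow, Real.sq_sqrt (hnn θ), neg_sq, mul_pow, sin_sq]
    have := (hpos θ hθ).ne'
    rw [div_eq_div_iff (by positivity) (by norm_num)]
    ring
  have hg2i : ∀ x y, IntervalIntegrable (fun t => g t ^ 2) volume x y := by
    intro x y
    have h1 : IntervalIntegrable (fun θ => γ * (1 - cos (θ - θ₀)) / 4) volume x y :=
      Continuous.intervalIntegrable (by fun_prop) _ _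
    refine h1.congr_ae (ae_restrict_of_ae ?_)
    filter_upwards [hScount.ae_notMem volume] with θ hθ using (hg2 θ hθ).symm
  refine ⟨fun θ => ?_, g,
    isH1On_of_hasDerivAt_off_countable hScount hψc hgm hd hg2i (by positivity),
    fun φ hφ hφp => weakIdentity_of_flux (W := W) hScount hψc (by fun_prop)
      (fun θ hθ => ?_) (fun θ hθ => ?_) hg2i hφ ?_⟩
  · simp only [hψ]
    rw [show θ + 2 * π - θ₀ = θ - θ₀ + 2 * π by ring, cos_add_two_pi]
  · have h1 := Real.sqrt_pos.2 (hpos θ hθ)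
    simp only [hW, hψ, hg]
    generalize √(γ + γ * cos (θ - θ₀)) = r at h1 ⊢
    field_simp
    rw [hε2]
    ring
  · refine (((hasDerivAt_id θ).sub_const θ₀).sin.const_mul (-(γ / 4))).congr_deriv ?_
    rw [hψ2]
    simp
    ring
  · have h1 : W (2 * π) = W 0 := by
      simp only [hW]
      rw [show 2 * π - θ₀ = 0 - θ₀ + 2 * π by ring, sin_add_two_pi]
    rw [h1, hφp.eq]

lemma sqrt_eq_zero_iff_exists {γ ε θ₀ θ : ℝ} (hγ : 0 < γ) (hε : ε = 1 ∨ ε = -1) :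
    ε * √(γ + γ * cos (θ - θ₀)) = 0 ↔ ∃ k : ℤ, θ = θ₀ + π + k * (2 * π) := by
  have hε0 : ε ≠ 0 := by rcases hε with rfl | rfl <;> norm_num
  have hnn : 0 ≤ γ + γ * cos (θ - θ₀) := by
    nlinarith [neg_one_le_cos (θ - θ₀)]
  rw [mul_eq_zero, or_iff_right hε0, Real.sqrt_eq_zero hnn]
  have h1 : γ + γ * cos (θ - θ₀) = 0 ↔ cos (θ - θ₀ - π) = 1 := by
    rw [cos_sub_pi]
    constructor
    · intro h
      have h2 : γ * (1 + cos (θ - θ₀)) = 0 := by linarith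
      linarith [(mul_eq_zero.1 h2).resolve_left hγ.ne']
    · intro h
      rw [show cos (θ - θ₀) = -1 by linarith]
      ring
  rw [h1, cos_eq_one_iff]
  refine exists_congr fun k => ⟨fun h => by linarith, fun h => by linarith⟩

lemma isParabolic_sqrt {γ ε θ₀ : ℝ} (hγ : 0 < γ) (hε : ε = 1 ∨ ε = -1) :
    IsParabolic (1 / 2) (-γ / 4) (fun θ => ε * √(γ + γ * cos (θ - θ₀))) := by
  refine ⟨isSolution_sqrt hγ hε, ?_⟩
  obtain ⟨m, hm, huniq⟩ := existsUnique_add_zsmul_mem_Ico two_pi_pos (θ₀ + π) 0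
  simp only [zero_add, zsmul_eq_mul] at hm huniq
  refine ⟨θ₀ + π + m * (2 * π), ⟨hm, (sqrt_eq_zero_iff_exists hγ hε).2 ⟨m, rfl⟩⟩, ?_⟩
  rintro y ⟨hy, hz⟩
  obtain ⟨k, rfl⟩ := (sqrt_eq_zero_iff_exists hγ hε).1 hz
  rw [huniq k hy]

lemma IsParabolic.exists_eq_sqrt {lam P : ℝ} {ψ : ℝ → ℝ} (hlam : 0 < lam)
    (H : IsParabolic lam P ψ) :
    lam = 1 / 2 ∧ ∃ γ ε θ₀ : ℝ, 0 < γ ∧ (ε = 1 ∨ ε = -1) ∧ P = -γ / 4 ∧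
      ∀ θ, ψ θ = ε * √(γ + γ * cos (θ - θ₀)) := by
  obtain ⟨hsol, z, ⟨hz, hz0⟩, huniq⟩ := H
  have hz2 : ψ (z + 2 * π) = 0 := by rw [hsol.1, hz0]
  have hloc : IsLocalSolution lam P ψ z (z + 2 * π) := by
    refine hsol.isLocalSolution (by linarith [pi_pos]) le_rfl hz0 hz2 fun θ hθ h0 => ?_
    rcases lt_or_ge θ (2 * π) with h | h
    · exact hθ.1.ne' (huniq θ ⟨⟨hz.1.trans hθ.1.le, h⟩, h0⟩)
    · have h1 : ψ (θ - 2 * π) = 0 := by rw [← hsol.1, sub_add_cancel, h0]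
      have h2 := huniq (θ - 2 * π) ⟨⟨by linarith, by linarith [hθ.2, hz.2]⟩, h1⟩
      linarith [hθ.2]
  obtain ⟨B, hB⟩ := hloc.exists_hasBernoulli hlam
  have key : ∀ ψ' : ℝ → ℝ, Function.Periodic ψ' (2 * π) → IsProfile lam P B ψ' z (z + 2 * π) →
      lam = 1 / 2 ∧ ∃ γ θ₀ : ℝ, 0 < γ ∧ P = -γ / 4 ∧
      ∀ θ, ψ' θ = √(γ + γ * cos (θ - θ₀)) := by
    intro ψ' hper h
    -- The single zero makes the life-span exactly `2π`, too long for `λ > 1/2`. The cosine formula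
    -- then gives `π/λ = 2π`.
    have hle : lam ≤ 1 / 2 := by
      by_contra hcon
      have := h.lifespan_lt_two_pi (not_le.1 hcon)
      linarith
    obtain rfl := h.bernoulli_eq_zero_of_le_half hlam hle
    obtain ⟨hl, M, hM, hMP, hcos⟩ := h.eq_cos_of_bernoulli_eq_zero hlam
    have hlam2 : lam = 1 / 2 := by
      rw [add_sub_cancel_left, eq_div_iff hlam.ne'] at hl
      have : π * (2 * lam - 1) = 0 := by linarith
      linarith [(mul_eq_zero.1 this).resolve_left pi_pos.ne']
    -- The half-angle formula turns `M cos ((θ - θ₀)/2)` into the square root with `γ = M²/2`. The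
    -- centre `θ₀ = z + π` is opposite the zero, and the cosine is nonnegative on the period
    -- starting at `z`.
    refine ⟨hlam2, M ^ 2 / 2, z + π, by positivity, ?_, fun θ => ?_⟩
    · rw [hlam2] at hMP
      linarith
    · obtain ⟨y, hy, hyθ⟩ := Function.Periodic.exists_mem_Ico
        (f := fun θ => ψ' θ - √(M ^ 2 / 2 + M ^ 2 / 2 * cos (θ - (z + π))))
        (fun x => by
          simp only
          rw [hper, show x + 2 * π - (z + π) = x - (z + π) + 2 * π by ring, cos_add_two_pi])
        two_pi_pos θ z
      have h1 := hcos y (Ico_subset_Icc_self hy)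
      have harg : lam * (y - (z + (z + 2 * π)) / 2) = (y - (z + π)) / 2 := by
        rw [hlam2]; ring
      rw [harg] at h1
      have hc : 0 ≤ cos ((y - (z + π)) / 2) :=
        cos_nonneg_of_mem_Icc ⟨by linarith [hy.1], by linarith [hy.2]⟩
      have h2 : M ^ 2 / 2 + M ^ 2 / 2 * cos (y - (z + π)) =
          (M * cos ((y - (z + π)) / 2)) ^ 2 := by
        have := cos_sq ((y - (z + π)) / 2)
        rw [mul_div_cancel₀ _ (two_ne_zero' ℝ)] at this
        rw [mul_pow, this]
        ring
      rw [h2, Real.sqrt_sq (by positivity), h1, sub_self] at hyθ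
      linarith
  rcases hloc.isProfile hlam hB with h | h
  · obtain ⟨h1, γ, θ₀, hγ, hP, he⟩ := key _ hsol.1 h
    exact ⟨h1, γ, 1, θ₀, hγ, Or.inl rfl, hP, fun θ => by rw [he θ, one_mul]⟩
  · obtain ⟨h1, γ, θ₀, hγ, hP, he⟩ := key _ (fun x => by simp only [hsol.1 x]) h
    exact ⟨h1, γ, -1, θ₀, hγ, Or.inr rfl, hP, fun θ => by
      have := he θ
      linarith⟩

theorem isParabolic_iff {lam P : ℝ} {ψ : ℝ → ℝ} (hlam : 0 < lam) :
    IsParabolic lam P ψ ↔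
      lam = 1 / 2 ∧ ∃ γ ε θ₀ : ℝ, 0 < γ ∧ (ε = 1 ∨ ε = -1) ∧ P = -γ / 4 ∧
        ∀ θ : ℝ, ψ θ = ε * √(γ + γ * cos (θ - θ₀)) := by
  refine ⟨fun H => H.exists_eq_sqrt hlam, ?_⟩
  rintro ⟨rfl, γ, ε, θ₀, hγ, hε, rfl, h⟩
  rw [show ψ = fun θ => ε * √(γ + γ * cos (θ - θ₀)) from funext h]
  exact isParabolic_sqrt hγ hε

/-! ### The Bernoulli constant as a function of the maximum, and the ranges of the life-span. -/

/-- The Bernoulli constant of a local solution with maximum `M`. -/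
noncomputable def bernoulliOfMax (lam P M : ℝ) : ℝ :=
  (2 * P + lam ^ 2 * M ^ 2) * M ^ (2 / lam - 2)

section

variable {lam P : ℝ}

lemma bernoulliOfMax_eq {M : ℝ} (hM : 0 < M) :
    bernoulliOfMax lam P M = 2 * P * M ^ (2 / lam - 2) + lam ^ 2 * M ^ (2 / lam) := by
  have e : M ^ (2 / lam) = M ^ 2 * M ^ (2 / lam - 2) := by
    rw [← Real.rpow_natCast, ← Real.rpow_add hM]
    congr 1; push_cast; ring
  rw [bernoulliOfMax, e]
  ring

lemma bernoulliOfMax_strictMonoOn (h0 : 0 < lam) (hP : 0 ≤ P * (1 - lam)) :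
    StrictMonoOn (bernoulliOfMax lam P) (Ioi 0) := by
  intro x hx y hy hxy
  rw [mem_Ioi] at hx hy
  rw [bernoulliOfMax_eq hx, bernoulliOfMax_eq hy]
  have h1 : x ^ (2 / lam) < y ^ (2 / lam) := Real.rpow_lt_rpow hx.le hxy (by positivity)
  have h2 : P * x ^ (2 / lam - 2) ≤ P * y ^ (2 / lam - 2) := by
    rcases lt_trichotomy lam 1 with h | h | h
    · have hp : 0 ≤ 2 / lam - 2 := by
        rw [sub_nonneg, le_div_iff₀ h0]; linarith
      exact mul_le_mul_of_nonneg_left (Real.rpow_le_rpow hx.le hxy.le hp)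
        (nonneg_of_mul_nonneg_left hP (by linarith))
    · simp [h]
    · have hp : 2 / lam - 2 ≤ 0 := by
        rw [sub_nonpos, div_le_iff₀ h0]; linarith
      refine mul_le_mul_of_nonpos_left (Real.rpow_le_rpow_of_nonpos hx hxy.le hp) ?_
      by_contra hcon
      nlinarith
  have h3 : 0 < lam ^ 2 := by positivity
  nlinarith

lemma exists_bernoulliOfMax_ge (h0 : 0 < lam) (hP : 0 ≤ P * (1 - lam)) (B : ℝ) :
    ∃ M, 0 < M ∧ B ≤ bernoulliOfMax lam P M := by
  have h1 : Tendsto (fun M : ℝ => lam ^ 2 * M ^ (2 / lam)) atTop atTop :=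
    (tendsto_rpow_atTop (by positivity)).const_mul_atTop (by positivity)
  -- For `P < 0` the sign condition forces `λ ≥ 1`. The pressure term is then at least `-2|P|` once
  -- `M ≥ 1`, and the surplus `2|P|` absorbs it.
  obtain ⟨M, hM1, hM2⟩ := ((h1.eventually_ge_atTop (B + 2 * |P|)).and
    (eventually_ge_atTop 1)).exists
  have hM : 0 < M := by linarith
  refine ⟨M, hM, ?_⟩
  rw [bernoulliOfMax_eq hM]
  suffices -|P| ≤ P * M ^ (2 / lam - 2) by linarith
  rcases le_or_gt 0 P with h | h
  · exact (neg_nonpos.2 (abs_nonneg P)).trans (mul_nonneg h (Real.rpow_nonneg hM.le _))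
  · have hl : 1 ≤ lam := by
      by_contra hcon
      nlinarith
    have hp : 2 / lam - 2 ≤ 0 := by
      rw [sub_nonpos, div_le_iff₀ h0]; linarith
    have := Real.rpow_le_one_of_one_le_of_nonpos hM2 hp
    rw [abs_of_neg h, neg_neg]
    nlinarith

lemma tendsto_bernoulliOfMax_of_lt_one (h0 : 0 < lam) (h1 : lam < 1) :
    Tendsto (bernoulliOfMax lam P) (𝓝[>] 0) (𝓝 0) := by
  have hp : 0 < 2 / lam - 2 := by
    rw [sub_pos, lt_div_iff₀ h0]; linarith
  have hq : 0 < 2 / lam := by positivity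
  have hlim : ∀ p : ℝ, 0 < p → Tendsto (fun M : ℝ => M ^ p) (𝓝[>] 0) (𝓝 0) := fun p hp => by
    have := (Real.continuousAt_rpow_const 0 p (Or.inr hp.le)).tendsto
    rw [Real.zero_rpow hp.ne'] at this
    exact this.mono_left nhdsWithin_le_nhds
  have h := ((hlim _ hp).const_mul (2 * P)).add ((hlim _ hq).const_mul (lam ^ 2))
  rw [mul_zero, mul_zero, add_zero] at h
  refine h.congr' ?_
  filter_upwards [self_mem_nhdsWithin] with M hM using (bernoulliOfMax_eq hM).symm

lemma tendsto_bernoulliOfMax_of_one_lt (h1 : 1 < lam) (hP : P < 0) :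
    Tendsto (bernoulliOfMax lam P) (𝓝[>] 0) atBot := by
  have hp : 2 / lam - 2 < 0 := by
    rw [sub_neg, div_lt_iff₀ (by linarith)]; linarith
  have hq : 0 < 2 / lam := by positivity
  have h2 := tendsto_rpow_neg_nhdsGT_zero hp
  have h3 : Tendsto (fun M : ℝ => lam ^ 2 * M ^ (2 / lam)) (𝓝[>] 0) (𝓝 0) := by
    have := (Real.continuousAt_rpow_const 0 (2 / lam) (Or.inr hq.le)).tendsto.const_mul (lam ^ 2)
    rw [Real.zero_rpow hq.ne', mul_zero] at this
    exact this.mono_left nhdsWithin_le_nhds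
  refine ((h2.const_mul_atTop_of_neg (show 2 * P < 0 by linarith)).atBot_add h3).congr' ?_
  filter_upwards [self_mem_nhdsWithin] with M hM using (bernoulliOfMax_eq hM).symm

/-- The frequency hypothesis supplies a small amplitude below the target. It covers both behaviours
at `M → 0`: limit zero for `λ < 1`, and limit `-∞` for `λ > 1` with `P < 0`. -/
lemma exists_bernoulliOfMax_eq (h0 : 0 < lam) (hP : 0 ≤ P * (1 - lam)) {B : ℝ}
    (h : ∃ᶠ M in 𝓝[>] 0, bernoulliOfMax lam P M ≤ B) :
    ∃ M, 0 < M ∧ bernoulliOfMax lam P M = B := by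
  obtain ⟨x, hxB, hx⟩ := (h.and_eventually self_mem_nhdsWithin).exists
  obtain ⟨y, hy, hyB⟩ := exists_bernoulliOfMax_ge h0 hP B
  have hc : ContinuousOn (bernoulliOfMax lam P) (Ioi 0) := by
    unfold bernoulliOfMax
    exact (by fun_prop : Continuous fun M : ℝ => 2 * P + lam ^ 2 * M ^ 2).continuousOn.mul
      (continuousOn_id.rpow_const fun M hM => Or.inl (ne_of_gt hM))
  obtain ⟨M, hM, e⟩ := isPreconnected_Ioi.intermediate_value hx hy hc ⟨hxB, hyB⟩
  exact ⟨M, hM, e⟩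

/-- The life-span is a function of the Bernoulli constant. -/
theorem exists_isLifeSpanFunction (hlam : 1 / 2 < lam) (hP : 0 ≤ P * (1 - lam)) {S : Set ℝ}
    (hS : ∀ B ∈ S, ∃ M, 0 < M ∧ bernoulliOfMax lam P M = B) :
    ∃ T : ℝ → ℝ, IsLifeSpanFunction lam P S T ∧ ∀ M, 0 < M → bernoulliOfMax lam P M ∈ S →
      T (bernoulliOfMax lam P M) = timeMap lam |2 * P / (lam ^ 2 * M ^ 2)| := by
  have h0 : 0 < lam := by linarith
  -- `amp` inverts `bernoulliOfMax` on `S`; strict monotonicity makes the maximum of a local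
  -- solution a function of `B`.
  choose! amp hamp hampB using hS
  have hT : ∀ M, 0 < M → bernoulliOfMax lam P M ∈ S → amp (bernoulliOfMax lam P M) = M :=
    fun M hM hMS => (bernoulliOfMax_strictMonoOn h0 hP).injOn (hamp _ hMS) hM (hampB _ hMS)
  refine ⟨fun B => timeMap lam |2 * P / (lam ^ 2 * amp B ^ 2)|, fun B hB => ⟨?_, ?_⟩,
    fun M hM hMS => by simp only [hT M hM hMS]⟩
  · obtain ⟨ψ, h1, h2⟩ := exists_isLocalSolution hlam hP (hamp B hB)
    refine ⟨ψ, 0, _, h1, ?_⟩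
    rw [← bernoulliOfMax, hampB B hB] at h2
    exact h2
  · intro ψ a b H HB
    obtain ⟨ψ', h1⟩ := H.exists_profile h0 HB
    obtain ⟨M, hM, hBM, hl⟩ := h1.lifespan_eq h0 hP
    have h2 : bernoulliOfMax lam P M = B := hBM.symm
    have h3 := hT M hM (h2 ▸ hB)
    rw [h2] at h3
    simp only [h3, hl]

/-- No integral is evaluated: `P = -1/2` and `M = 1/λ` give `κ = -1`, hence `B = 0`, and the cosine
profile has life-span `π/λ`. -/
lemma timeMap_one (h1 : 1 < lam) : timeMap lam 1 = π / lam := by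
  have h0 : 0 < lam := by linarith
  obtain ⟨ψ, hl, hB⟩ := exists_isLocalSolution (lam := lam) (P := -1 / 2) (M := 1 / lam)
    (by linarith) (by linarith) (by positivity)
  have e : lam ^ 2 * (1 / lam) ^ 2 = 1 := by field_simp
  rw [e] at hl hB
  norm_num at hl hB
  obtain ⟨ψ', h⟩ := hl.exists_profile h0 hB
  simpa using (h.eq_cos_of_bernoulli_eq_zero h0).1

/-- In terms of `s = |κ|`, which takes every positive value, `B > 0` means `s < 1` and `B < 0` means
`s > 1`. The three ranges are those of the strictly decreasing time map on either side of `s = 1`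
and at that point. -/
lemma exists_lifespan_of_one_lt (h1 : 1 < lam) (hP : P < 0) :
    ∃ T : ℝ → ℝ, IsLifeSpanFunction lam P univ T ∧
      T '' Ioi 0 = Ioo (π / lam) π ∧ T 0 = π / lam ∧ T '' Iio 0 = Ioo 0 (π / lam) := by
  have h0 : 0 < lam := by linarith
  have hP' : 0 ≤ P * (1 - lam) := mul_nonneg_of_nonpos_of_nonpos hP.le (by linarith)
  have hex : ∀ B : ℝ, ∃ M, 0 < M ∧ bernoulliOfMax lam P M = B := fun B =>
    exists_bernoulliOfMax_eq h0 hP'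
      ((tendsto_bernoulliOfMax_of_one_lt h1 hP).eventually_le_atBot B).frequently
  obtain ⟨T, hT, hTM⟩ := exists_isLifeSpanFunction (S := univ) (by linarith) hP' fun B _ => hex B
  replace hTM := fun M hM => hTM M hM (mem_univ _)
  have hs : ∀ M, 0 < M → |2 * P / (lam ^ 2 * M ^ 2)| = -(2 * P) / (lam ^ 2 * M ^ 2) :=
    fun M hM => by
      rw [abs_of_neg (div_neg_of_neg_of_pos (by linarith) (by positivity)), neg_div]
  have hanti := timeMap_strictAntiOn (lam := lam) h1.ne'
  have hpos : ∀ M, 0 < M → 0 < |2 * P / (lam ^ 2 * M ^ 2)| := fun M hM => by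
    rw [hs M hM]
    exact div_pos (by linarith) (by positivity)
  have hBpos : ∀ M, 0 < M →
      (0 < bernoulliOfMax lam P M ↔ |2 * P / (lam ^ 2 * M ^ 2)| < 1) := fun M hM => by
    rw [hs M hM, div_lt_one (by positivity), bernoulliOfMax,
      mul_pos_iff_of_pos_right (Real.rpow_pos_of_pos hM _)]
    constructor <;> intro h <;> linarith
  have hBneg : ∀ M, 0 < M →
      (bernoulliOfMax lam P M < 0 ↔ 1 < |2 * P / (lam ^ 2 * M ^ 2)|) := fun M hM => by
    rw [hs M hM, one_lt_div (by positivity), bernoulliOfMax, ← neg_pos, ← neg_mul,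
      mul_pos_iff_of_pos_right (Real.rpow_pos_of_pos hM _)]
    constructor <;> intro h <;> linarith
  have hone : (1 : ℝ) ∈ Ici (0 : ℝ) := mem_Ici.2 zero_le_one
  refine ⟨T, hT, ?_, ?_, ?_⟩
  · apply Subset.antisymm
    · rintro _ ⟨B, hB, rfl⟩
      obtain ⟨M, hM, rfl⟩ := hex B
      rw [hTM M hM, ← timeMap_one h1, ← timeMap_zero lam]
      exact ⟨hanti (hpos M hM).le hone ((hBpos M hM).1 hB),
        hanti self_mem_Ici (hpos M hM).le (hpos M hM)⟩
    · intro y hy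
      obtain ⟨t, ht, rfl⟩ := exists_timeMap_eq h1.ne' le_rfl (y := y) (by
        rw [timeMap_zero]
        exact ⟨(by positivity : (0 : ℝ) < π / lam).trans hy.1, hy.2⟩)
      obtain ⟨M, hM, rfl⟩ := exists_amplitude hP.ne h0 ht
      refine ⟨bernoulliOfMax lam P M, (hBpos M hM).2 ?_, hTM M hM⟩
      rw [← timeMap_one h1] at hy
      exact (hanti.lt_iff_gt hone ht.le).1 hy.1
  · obtain ⟨M, hM, e⟩ := hex 0
    rw [← e, hTM M hM, ← timeMap_one h1]
    congr 1
    have e1 := mt (hBpos M hM).2 (by rw [e]; exact lt_irrefl _)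
    have e2 := mt (hBneg M hM).2 (by rw [e]; exact lt_irrefl _)
    exact le_antisymm (not_lt.1 e2) (not_lt.1 e1)
  · apply Subset.antisymm
    · rintro _ ⟨B, hB, rfl⟩
      obtain ⟨M, hM, rfl⟩ := hex B
      rw [hTM M hM, ← timeMap_one h1]
      exact ⟨timeMap_pos (abs_nonneg _), hanti hone (hpos M hM).le ((hBneg M hM).1 hB)⟩
    · intro y hy
      rw [← timeMap_one h1] at hy
      obtain ⟨t, ht, rfl⟩ := exists_timeMap_eq h1.ne' zero_le_one hy
      obtain ⟨M, hM, rfl⟩ := exists_amplitude hP.ne h0 (zero_lt_one.trans ht)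
      exact ⟨bernoulliOfMax lam P M, (hBneg M hM).2 ht, hTM M hM⟩

lemma bernoulliOfMax_pos (h0 : lam ≠ 0) (hP : 0 < P) {M : ℝ} (hM : 0 < M) :
    0 < bernoulliOfMax lam P M := by
  unfold bernoulliOfMax
  positivity

/-- Every amplitude has positive Bernoulli constant here, so `s` runs through all of `(0, ∞)` and
the time map through all values below `timeMap lam 0 = π`. -/
lemma exists_lifespan_of_lt_one (hlam : 1 / 2 < lam) (h1 : lam < 1) (hP : 0 < P) :
    ∃ T : ℝ → ℝ, IsLifeSpanFunction lam P (Ioi 0) T ∧ T '' Ioi 0 = Ioo 0 π := by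
  have h0 : 0 < lam := by linarith
  have hP' : 0 ≤ P * (1 - lam) := mul_nonneg hP.le (by linarith)
  have hex : ∀ B ∈ Ioi (0 : ℝ), ∃ M, 0 < M ∧ bernoulliOfMax lam P M = B := fun B hB =>
    exists_bernoulliOfMax_eq h0 hP'
      ((tendsto_bernoulliOfMax_of_lt_one h0 h1).eventually_le_const hB).frequently
  obtain ⟨T, hT, hTM⟩ := exists_isLifeSpanFunction hlam hP' hex
  replace hTM := fun M hM => hTM M hM (bernoulliOfMax_pos h0.ne' hP hM)
  refine ⟨T, hT, Subset.antisymm ?_ fun y hy => ?_⟩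
  · rintro _ ⟨B, hB, rfl⟩
    obtain ⟨M, hM, rfl⟩ := hex B hB
    have hpos : 0 < |2 * P / (lam ^ 2 * M ^ 2)| := abs_pos.2 (by positivity)
    rw [hTM M hM]
    refine ⟨timeMap_pos (abs_nonneg _), ?_⟩
    rw [← timeMap_zero lam]
    exact timeMap_strictAntiOn h1.ne self_mem_Ici hpos.le hpos
  · rw [← timeMap_zero lam] at hy
    obtain ⟨t, ht, rfl⟩ := exists_timeMap_eq h1.ne le_rfl hy
    obtain ⟨M, hM, rfl⟩ := exists_amplitude hP.ne' h0 ht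
    exact ⟨_, bernoulliOfMax_pos h0.ne' hP hM, hTM M hM⟩

lemma IsLocalSolution.bernoulli_pos (hP : 0 < P) {ψ : ℝ → ℝ} {a b B : ℝ}
    (H : IsLocalSolution lam P ψ a b) (HB : HasBernoulli lam P B ψ a b) : 0 < B := by
  have hmid : (a + b) / 2 ∈ Ioo a b := ⟨by linarith [H.1], by linarith [H.1]⟩
  rw [← (HB _ hmid).2]
  have := abs_pos.2 (H.2.2.2.1 _ hmid)
  positivity

end

end HomEuler

theorem mainTheorem9 :
    -- hyperbolic solutions, 1/2 < λ < 1
    (∀ lam : ℝ, 1 / 2 < lam → lam < 1 →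
      (∀ P : ℝ, 0 < P → HomEuler.InfinitelyManyHyperbolic lam P) ∧
      (∀ P : ℝ, P < 0 → ∀ ψ : ℝ → ℝ, ¬ HomEuler.IsHyperbolic lam P ψ)) ∧
    -- hyperbolic solutions, 0 < λ ≤ 1/2
    (∀ lam : ℝ, 0 < lam → lam ≤ 1 / 2 →
      ∀ (P : ℝ) (ψ : ℝ → ℝ), ¬ HomEuler.IsHyperbolic lam P ψ) ∧
    -- hyperbolic solutions, λ > 1
    (∀ lam : ℝ, 1 < lam →
      (∀ P : ℝ, P < 0 → HomEuler.InfinitelyManyHyperbolic lam P) ∧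
      (∀ P : ℝ, 0 < P → ∀ ψ : ℝ → ℝ, ¬ HomEuler.IsHyperbolic lam P ψ)) ∧
    -- every local solution has a Bernoulli constant
    (∀ (lam P : ℝ) (ψ : ℝ → ℝ) (a b : ℝ), 0 < lam → HomEuler.IsLocalSolution lam P ψ a b →
      ∃ B : ℝ, HomEuler.HasBernoulli lam P B ψ a b) ∧
    -- ranges of the life-span, λ > 1 and P < 0
    (∀ lam P : ℝ, 1 < lam → P < 0 →
      ∃ T : ℝ → ℝ, HomEuler.IsLifeSpanFunction lam P Set.univ T ∧
        T '' Set.Ioi 0 = Set.Ioo (Real.pi / lam) Real.pi ∧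
        T 0 = Real.pi / lam ∧
        T '' Set.Iio 0 = Set.Ioo 0 (Real.pi / lam)) ∧
    -- ranges of the life-span, 1/2 < λ < 1 and P > 0; all Bernoulli constants are positive
    (∀ lam P : ℝ, 1 / 2 < lam → lam < 1 → 0 < P →
      (∀ (ψ : ℝ → ℝ) (a b B : ℝ), HomEuler.IsLocalSolution lam P ψ a b →
        HomEuler.HasBernoulli lam P B ψ a b → 0 < B) ∧
      ∃ T : ℝ → ℝ, HomEuler.IsLifeSpanFunction lam P (Set.Ioi 0) T ∧
        T '' Set.Ioi 0 = Set.Ioo 0 Real.pi) ∧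
    -- 1/2 < λ < 1, P < 0 and B > 0: life-spans are too long to fit twice in the circle
    (∀ lam P B : ℝ, 1 / 2 < lam → lam < 1 → P < 0 → 0 < B →
      ∀ (ψ : ℝ → ℝ) (a b : ℝ), HomEuler.IsLocalSolution lam P ψ a b →
        HomEuler.HasBernoulli lam P B ψ a b → b - a ∈ Set.Ioo Real.pi (Real.pi / lam)) ∧
    -- 0 < λ ≤ 1/2 and B > 0: there are no local solutions
    (∀ lam P B : ℝ, 0 < lam → lam ≤ 1 / 2 → 0 < B →
      ∀ (ψ : ℝ → ℝ) (a b : ℝ), HomEuler.IsLocalSolution lam P ψ a b →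
        ¬ HomEuler.HasBernoulli lam P B ψ a b) ∧
    -- parabolic solutions
    (∀ (lam P : ℝ) (ψ : ℝ → ℝ), 0 < lam →
      (HomEuler.IsParabolic lam P ψ ↔
        lam = 1 / 2 ∧ ∃ γ ε θ₀ : ℝ, 0 < γ ∧ (ε = 1 ∨ ε = -1) ∧ P = -γ / 4 ∧
          ∀ θ : ℝ, ψ θ = ε * Real.sqrt (γ + γ * Real.cos (θ - θ₀)))) := by
  refine ⟨fun lam h1 h2 => ⟨fun P hP => ?_, fun P hP ψ => ?_⟩, fun lam h1 h2 P ψ => ?_,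
    fun lam h1 => ⟨fun P hP => ?_, fun P hP ψ => ?_⟩, fun lam P ψ a b h0 H => ?_,
    fun lam P h1 hP => ?_, fun lam P h1 h2 hP => ⟨fun ψ a b B H HB => ?_, ?_⟩,
    fun lam P B h1 h2 hP hB ψ a b H HB => ?_, fun lam P B h0 h1 hB ψ a b H HB => ?_,
    fun lam P ψ h0 => HomEuler.isParabolic_iff h0⟩
  · exact HomEuler.infinitelyManyHyperbolic h1 (mul_pos hP (by linarith))
  · exact HomEuler.not_isHyperbolic_of_lt_one (by linarith) h2 hP
  · exact HomEuler.not_isHyperbolic_of_le_half h1 h2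
  · exact HomEuler.infinitelyManyHyperbolic (by linarith)
      (mul_pos_of_neg_of_neg hP (by linarith))
  · exact HomEuler.not_isHyperbolic_of_one_lt h1 hP
  · exact H.exists_hasBernoulli h0
  · exact HomEuler.exists_lifespan_of_one_lt h1 hP
  · exact H.bernoulli_pos hP HB
  · exact HomEuler.exists_lifespan_of_lt_one h1 h2 hP
  · obtain ⟨ψ', h⟩ := H.exists_profile (by linarith) HB
    exact h.lifespan_mem_Ioo (by linarith) h2 hP hB
  · obtain ⟨ψ', h⟩ := H.exists_profile h0 HB
    exact hB.ne' (h.bernoulli_eq_zero_of_le_half h0 h1)
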